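/- Consider a cellular network in $\mathbb R^2$ with finitely many tiers of base stations (BSs), indexed by $\mathcal K=\mathcal K_1\sqcup\mathcal K_2$. Let $\alpha>2$, $\mathtt N_0\ge 0$, and for $k\in\mathcal K$ let $P_k>0$ (transmit power) and $\tau_k>0$ (threshold). For $k\in\mathcal K_1$, $\Phi_k$ is a Poisson cluster process $\bigcup_{\mathbf z\in\Phi_{\mathrm p_k}}(\mathbf z+\mathcal B_k^{\mathbf z})$: the parent process $\Phi_{\mathrm p_k}$ is a homogeneous Poisson point process (PPP) of intensity $\lambda_{\mathrm p_k}>0$; each $\mathcal B_k^{\mathbf z}$ consists of a $\mathrm{Poisson}(\bar m_k)$ number ($\bar m_k>0$) of i.i.d. points with probability density $g_k$ on $\mathbb R^2$, where $g_k(\mathbf s)$ depends only on $\|\mathbf s\|$. For $k\in\mathcal K_2$, $\Phi_k$ is a homogeneous PPP of intensity $\lambda_k>0$. Every BS $\mathbf x$ has a fading variable $h_{\mathbf x}\sim\mathrm{Exp}(1)$. The user is at a location $\mathbf u$, deterministic (for instance the origin) or random. All parent processes, cluster sizes, offspring points, PPP tiers, fading variables and the location of the user are mutually independent. The user is served by the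 BS $\mathbf x^*$ that maximizes the average received power $P_k\|\mathbf x-\mathbf u\|^{-\alpha}$ over all $k\in\mathcal K$ and $\mathbf x\in\Phi_k$; let $\mathcal S_i$ be the event that $\mathbf x^*\in\Phi_i$. On $\mathcal S_i$ put $$\mathrm{SINR}=\frac{P_i h_{\mathbf x^*}\|\mathbf x^*-\mathbf u\|^{-\alpha}}{\mathtt N_0+\sum_{j\in\mathcal K}\sum_{\mathbf x\in\Phi_j\setminus\{\mathbf x^*\}}P_jh_{\mathbf x}\|\mathbf x-\mathbf u\|^{-\alpha}},$$ and let $\mathtt{P_c}=\mathbb P\big(\bigcup_{i\in\mathcal K}\{\mathrm{SINR}>\tau_i\}\cap\mathcal S_i\big)$ be the coverage probability. Let $\bar P_{j,i}=(P_j/P_i)^{1/\alpha}$. For $k\in\mathcal K_1$ let $f_{\mathrm d_k}(r\mid z)=r\int_0^{2\pi}g_k(r\cos\theta-z,\,r\sin\theta)\,d\theta$, which is the conditional density of the distance to the origin of a point of $\Phi_k$ given that its cluster center is at distance $z$ from the origin. Let $$\mathcal C_{j,i}(r,z)=\exp\left(-\bar m_j\left(1-\int_{\bar P_{j,i}r}^\infty\frac{f_{\mathrm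 d_j}(y\mid z)}{1+\tau_i(\bar P_{j,i}r)^\alpha y^{-\alpha}}\,dy\right)\right),\qquad \rho(\tau,\alpha)=1+\tau^{2/\alpha}\int_{\tau^{-2/\alpha}}^\infty\frac{dt}{1+t^{\alpha/2}},$$ $$A_i(r)=\exp\left(-\frac{\tau_i\mathtt N_0r^\alpha}{P_i}\right)\prod_{j\in\mathcal K_1}\exp\left(-2\pi\lambda_{\mathrm p_j}\int_0^\infty(1-\mathcal C_{j,i}(r,z))z\,dz\right)\exp\left(-\pi r^2\sum_{j\in\mathcal K_2}\lambda_j\bar P_{j,i}^2\rho(\tau_i,\alpha)\right).$$ Then $\mathtt{P_c}=\sum_{i\in\mathcal K}\mathbb P(\mathrm{SINR}>\tau_i,\mathcal S_i)$, where $$\mathbb P(\mathrm{SINR}>\tau_i,\mathcal S_i)=2\pi\lambda_{\mathrm p_i}\bar m_i\int_0^\infty A_i(r)\int_0^\infty f_{\mathrm d_i}(r\mid z)\,\mathcal C_{i,i}(r,z)\,z\,dz\,dr\quad\text{for } i\in\mathcal K_1,$$ $$\mathbb P(\mathrm{SINR}>\tau_i,\mathcal S_i)=2\pi\lambda_i\int_0^\infty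 A_i(r)\,r\,dr\quad\text{for } i\in\mathcal K_2,$$ and the integrals over $z$ (for every $r>0$) and over $r$ in these formulas converge absolutely. -/

import Mathlib

open MeasureTheory ProbabilityTheory Set

open scoped ENNReal

noncomputable section

/-- The Euclidean plane. -/
abbrev Plane : Type := EuclideanSpace ℝ (Fin 2)

/-- The number of points (with multiplicity) of the enumerated point process `X` in `A`. -/
def pointCount {Ω : Type*} (X : ℕ → Ω → Plane) (A : Set Plane) (ω : Ω) : ℕ∞ :=
  {n : ℕ | X n ω ∈ A}.encard

/-- `X` enumerates the points of a homogeneous Poisson point process in the plane with intensity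
`lam`: the number of points in a Borel set `A` of finite area is Poisson with mean `lam * |A|`, and
the numbers of points in pairwise disjoint Borel sets of finite area are independent. (For
`0 < lam` such a process almost surely has infinitely many points.) -/
structure IsHomogeneousPPP {Ω : Type*} [MeasurableSpace Ω] (μ : Measure Ω)
    (X : ℕ → Ω → Plane) (lam : ℝ) : Prop where
  measurable : ∀ n, Measurable (X n)
  poisson : ∀ A : Set Plane, MeasurableSet A → volume A ≠ ∞ → ∀ m : ℕ,
    μ {ω | pointCount X A ω = (m : ℕ∞)} =
      poissonMeasure (Real.toNNReal (lam * (volume A).toReal)) {m}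
  indep : ∀ (d : ℕ) (A : Fin d → Set Plane), (∀ a, MeasurableSet (A a)) →
    (∀ a, volume (A a) ≠ ∞) → Pairwise (fun a b => Disjoint (A a) (A b)) →
    iIndepFun (fun a ω => pointCount X (A a) ω) μ

/-- Parameters of a multi-tier cellular network. The tiers in `κ₁` are Poisson cluster processes,
those in `κ₂` are homogeneous Poisson point processes; the set of all tiers is `κ₁ ⊕ κ₂`. -/
structure HetNet (κ₁ κ₂ : Type*) where
  /-- transmit powers -/
  P : κ₁ ⊕ κ₂ → ℝ
  P_pos : ∀ k, 0 < P k
  /-- coverage thresholds -/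
  τ : κ₁ ⊕ κ₂ → ℝ
  τ_pos : ∀ k, 0 < τ k
  /-- path-loss exponent -/
  α : ℝ
  two_lt_α : 2 < α
  /-- thermal noise power -/
  N₀ : ℝ
  N₀_nonneg : 0 ≤ N₀
  /-- intensities of the parent processes -/
  lamP : κ₁ → ℝ
  lamP_pos : ∀ k, 0 < lamP k
  /-- mean numbers of points per cluster -/
  mbar : κ₁ → ℝ
  mbar_pos : ∀ k, 0 < mbar k
  /-- (Cartesian) probability densities of the offspring points around the cluster center -/
  g : κ₁ → Plane → ℝ
  g_measurable : ∀ k, Measurable (g k)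
  g_nonneg : ∀ k x, 0 ≤ g k x
  g_lintegral : ∀ k, ∫⁻ x, ENNReal.ofReal (g k x) = 1
  /-- the offspring points are isotropically distributed around the cluster center -/
  g_isotropic : ∀ k x y, ‖x‖ = ‖y‖ → g k x = g k y
  /-- intensities of the Poisson tiers -/
  lam : κ₂ → ℝ
  lam_pos : ∀ k, 0 < lam k

/-- Labels of (potential) base stations: `inl (k, n, l)` is the `l`-th offspring point of the `n`-th
cluster of the cluster tier `k`, and `inr (k, n)` is the `n`-th point of the Poisson tier `k`. -/
abbrev BSIndex (κ₁ κ₂ : Type*) : Type _ := (κ₁ × ℕ × ℕ) ⊕ (κ₂ × ℕ)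

/-- The tier to which a base station belongs. -/
def BSIndex.tier {κ₁ κ₂ : Type*} : BSIndex κ₁ κ₂ → κ₁ ⊕ κ₂
  | .inl (k, _, _) => .inl k
  | .inr (k, _) => .inr k

/-- The random elements from which a realization of the network is built. -/
structure Realization (Ω κ₁ κ₂ : Type*) where
  /-- location of the user -/
  user : Ω → Plane
  /-- `parent k n` is the `n`-th cluster center of the cluster tier `k` -/
  parent : κ₁ → ℕ → Ω → Plane
  /-- `size k n` is the number of points of the `n`-th cluster of tier `k` -/
  size : κ₁ → ℕ → Ω → ℕ
  /-- `offspring k n l` is the position relative to the cluster center of the `l`-th point of the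
  `n`-th cluster of tier `k`; only the points with `l < size k n` are present -/
  offspring : κ₁ → ℕ → ℕ → Ω → Plane
  /-- `point k n` is the `n`-th point of the Poisson tier `k` -/
  point : κ₂ → ℕ → Ω → Plane
  /-- `fading b` is the small scale fading of the link between the user and base station `b` -/
  fading : BSIndex κ₁ κ₂ → Ω → ℝ

/-- Labels of the random elements of a realization that are required to be independent. -/
inductive Source (κ₁ κ₂ : Type*) where
  | user : Source κ₁ κ₂
  | parent (k : κ₁) : Source κ₁ κ₂
  | size (k : κ₁) (n : ℕ) : Source κ₁ κ₂
  | offspring (k : κ₁) (n l : ℕ) : Source κ₁ κ₂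
  | point (k : κ₂) : Source κ₁ κ₂
  | fading (b : BSIndex κ₁ κ₂) : Source κ₁ κ₂

namespace Realization

variable {Ω κ₁ κ₂ : Type*} (R : Realization Ω κ₁ κ₂)

/-- The σ-algebra generated by each of the random elements. A parent process or a Poisson tier
counts as one random element. -/
@[reducible]
def sigma : Source κ₁ κ₂ → MeasurableSpace Ω
  | .user => MeasurableSpace.comap R.user inferInstance
  | .parent k => MeasurableSpace.comap (fun ω n => R.parent k n ω) inferInstance
  | .size k n => MeasurableSpace.comap (R.size k n) inferInstance
  | .offspring k n l => MeasurableSpace.comap (R.offspring k n l) inferInstance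
  | .point k => MeasurableSpace.comap (fun ω n => R.point k n ω) inferInstance
  | .fading b => MeasurableSpace.comap (R.fading b) inferInstance

/-- Whether the potential base station `b` is present. -/
def Present (ω : Ω) : BSIndex κ₁ κ₂ → Prop
  | .inl (k, n, l) => l < R.size k n ω
  | .inr _ => True

/-- The location of the base station `b`. -/
def loc (ω : Ω) : BSIndex κ₁ κ₂ → Plane
  | .inl (k, n, l) => R.parent k n ω + R.offspring k n l ω
  | .inr (k, n) => R.point k n ω

/-- The power received by the user from the base station `b`, averaged over fading. -/
def meanPower (D : HetNet κ₁ κ₂) (ω : Ω) (b : BSIndex κ₁ κ₂) : ℝ :=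
  D.P b.tier * ‖R.loc ω b - R.user ω‖ ^ (-D.α)

/-- The power received by the user from the base station `b`. -/
def rxPower (D : HetNet κ₁ κ₂) (ω : Ω) (b : BSIndex κ₁ κ₂) : ℝ :=
  D.P b.tier * R.fading b ω * ‖R.loc ω b - R.user ω‖ ^ (-D.α)

/-- `b` is the serving base station: it maximizes the average received power. -/
def IsServing (D : HetNet κ₁ κ₂) (ω : Ω) (b : BSIndex κ₁ κ₂) : Prop :=
  R.Present ω b ∧ ∀ b', R.Present ω b' → R.meanPower D ω b' ≤ R.meanPower D ω b

/-- The signal to interference and noise ratio of the link from `b` to the user. -/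
def sinr (D : HetNet κ₁ κ₂) (ω : Ω) (b : BSIndex κ₁ κ₂) : ℝ≥0∞ :=
  ENNReal.ofReal (R.rxPower D ω b) /
    (ENNReal.ofReal D.N₀ +
      ∑' b' : {b' : BSIndex κ₁ κ₂ // R.Present ω b' ∧ b' ≠ b}, ENNReal.ofReal (R.rxPower D ω b'))

/-- The event that the user is served by tier `i` and that its SINR exceeds the threshold of
tier `i`. -/
def tierCoverage (D : HetNet κ₁ κ₂) (i : κ₁ ⊕ κ₂) : Set Ω :=
  {ω | ∃ b : BSIndex κ₁ κ₂, b.tier = i ∧ R.IsServing D ω b ∧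
    ENNReal.ofReal (D.τ i) < R.sinr D ω b}

/-- The event that the user is in coverage. -/
def coverage (D : HetNet κ₁ κ₂) : Set Ω := ⋃ i, R.tierCoverage D i

/-- The law of the network without coupling between the user and the base stations: the parent
processes and the Poisson tiers are homogeneous Poisson point processes, the cluster sizes are
Poisson, the offspring points have density `g`, the fading variables are exponential with mean `1`,
and all of these, and the location of the user, are independent. -/
structure IsUncoupled [MeasurableSpace Ω] (D : HetNet κ₁ κ₂) (μ : Measure Ω) : Prop where
  user_measurable : Measurable R.user
  parent_ppp : ∀ k, IsHomogeneousPPP μ (R.parent k) (D.lamP k)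
  size_measurable : ∀ k n, Measurable (R.size k n)
  size_law : ∀ k n, μ.map (R.size k n) = poissonMeasure (Real.toNNReal (D.mbar k))
  offspring_measurable : ∀ k n l, Measurable (R.offspring k n l)
  offspring_law : ∀ k n l,
    μ.map (R.offspring k n l) = volume.withDensity (fun x => ENNReal.ofReal (D.g k x))
  point_ppp : ∀ k, IsHomogeneousPPP μ (R.point k) (D.lam k)
  fading_measurable : ∀ b, Measurable (R.fading b)
  fading_law : ∀ b, μ.map (R.fading b) = expMeasure 1
  indep : iIndep R.sigma μ

end Realization

namespace HetNet

variable {κ₁ κ₂ : Type*} (D : HetNet κ₁ κ₂)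

/-- The conditional density at `r > 0` of the distance to the origin of a point of the cluster tier
`k`, given that its cluster center is at distance `z` from the origin: the density
`x ↦ g (x - (z, 0))` in polar coordinates, integrated over the angle. -/
def fd (k : κ₁) (r z : ℝ) : ℝ :=
  r * ∫ θ in (0 : ℝ)..(2 * Real.pi), D.g k !₂[r * Real.cos θ - z, r * Real.sin θ]

/-- `(P j / P i) ^ (1 / α)`. -/
def Pbar (j i : κ₁ ⊕ κ₂) : ℝ := (D.P j / D.P i) ^ (1 / D.α)

/-- The function `𝒞_{j,i}(r, z)`. -/
def C (j : κ₁) (i : κ₁ ⊕ κ₂) (r z : ℝ) : ℝ :=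
  Real.exp (-D.mbar j * (1 - ∫ y in Ioi (D.Pbar (.inl j) i * r),
    D.fd j y z / (1 + D.τ i * ((D.Pbar (.inl j) i * r) ^ D.α / y ^ D.α))))

/-- The function `ρ(τ, α)`. -/
def rho (τ α : ℝ) : ℝ :=
  1 + τ ^ (2 / α) * ∫ t in Ioi (τ ^ (-2 / α)), 1 / (1 + t ^ (α / 2))

variable [Fintype κ₁] [Fintype κ₂]

/-- The factors that the integrands for the coverage probabilities of all tiers `i` share. -/
def commonFactor (i : κ₁ ⊕ κ₂) (r : ℝ) : ℝ :=
  Real.exp (-(D.τ i * D.N₀ * r ^ D.α / D.P i)) *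
    (∏ j : κ₁, Real.exp (-(2 * Real.pi * D.lamP j * ∫ z in Ioi (0 : ℝ), (1 - D.C j i r z) * z))) *
    Real.exp (-(Real.pi * r ^ 2 *
      ∑ j : κ₂, D.lam j * D.Pbar (.inr j) i ^ 2 * rho (D.τ i) D.α))

/-- The integrand for the coverage probability of the cluster tier `i`. -/
def clusterIntegrand (i : κ₁) (r : ℝ) : ℝ :=
  D.commonFactor (.inl i) r * ∫ z in Ioi (0 : ℝ), D.fd i r z * D.C i (.inl i) r z * z

/-- The integrand for the coverage probability of the Poisson tier `i`. -/
def poissonIntegrand (i : κ₂) (r : ℝ) : ℝ :=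
  D.commonFactor (.inr i) r * r

end HetNet

end

section

open Filter Topology

set_option linter.unusedSectionVars false

/-! ### The function `t ↦ exp (-t)` on `[0, ∞]` -/

/-! Fix a candidate server in tier `i` at distance `r` from the user. It serves if no station of any
tier `j` lies within `Pbar j i * r`, and it covers if its own fading exceeds `τ i * r ^ α / P i`
times noise plus interference. That fading is exponential and independent of everything else, so the
conditional probability of coverage is the exponential of minus noise plus interference, scaled by
that factor. Exclusion can be put into the same exponent by giving weight `⊤` to every station
inside its exclusion disc (`HetNet.exclusionWeight`); this is why all Laplace functionals are
written with `expNeg` on `[0, ∞]`. The probability of coverage by tier `i` thus becomes the mean of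
a sum, over stations `b`, of `exp` of minus an additive functional of the other stations.

Such means are given by a reduced Campbell formula, `lintegral_palm`: the factor for the tier of `b`
is an intensity weighted by the siblings of `b` in its cluster (`HetNet.palmDensity`), and every
tier contributes its Laplace functional (`HetNet.tierLaplace`). The formula is derived from Poisson
counts. For step functions it follows from the generating function of the Poisson law and its
size-biased version; monotone limits give general exponents; independent marks are integrated out,
and a cluster is treated as a mark of its parent. Independence of the tiers and of the user's
location finishes it.

In the Campbell formula the exponent must not depend on the selected point, whereas here it depends
on `r`. So `r` is replaced by an end of its cell of width `1 / (n + 1)`. The lower end yields an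
upper bound for the coverage event (union bound, `measure_tierCoverage_le`); the upper end yields a
lower bound for coverage by a unique server, where the events are disjoint
(`lintegral_coverageDensity_le`). Both bounds converge to the integral of `HetNet.coverageDensity`,
which is continuous in the radius because spheres are null sets. Hence equality
(`measure_tierCoverage`), and ties have no influence, which gives additivity over the tiers.

What remains is calculus. The fading of an interferer averages to `1 / (1 + c)`; polar coordinates
and isotropy of `g` turn the means over clusters into `C` (`HetNet.clusterLaplace_fadedWeight`) and
the Poisson exponents into `rho` (`HetNet.lintegral_one_sub_fadedWeight`). Integrability is
automatic from nonnegativity, since the extended integrals are already known to be finite; the outer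
one is a probability up to a constant. -/

/-- The decreasing function `t ↦ exp (-t)` on `[0, ∞]`, with value `0` at `∞`. -/
noncomputable def expNeg (t : ℝ≥0∞) : ℝ≥0∞ := EReal.exp (-(t : EReal))

/-- The inverse of `expNeg` on `[0, 1]`. -/
noncomputable def negLog (w : ℝ≥0∞) : ℝ≥0∞ := (-ENNReal.log w).toENNReal

@[simp] lemma expNeg_zero : expNeg 0 = 1 := by simp [expNeg]

@[simp] lemma expNeg_top : expNeg ⊤ = 0 := by simp [expNeg]

lemma expNeg_add (a b : ℝ≥0∞) : expNeg (a + b) = expNeg a * expNeg b := by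
  rw [expNeg, expNeg, expNeg, ← EReal.exp_add, EReal.coe_ennreal_add,
    EReal.neg_add (by simp) (by simp)]
  rfl

lemma expNeg_antitone : Antitone expNeg := fun a b h => by
  unfold expNeg
  rw [EReal.exp_le_exp_iff, EReal.neg_le_neg_iff]
  exact_mod_cast h

lemma expNeg_le_one (a : ℝ≥0∞) : expNeg a ≤ 1 := by
  simpa using expNeg_antitone (zero_le (a := a))

lemma continuous_expNeg : Continuous expNeg :=
  ENNReal.continuous_exp.comp (continuous_neg.comp continuous_coe_ennreal_ereal)

@[fun_prop]
lemma measurable_expNeg : Measurable expNeg := continuous_expNeg.measurable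

lemma expNeg_ofReal {r : ℝ} (hr : 0 ≤ r) :
    expNeg (ENNReal.ofReal r) = ENNReal.ofReal (Real.exp (-r)) := by
  rw [expNeg, EReal.coe_ennreal_ofReal, max_eq_left hr, ← EReal.coe_neg, EReal.exp_coe]

lemma expNeg_ne_top (a : ℝ≥0∞) : expNeg a ≠ ⊤ :=
  ((expNeg_le_one a).trans_lt ENNReal.one_lt_top).ne

lemma expNeg_ne_zero {a : ℝ≥0∞} (ha : a ≠ ⊤) : expNeg a ≠ 0 := by
  simpa [expNeg, EReal.exp_eq_zero_iff] using ha

lemma expNeg_sum {ι : Type*} (s : Finset ι) (a : ι → ℝ≥0∞) :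
    expNeg (∑ i ∈ s, a i) = ∏ i ∈ s, expNeg (a i) := by
  induction s using Finset.cons_induction with
  | empty => simp
  | cons i s hi ih => simp [expNeg_add, ih]

lemma expNeg_mul_natCast (a : ℝ≥0∞) (n : ℕ) : expNeg (a * n) = expNeg a ^ n := by
  induction n with
  | zero => simp
  | succ n ih => rw [Nat.cast_succ, mul_add, mul_one, expNeg_add, ih, pow_succ]

lemma tendsto_expNeg_sum_range (a : ℕ → ℝ≥0∞) :
    Tendsto (fun N => ∏ n ∈ Finset.range N, expNeg (a n)) atTop (𝓝 (expNeg (∑' n, a n))) := by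
  simp_rw [← expNeg_sum]
  exact (continuous_expNeg.tendsto _).comp (ENNReal.tendsto_nat_tsum a)

/-- At `w = 0` the exponent is `⊤`. Thus every mean weight in `[0, 1]`, including `0`, can be fed
back as an exponent into formulas about `expNeg`. -/
lemma expNeg_negLog {w : ℝ≥0∞} (hw : w ≤ 1) : expNeg (negLog w) = w := by
  have : (0 : EReal) ≤ -ENNReal.log w := by
    rw [EReal.le_neg]; simpa using hw
  rw [expNeg, negLog, EReal.coe_toENNReal this, neg_neg, ENNReal.exp_log]

@[fun_prop]
lemma measurable_negLog : Measurable negLog :=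
  measurable_ereal_toENNReal.comp (measurable_neg.comp ENNReal.measurable_log)

lemma one_sub_expNeg_le (t : ℝ≥0∞) : 1 - expNeg t ≤ t := by
  rcases eq_or_ne t ⊤ with rfl | ht
  · simp
  · rw [← ENNReal.ofReal_toReal ht, expNeg_ofReal ENNReal.toReal_nonneg, ← ENNReal.ofReal_one,
      ← ENNReal.ofReal_sub _ (Real.exp_pos _).le]
    apply ENNReal.ofReal_le_ofReal
    linarith [Real.add_one_le_exp (-t.toReal)]

/-! ### Poisson sums -/

lemma tsum_poissonMeasure_mul_pow (a : NNReal) {w : ℝ≥0∞} (hw : w ≤ 1) :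
    ∑' m : ℕ, poissonMeasure a {m} * w ^ m = expNeg (a * (1 - w)) := by
  lift w to NNReal using (hw.trans_lt ENNReal.one_lt_top).ne
  have hw' : (w : ℝ) ≤ 1 := by exact_mod_cast hw
  have h1 : ∀ m : ℕ, poissonMeasure a {m} * (w : ℝ≥0∞) ^ m =
      ENNReal.ofReal (Real.exp (-a) * ((a * w : ℝ) ^ m / (m.factorial : ℝ))) := fun m => by
    rw [poissonMeasure_singleton, ← ENNReal.ofReal_coe_nnreal (p := w),
      ← ENNReal.ofReal_pow w.coe_nonneg, ← ENNReal.ofReal_mul (by positivity)]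
    congr 1
    rw [mul_pow]; ring
  simp_rw [h1]
  have hs : HasSum (fun m : ℕ => Real.exp (-a) * ((a * w : ℝ) ^ m / (m.factorial : ℝ)))
      (Real.exp (-a) * Real.exp (a * w)) := by
    have := NormedSpace.expSeries_div_hasSum_exp (𝔸 := ℝ) (a * w : ℝ)
    rw [← Real.exp_eq_exp_ℝ] at this
    exact this.mul_left _
  rw [← ENNReal.ofReal_tsum_of_nonneg (fun m => by positivity) hs.summable, hs.tsum_eq,
    ← Real.exp_add]
  have : (a : ℝ≥0∞) * (1 - w) = ENNReal.ofReal (a * (1 - w)) := by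
    rw [ENNReal.ofReal_mul a.coe_nonneg, ENNReal.ofReal_sub _ w.coe_nonneg]
    simp
  rw [this, expNeg_ofReal (mul_nonneg a.coe_nonneg (by linarith))]
  congr 2; ring

/-- The Poisson weights satisfy `p (m + 1) * (m + 1) = a * p m`, so size-biasing and removing one
point reproduces the same law. Both Campbell formulas, for point processes and for clusters, rest on
this. -/
lemma tsum_poissonMeasure_mul_natCast_mul_pow (a : NNReal) {w : ℝ≥0∞} (hw : w ≤ 1) :
    ∑' m : ℕ, poissonMeasure a {m} * (m * w ^ (m - 1)) = a * expNeg (a * (1 - w)) := by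
  rw [← tsum_poissonMeasure_mul_pow a hw, ← ENNReal.tsum_mul_left,
    tsum_eq_zero_add' ENNReal.summable]
  simp only [Nat.cast_zero, zero_mul, mul_zero, zero_add, Nat.add_sub_cancel]
  congr 1; ext m
  have : poissonMeasure a {m + 1} * ((m + 1 : ℕ) : ℝ≥0∞) = a * poissonMeasure a {m} := by
    rw [poissonMeasure_singleton, poissonMeasure_singleton, ← ENNReal.ofReal_natCast,
      ← ENNReal.ofReal_mul (by positivity), ← ENNReal.ofReal_coe_nnreal (p := a),
      ← ENNReal.ofReal_mul a.coe_nonneg, Nat.factorial_succ]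
    congr 1
    push_cast
    have : (m.factorial : ℝ) ≠ 0 := by positivity
    field_simp
    ring
  rw [← mul_assoc, this, mul_assoc]

/-! ### Independence -/

section Independence

variable {Ω : Type*} {mΩ : MeasurableSpace Ω} {μ : Measure Ω}

/-- Induction over finite subfamilies: the block split off is independent of the join of the
remaining ones. It is used to group the sources of randomness by point, by cluster and by tier. -/
lemma iIndep_iSup_of_pairwise_disjoint {ι κ : Type*} {m : ι → MeasurableSpace Ω}
    (h_le : ∀ i, m i ≤ mΩ) (h : iIndep m μ) (S : κ → Set ι)
    (hS : ∀ k l, k ≠ l → Disjoint (S k) (S l)) : iIndep (fun k => ⨆ i ∈ S k, m i) μ := by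
  classical
  have := h.isProbabilityMeasure
  rw [iIndep_iff]
  intro s f
  induction s using Finset.cons_induction with
  | empty => simp
  | cons a s ha ih =>
    intro hf
    rw [Finset.prod_cons, ← ih fun i hi => hf i (Finset.mem_cons_of_mem hi)]
    have hd : Disjoint (S a) (⋃ k ∈ s, S k) := by
      simp only [disjoint_iUnion_right]
      rintro k hk
      exact hS _ _ (by rintro rfl; exact ha hk)
    have hI := indep_iSup_of_disjoint h_le h hd
    rw [Indep_iff] at hI
    rw [← hI _ _ (hf a (Finset.mem_cons_self a s)) ?_]
    · congr 1; ext ω; simp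
    · refine Finset.measurableSet_biInter _ fun k hk => ?_
      have hle : (⨆ i ∈ S k, m i) ≤ ⨆ i ∈ ⋃ k ∈ s, S k, m i :=
        biSup_mono fun i hi => mem_biUnion (Finset.mem_coe.2 hk) hi
      exact hle _ (hf k (Finset.mem_cons_of_mem hk))

lemma lintegral_comp_prodMk_of_indepFun [IsProbabilityMeasure μ] {β γ : Type*}
    [MeasurableSpace β] [MeasurableSpace γ] {X : Ω → β} {Y : Ω → γ} (hX : Measurable X)
    (hY : Measurable Y) (h : IndepFun X Y μ) {F : β × γ → ℝ≥0∞} (hF : Measurable F) :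
    ∫⁻ ω, F (X ω, Y ω) ∂μ = ∫⁻ x, ∫⁻ ω, F (x, Y ω) ∂μ ∂(μ.map X) := by
  have := Measure.isProbabilityMeasure_map (μ := μ) hY.aemeasurable
  have h' := (indepFun_iff_map_prod_eq_prod_map_map hX.aemeasurable hY.aemeasurable).1 h
  rw [← lintegral_map hF (hX.prodMk hY), h', lintegral_prod _ hF.aemeasurable]
  congr 1; ext x
  exact lintegral_map (f := fun y => F (x, y)) (hF.comp measurable_prodMk_left) hY

/-- Integration with respect to the law of a random element `X` that is independent of a σ-algebra
`m`, if the integrand depends on `X` and on `m`-measurable quantities. -/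
lemma lintegral_eq_lintegral_map_of_indep [IsProbabilityMeasure μ] {β : Type*}
    {mβ : MeasurableSpace β} {X : Ω → β} (hX : Measurable X) {m : MeasurableSpace Ω} (hm : m ≤ mΩ)
    (hind : Indep (mβ.comap X) m μ) {F : β × Ω → ℝ≥0∞} (hF : Measurable[mβ.prod m] F) :
    ∫⁻ ω, F (X ω, ω) ∂μ = ∫⁻ x, ∫⁻ ω, F (x, ω) ∂μ ∂(@Measure.map Ω β mΩ mβ X μ) := by
  -- The second random element is the identity of `Ω`, with `m` as the σ-algebra on the target; its
  -- independence of `X` is then the hypothesis.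
  refine @lintegral_comp_prodMk_of_indepFun Ω mΩ μ _ β Ω mβ m X id hX
    (@measurable_id'' Ω m mΩ hm) ?_ F hF
  rw [IndepFun_iff_Indep]
  simpa [MeasurableSpace.comap_id] using hind

/-- Independence settles the partial products, and dominated convergence (all factors are at most
one) the limit. The infinite product of means is encoded as `expNeg` of a sum of `negLog`s, which
has the shape of the exponents for which point process formulas are proved. -/
lemma lintegral_expNeg_tsum_of_iIndepFun {a : ℕ → Ω → ℝ≥0∞} (ha : ∀ n, Measurable (a n))
    (h : iIndepFun a μ) :
    ∫⁻ ω, expNeg (∑' n, a n ω) ∂μ = expNeg (∑' n, negLog (∫⁻ ω, expNeg (a n ω) ∂μ)) := by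
  have := h.isProbabilityMeasure
  have hw : ∀ n, ∫⁻ ω, expNeg (a n ω) ∂μ ≤ 1 := fun n =>
    (lintegral_mono fun ω => expNeg_le_one _).trans (by simp)
  have h1 : Tendsto (fun N => ∫⁻ ω, ∏ n ∈ Finset.range N, expNeg (a n ω) ∂μ) atTop
      (𝓝 (∫⁻ ω, expNeg (∑' n, a n ω) ∂μ)) := by
    refine tendsto_lintegral_of_dominated_convergence (fun _ => 1) (fun N => ?_) (fun N => ?_)
      (by simp) ?_
    · exact Finset.measurable_prod _ fun n _ => measurable_expNeg.comp (ha n)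
    · exact Eventually.of_forall fun ω => Finset.prod_le_one' fun n _ => expNeg_le_one _
    · exact Eventually.of_forall fun ω => tendsto_expNeg_sum_range _
  refine tendsto_nhds_unique h1 ?_
  convert tendsto_expNeg_sum_range (fun n => negLog (∫⁻ ω, expNeg (a n ω) ∂μ)) using 2 with N
  rw [lintegral_prod_eq_prod_lintegral_of_indepFun (Finset.range N)
    (fun n ω => expNeg (a n ω)) (h.comp (fun _ => expNeg) fun _ => measurable_expNeg)
    fun n => measurable_expNeg.comp (ha n)]
  exact Finset.prod_congr rfl fun n _ => (expNeg_negLog (hw n)).symm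

end Independence

/-! ### Functionals of homogeneous Poisson point processes -/

section PPP

variable {Ω : Type*} [MeasurableSpace Ω] {μ : Measure Ω}

lemma tsum_indicator_one_eq_pointCount {Ω : Type*} (X : ℕ → Ω → Plane) (A : Set Plane) (ω : Ω) :
    ∑' n, A.indicator (1 : Plane → ℝ≥0∞) (X n ω) = (pointCount X A ω : ℝ≥0∞) := by
  have := ENNReal.tsum_set_one {n : ℕ | X n ω ∈ A}
  rw [pointCount, ← this, tsum_subtype {n : ℕ | X n ω ∈ A} (fun _ => (1 : ℝ≥0∞))]
  rfl

lemma measurable_pointCount {X : ℕ → Ω → Plane} (hX : ∀ n, Measurable (X n)) {A : Set Plane}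
    (hA : MeasurableSet A) : Measurable (pointCount X A) := by
  refine measurable_to_countable' fun m => ?_
  have h : Measurable fun ω => ∑' n, A.indicator (1 : Plane → ℝ≥0∞) (X n ω) :=
    Measurable.tsum fun n => (measurable_one.indicator hA).comp (hX n)
  convert h (measurableSet_singleton (m : ℝ≥0∞)) using 1
  ext ω
  simp only [mem_preimage, mem_singleton_iff, tsum_indicator_one_eq_pointCount]
  exact ENat.toENNReal_inj.symm

variable {X : ℕ → Ω → Plane} {lam : ℝ}

lemma IsHomogeneousPPP.iIndepFun_pointCount (hX : IsHomogeneousPPP μ X lam) {ι : Type*} [Fintype ι]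
    {A : ι → Set Plane} (hA : ∀ k, MeasurableSet (A k)) (hA' : ∀ k, volume (A k) ≠ ∞)
    (hd : Pairwise fun a b => Disjoint (A a) (A b)) :
    iIndepFun (fun k ω => pointCount X (A k) ω) μ := by
  let e := Fintype.equivFin ι
  have := hX.indep (Fintype.card ι) (fun a => A (e.symm a)) (fun _ => hA _) (fun _ => hA' _)
    (fun a b hab => hd (by simpa using hab))
  have h2 := this.precomp e.injective
  simpa using h2

variable [IsProbabilityMeasure μ]

lemma IsHomogeneousPPP.ae_pointCount_ne_top (hX : IsHomogeneousPPP μ X lam) {A : Set Plane}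
    (hA : MeasurableSet A) (hA' : volume A ≠ ∞) : ∀ᵐ ω ∂μ, pointCount X A ω ≠ ⊤ := by
  have hm := measurable_pointCount hX.measurable hA
  have h1 : μ (⋃ m : ℕ, {ω | pointCount X A ω = (m : ℕ∞)}) = 1 := by
    rw [measure_iUnion]
    · simp_rw [hX.poisson A hA hA']
      -- The generating function at `w = 1`: the Poisson masses add up to one.
      simpa using tsum_poissonMeasure_mul_pow (Real.toNNReal (lam * (volume A).toReal)) le_rfl
    · intro m m' hmm
      rw [Function.onFun, Set.disjoint_left]
      intro ω h h'
      change pointCount X A ω = m at h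
      change pointCount X A ω = m' at h'
      exact hmm (by exact_mod_cast h.symm.trans h')
    · exact fun m => hm (measurableSet_singleton _)
  have h2 := (prob_compl_eq_zero_iff
    (MeasurableSet.iUnion fun m : ℕ => hm (measurableSet_singleton (m : ℕ∞)))).2 h1
  refine measure_mono_null ?_ h2
  intro ω hω
  simp only [mem_compl_iff, mem_iUnion, not_exists]
  intro m hm'
  apply hω
  change pointCount X A ω = m at hm'
  simp [hm']

lemma IsHomogeneousPPP.lintegral_comp_pointCount (hX : IsHomogeneousPPP μ X lam) {A : Set Plane}
    (hA : MeasurableSet A) (hA' : volume A ≠ ∞) (φ : ℕ∞ → ℝ≥0∞) :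
    ∫⁻ ω, φ (pointCount X A ω) ∂μ =
      ∑' m : ℕ, poissonMeasure (Real.toNNReal (lam * (volume A).toReal)) {m} * φ m := by
  have hm := measurable_pointCount hX.measurable hA
  have h : ∀ᵐ ω ∂μ, φ (pointCount X A ω) =
      ∑' m : ℕ, {ω | pointCount X A ω = (m : ℕ∞)}.indicator (fun _ => φ m) ω := by
    filter_upwards [hX.ae_pointCount_ne_top hA hA'] with ω hω
    obtain ⟨k, hk⟩ := ENat.ne_top_iff_exists.1 hω
    rw [tsum_eq_single k]
    · simp [hk]
    · intro m hmk
      rw [indicator_of_notMem]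
      simpa [← hk] using hmk.symm
  rw [lintegral_congr_ae h, lintegral_tsum]
  · congr 1; ext m
    rw [lintegral_indicator_const (s := {ω | pointCount X A ω = (m : ℕ∞)})
      (hm (measurableSet_singleton _)), ← hX.poisson A hA hA' m, mul_comm]
  · exact fun m => (measurable_const.indicator (hm (measurableSet_singleton _))).aemeasurable

lemma IsHomogeneousPPP.lintegral_expNeg_pointCount (hX : IsHomogeneousPPP μ X lam)
    {A : Set Plane} (hA : MeasurableSet A) (hA' : volume A ≠ ∞) (t : ℝ≥0∞) :
    ∫⁻ ω, expNeg (t * pointCount X A ω) ∂μ =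
      expNeg (ENNReal.ofReal lam * volume A * (1 - expNeg t)) := by
  rw [hX.lintegral_comp_pointCount hA hA' (fun N => expNeg (t * N))]
  simp only [ENat.toENNReal_coe, expNeg_mul_natCast]
  rw [tsum_poissonMeasure_mul_pow _ (expNeg_le_one t)]
  congr 2
  change ENNReal.ofReal _ = _
  rw [ENNReal.ofReal_mul' ENNReal.toReal_nonneg, ENNReal.ofReal_toReal hA']

lemma IsHomogeneousPPP.lintegral_pointCount_mul_expNeg (hX : IsHomogeneousPPP μ X lam)
    {A : Set Plane} (hA : MeasurableSet A) (hA' : volume A ≠ ∞) (t : ℝ≥0∞) :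
    ∫⁻ ω, pointCount X A ω * expNeg (t * pointCount X A ω) ∂μ =
      ENNReal.ofReal lam * volume A * expNeg t *
        expNeg (ENNReal.ofReal lam * volume A * (1 - expNeg t)) := by
  rw [hX.lintegral_comp_pointCount hA hA' (fun N => N * expNeg (t * N))]
  simp only [ENat.toENNReal_coe, expNeg_mul_natCast]
  have h := tsum_poissonMeasure_mul_natCast_mul_pow (Real.toNNReal (lam * (volume A).toReal))
    (expNeg_le_one t)
  have h2 : ((Real.toNNReal (lam * (volume A).toReal) : NNReal) : ℝ≥0∞)
      = ENNReal.ofReal lam * volume A := by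
    change ENNReal.ofReal _ = _
    rw [ENNReal.ofReal_mul' ENNReal.toReal_nonneg, ENNReal.ofReal_toReal hA']
  rw [h2] at h
  rw [mul_right_comm, ← h, ← ENNReal.tsum_mul_right]
  congr 1; ext m
  rcases m with _ | m
  · simp
  · rw [Nat.add_sub_cancel, pow_succ]; ring

variable {ι : Type*} [Fintype ι] {A : ι → Set Plane}

lemma IsHomogeneousPPP.lintegral_prod_pointCount (hX : IsHomogeneousPPP μ X lam)
    (hA : ∀ k, MeasurableSet (A k)) (hA' : ∀ k, volume (A k) ≠ ∞)
    (hd : Pairwise fun a b => Disjoint (A a) (A b)) (φ : ι → ℕ∞ → ℝ≥0∞) :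
    ∫⁻ ω, ∏ k, φ k (pointCount X (A k) ω) ∂μ = ∏ k, ∫⁻ ω, φ k (pointCount X (A k) ω) ∂μ := by
  have hφ : ∀ k, Measurable (φ k) := fun k => measurable_from_top
  exact lintegral_prod_eq_prod_lintegral_of_indepFun Finset.univ
    (fun k ω => φ k (pointCount X (A k) ω)) ((hX.iIndepFun_pointCount hA hA' hd).comp φ hφ)
    fun k => (hφ k).comp (measurable_pointCount hX.measurable (hA k))

lemma IsHomogeneousPPP.lintegral_prod_expNeg_pointCount (hX : IsHomogeneousPPP μ X lam)
    (hA : ∀ k, MeasurableSet (A k)) (hA' : ∀ k, volume (A k) ≠ ∞)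
    (hd : Pairwise fun a b => Disjoint (A a) (A b)) (t : ι → ℝ≥0∞) :
    ∫⁻ ω, expNeg (∑ k, t k * pointCount X (A k) ω) ∂μ =
      expNeg (ENNReal.ofReal lam * ∑ k, (1 - expNeg (t k)) * volume (A k)) := by
  simp_rw [expNeg_sum]
  rw [hX.lintegral_prod_pointCount hA hA' hd (fun k N => expNeg (t k * N)), Finset.mul_sum,
    expNeg_sum]
  refine Finset.prod_congr rfl fun k _ => ?_
  rw [hX.lintegral_expNeg_pointCount (hA k) (hA' k)]
  congr 1; ring

lemma IsHomogeneousPPP.lintegral_sum_pointCount_mul_expNeg (hX : IsHomogeneousPPP μ X lam)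
    (hA : ∀ k, MeasurableSet (A k)) (hA' : ∀ k, volume (A k) ≠ ∞)
    (hd : Pairwise fun a b => Disjoint (A a) (A b)) (c t : ι → ℝ≥0∞) :
    ∫⁻ ω, (∑ k, c k * pointCount X (A k) ω) * expNeg (∑ k, t k * pointCount X (A k) ω) ∂μ =
      ENNReal.ofReal lam * (∑ k, c k * expNeg (t k) * volume (A k)) *
      expNeg (ENNReal.ofReal lam * ∑ k, (1 - expNeg (t k)) * volume (A k)) := by
  classical
  have hmN : ∀ k, Measurable fun ω => (pointCount X (A k) ω : ℝ≥0∞) := fun k =>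
    measurable_from_top.comp (measurable_pointCount hX.measurable (hA k))
  simp_rw [Finset.sum_mul]
  rw [lintegral_finsetSum, Finset.mul_sum, Finset.sum_mul]
  swap
  · intro k _
    exact (measurable_const.mul (hmN k)).mul (measurable_expNeg.comp
      (Finset.measurable_sum _ fun k _ => measurable_const.mul (hmN k)))
  refine Finset.sum_congr rfl fun i _ => ?_
  -- Only the factor `i` carries the extra count, so the integrand is still a product of functions
  -- of independent counts.
  let φ : ι → ℕ∞ → ℝ≥0∞ := fun k N => if k = i then N * expNeg (t k * N) else expNeg (t k * N)
  have h1 : ∀ ω, c i * pointCount X (A i) ω * expNeg (∑ k, t k * pointCount X (A k) ω) =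
      c i * ∏ k, φ k (pointCount X (A k) ω) := fun ω => by
    rw [expNeg_sum, ← Finset.mul_prod_erase _ _ (Finset.mem_univ i),
      ← Finset.mul_prod_erase _ (fun k => φ k (pointCount X (A k) ω)) (Finset.mem_univ i)]
    have : ∀ k ∈ Finset.univ.erase i, φ k (pointCount X (A k) ω) =
        expNeg (t k * pointCount X (A k) ω) := fun k hk => by
      simp [φ, Finset.ne_of_mem_erase hk]
    rw [Finset.prod_congr rfl this]
    simp only [φ, if_true]
    ring
  simp_rw [h1]
  rw [lintegral_const_mul, hX.lintegral_prod_pointCount hA hA' hd,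
    ← Finset.mul_prod_erase _ _ (Finset.mem_univ i), Finset.mul_sum, expNeg_sum,
    ← Finset.mul_prod_erase (a := i) _
      (fun k => expNeg (ENNReal.ofReal lam * ((1 - expNeg (t k)) * volume (A k))))
      (Finset.mem_univ i)]
  · simp only [φ, if_true]
    rw [hX.lintegral_pointCount_mul_expNeg (hA i) (hA' i)]
    have : ∀ k ∈ Finset.univ.erase i, ∫⁻ ω, (if k = i then (pointCount X (A k) ω : ℝ≥0∞) *
        expNeg (t k * pointCount X (A k) ω) else expNeg (t k * pointCount X (A k) ω)) ∂μ =
        expNeg (ENNReal.ofReal lam * ((1 - expNeg (t k)) * volume (A k))) := fun k hk => by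
      simp only [Finset.ne_of_mem_erase hk, if_false]
      rw [hX.lintegral_expNeg_pointCount (hA k) (hA' k)]
      congr 1; ring
    rw [Finset.prod_congr rfl this]
    rw [show ENNReal.ofReal lam * volume (A i) * (1 - expNeg (t i)) =
      ENNReal.ofReal lam * ((1 - expNeg (t i)) * volume (A i)) by ring]
    ring
  · exact Finset.measurable_prod _ fun k _ => (measurable_from_top (f := φ k)).comp
      (measurable_pointCount hX.measurable (hA k))

end PPP

/-! ### Laplace functional and reduced Campbell formula: from step functions to measurable
functions. -/

section PPP

variable {Ω : Type*} [MeasurableSpace Ω] {μ : Measure Ω} [IsProbabilityMeasure μ]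
  {X : ℕ → Ω → Plane} {lam : ℝ}

/-- The fibre over `q₀`, where `h` vanishes, is left out because it is the one that may have
infinite area. -/
lemma simpleFunc_comp_eq_sum {α γ : Type*} [MeasurableSpace α] [DecidableEq γ]
    (p : SimpleFunc α γ) {q₀ : γ}
    {h : γ → ℝ≥0∞} (h0 : h q₀ = 0) (x : α) :
    h (p x) = ∑ q : {q // q ∈ p.range.erase q₀}, h q * (p ⁻¹' {q.1}).indicator 1 x := by
  have hne : ∀ q : {q // q ∈ p.range.erase q₀}, q.1 ≠ q₀ := fun q => Finset.ne_of_mem_erase q.2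
  by_cases hx : p x = q₀
  · rw [hx, h0, eq_comm]
    refine Finset.sum_eq_zero fun q _ => ?_
    have : x ∉ p ⁻¹' {q.1} := fun hq => hne q ((show p x = q.1 from hq).symm.trans hx)
    simp [this]
  · rw [Finset.sum_eq_single_of_mem
      (⟨p x, Finset.mem_erase.2 ⟨hx, p.mem_range_self x⟩⟩ : {q // q ∈ p.range.erase q₀})
      (Finset.mem_univ _)]
    · simp
    · intro q _ hq
      have : x ∉ p ⁻¹' {q.1} := fun h => hq (Subtype.ext (by exact h.symm))
      simp [this]

/-- The fibres of `p` other than that of `q₀` are disjoint with finite area, so the formulas for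
counts apply. Reading both `c` and `t` off one simple function with arbitrary values lets an
exponent and the indicator of a set be treated on a common partition. The factor `expNeg (t (p x))`
appears because the selected point still counts in the exponent here. -/
lemma IsHomogeneousPPP.lintegral_simpleFunc (hX : IsHomogeneousPPP μ X lam) {γ : Type*}
    (p : SimpleFunc Plane γ) {q₀ : γ} (hp : volume {x | p x ≠ q₀} ≠ ∞) {c t : γ → ℝ≥0∞}
    (hc : c q₀ = 0) (ht : t q₀ = 0) :
    ∫⁻ ω, expNeg (∑' n, t (p (X n ω))) ∂μ =
      expNeg (ENNReal.ofReal lam * ∫⁻ x, (1 - expNeg (t (p x)))) ∧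
    ∫⁻ ω, (∑' n, c (p (X n ω))) * expNeg (∑' n, t (p (X n ω))) ∂μ =
      ENNReal.ofReal lam * (∫⁻ x, c (p x) * expNeg (t (p x))) *
        expNeg (ENNReal.ofReal lam * ∫⁻ x, (1 - expNeg (t (p x)))) := by
  classical
  let A : {q // q ∈ p.range.erase q₀} → Set Plane := fun q => p ⁻¹' {q.1}
  have hA : ∀ q, MeasurableSet (A q) := fun q => p.measurableSet_fiber _
  have hA' : ∀ q, volume (A q) ≠ ∞ := fun q => ne_top_of_le_ne_top hp <| measure_mono fun x hx => by
    have hx' : p x = q.1 := hx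
    change p x ≠ q₀
    rw [hx']
    exact Finset.ne_of_mem_erase q.2
  have hd : Pairwise fun a b => Disjoint (A a) (A b) := fun a b hab => by
    beta_reduce
    rw [Set.disjoint_left]
    intro x hxa hxb
    exact hab (Subtype.ext ((show p x = a.1 from hxa).symm.trans hxb))
  have hI : ∀ h : γ → ℝ≥0∞, h q₀ = 0 → ∫⁻ x, h (p x) = ∑ q, h q.1 * volume (A q) := by
    intro h h0
    simp_rw [simpleFunc_comp_eq_sum p h0]
    rw [lintegral_finsetSum]
    · refine Finset.sum_congr rfl fun q _ => ?_
      rw [lintegral_const_mul _ (measurable_one.indicator (hA q)), lintegral_indicator_one (hA q)]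
    · exact fun q _ => (measurable_one.indicator (hA q)).const_mul _
  have hN : ∀ h : γ → ℝ≥0∞, h q₀ = 0 → ∀ ω,
      ∑' n, h (p (X n ω)) = ∑ q, h q.1 * pointCount X (A q) ω := by
    intro h h0 ω
    simp_rw [simpleFunc_comp_eq_sum p h0]
    rw [Summable.tsum_finsetSum fun _ _ => ENNReal.summable]
    refine Finset.sum_congr rfl fun q _ => ?_
    rw [ENNReal.tsum_mul_left, ← tsum_indicator_one_eq_pointCount]
  simp_rw [hN t ht, hN c hc]
  rw [hI (fun q => 1 - expNeg (t q)) (by simp [ht]),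
    hI (fun q => c q * expNeg (t q)) (by simp [hc])]
  exact ⟨hX.lintegral_prod_expNeg_pointCount hA hA' hd _,
    hX.lintegral_sum_pointCount_mul_expNeg hA hA' hd _ _⟩

/-- Two ways to average over the points of a point process agree if they agree for indicators of
sets of finite measure. -/
lemma lintegral_tsum_mul_eq_of_indicator {E : Type*} [MeasurableSpace E] {μ : Measure Ω}
    (vol : Measure E) [SigmaFinite vol] {Y : ℕ → Ω → E} (hY : ∀ n, Measurable (Y n))
    {W : ℕ → Ω → ℝ≥0∞} (hW : ∀ n, Measurable (W n)) (ν : Measure E)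
    (h : ∀ B, MeasurableSet B → vol B ≠ ∞ →
      ∫⁻ ω, ∑' n, B.indicator 1 (Y n ω) * W n ω ∂μ = ν B)
    {f : E → ℝ≥0∞} (hf : Measurable f) :
    ∫⁻ ω, ∑' n, f (Y n ω) * W n ω ∂μ = ∫⁻ x, f x ∂ν := by
  let ξ : Measure E := Measure.sum fun n => (μ.withDensity (W n)).map (Y n)
  have hξ : ∀ f : E → ℝ≥0∞, Measurable f →
      ∫⁻ x, f x ∂ξ = ∫⁻ ω, ∑' n, f (Y n ω) * W n ω ∂μ := by
    intro f hf
    rw [lintegral_sum_measure, lintegral_tsum fun n =>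
      ((hf.fun_comp (hY n)).fun_mul (hW n)).aemeasurable]
    congr 1; ext n
    rw [lintegral_map hf (hY n), lintegral_withDensity_eq_lintegral_mul _ (hW n)
      (hf.fun_comp (hY n))]
    simp [mul_comm]
  have hξB : ∀ B, MeasurableSet B → vol B ≠ ∞ → ξ B = ν B := fun B hB hB' => by
    rw [← h B hB hB', ← hξ _ (measurable_one.indicator hB), lintegral_indicator_one hB]
  rw [← hξ f hf]
  congr 1
  ext B hB
  -- Agreement on sets of finite measure passes to all measurable sets by exhaustion with spanning
  -- sets.
  have hmono : Monotone fun n => B ∩ spanningSets vol n := fun a b hab =>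
    inter_subset_inter_right _ (monotone_spanningSets vol hab)
  have hU : B = ⋃ n, B ∩ spanningSets vol n := by
    rw [← inter_iUnion, iUnion_spanningSets, inter_univ]
  rw [hU, hmono.measure_iUnion, hmono.measure_iUnion]
  congr 1; ext n
  exact hξB _ (hB.inter (measurableSet_spanningSets vol n))
    (ne_top_of_le_ne_top (measure_spanningSets_lt_top vol n).ne (measure_mono inter_subset_right))

lemma tendsto_tsum_of_monotone {a : ℕ → ℕ → ℝ≥0∞} {b : ℕ → ℝ≥0∞} (hm : ∀ n, Monotone fun k => a k n)
    (h : ∀ n, Tendsto (fun k => a k n) atTop (𝓝 (b n))) :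
    Tendsto (fun k => ∑' n, a k n) atTop (𝓝 (∑' n, b n)) := by
  simp_rw [← lintegral_count]
  exact lintegral_tendsto_of_tendsto_of_monotone (fun _ => measurable_from_top.aemeasurable)
    (Eventually.of_forall hm) (Eventually.of_forall h)

lemma tendsto_tsum_of_dominated {a : ℕ → ℕ → ℝ≥0∞} {b c : ℕ → ℝ≥0∞} (hc : ∑' n, c n ≠ ∞)
    (hac : ∀ k n, a k n ≤ c n)
    (h : ∀ n, Tendsto (fun k => a k n) atTop (𝓝 (b n))) :
    Tendsto (fun k => ∑' n, a k n) atTop (𝓝 (∑' n, b n)) := by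
  simp_rw [← lintegral_count] at hc ⊢
  exact tendsto_lintegral_of_dominated_convergence c (fun _ => measurable_from_top)
    (fun k => Eventually.of_forall (hac k)) hc (Eventually.of_forall h)

/-- Simple functions with support of finite measure that increase to `v`. -/
lemma exists_simpleFunc_tendsto {v : Plane → ℝ≥0∞} (hv : Measurable v) :
    ∃ p : ℕ → SimpleFunc Plane ℝ≥0∞, (∀ k x, p k x < ∞) ∧ (∀ k, volume {x | p k x ≠ 0} ≠ ∞) ∧
      (∀ x, Monotone fun k => p k x) ∧ ∀ x, Tendsto (fun k => p k x) atTop (𝓝 (v x)) := by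
  have hB : ∀ k : ℕ, MeasurableSet (Metric.closedBall (0 : Plane) k) := fun k =>
    Metric.isClosed_closedBall.measurableSet
  refine ⟨fun k => (SimpleFunc.eapprox v k).restrict (Metric.closedBall 0 k), fun k x => ?_,
    fun k => ?_, fun x k l hkl => ?_, fun x => ?_⟩
  · rw [SimpleFunc.restrict_apply _ (hB k)]
    by_cases hx : x ∈ Metric.closedBall (0 : Plane) k <;> simp [hx, SimpleFunc.eapprox_lt_top]
  · refine ne_top_of_le_ne_top (measure_closedBall_lt_top (x := (0 : Plane)) (r := k)).ne
      (measure_mono fun x hx => ?_)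
    by_contra hx'
    apply hx
    rw [SimpleFunc.restrict_apply _ (hB k), indicator_of_notMem hx']
  · simp only [SimpleFunc.restrict_apply _ (hB _)]
    refine (indicator_le_indicator_of_subset (Metric.closedBall_subset_closedBall
      (Nat.cast_le.2 hkl)) (fun _ => zero_le) x).trans ?_
    by_cases hx : x ∈ Metric.closedBall (0 : Plane) l
    · simpa only [indicator_of_mem hx] using SimpleFunc.monotone_eapprox v hkl x
    · simp [hx]
  · refine (SimpleFunc.tendsto_eapprox hv x).congr' ?_
    filter_upwards [eventually_ge_atTop ⌈‖x‖⌉₊] with k hk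
    rw [SimpleFunc.restrict_apply _ (hB k), indicator_of_mem]
    simpa using (Nat.le_ceil _).trans (by exact_mod_cast hk)

lemma lintegral_one_sub_expNeg_tendsto {E : Type*} [MeasurableSpace E] {ν : Measure E}
    {p : ℕ → E → ℝ≥0∞} {v : E → ℝ≥0∞} (hp : ∀ k, Measurable (p k))
    (hm : ∀ x, Monotone fun k => p k x) (h : ∀ x, Tendsto (fun k => p k x) atTop (𝓝 (v x))) :
    Tendsto (fun k => ∫⁻ x, (1 - expNeg (p k x)) ∂ν) atTop (𝓝 (∫⁻ x, (1 - expNeg (v x)) ∂ν)) :=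
  lintegral_tendsto_of_tendsto_of_monotone
    (fun k => (measurable_const.sub (measurable_expNeg.comp (hp k))).aemeasurable)
    (Eventually.of_forall fun x _ _ hkl => tsub_le_tsub_left (expNeg_antitone (hm x hkl)) 1)
    (Eventually.of_forall fun x => ENNReal.Tendsto.sub tendsto_const_nhds
      ((continuous_expNeg.tendsto _).comp (h x)) (by simp))

/-- The Laplace functional of a homogeneous Poisson point process. -/
theorem IsHomogeneousPPP.lintegral_expNeg_tsum (hX : IsHomogeneousPPP μ X lam)
    {v : Plane → ℝ≥0∞} (hv : Measurable v) :
    ∫⁻ ω, expNeg (∑' n, v (X n ω)) ∂μ =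
      expNeg (ENNReal.ofReal lam * ∫⁻ x, (1 - expNeg (v x))) := by
  obtain ⟨p, -, hp2, hp3, hp4⟩ := exists_simpleFunc_tendsto hv
  have h1 : ∀ k, ∫⁻ ω, expNeg (∑' n, p k (X n ω)) ∂μ =
      expNeg (ENNReal.ofReal lam * ∫⁻ x, (1 - expNeg (p k x))) := fun k =>
    (hX.lintegral_simpleFunc (p k) (hp2 k) (c := fun _ => 0) (t := id) rfl rfl).1
  have h2 : Tendsto (fun k => ∫⁻ ω, expNeg (∑' n, p k (X n ω)) ∂μ) atTop
      (𝓝 (∫⁻ ω, expNeg (∑' n, v (X n ω)) ∂μ)) := by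
    refine tendsto_lintegral_of_dominated_convergence (fun _ => 1) (fun k => ?_)
      (fun k => Eventually.of_forall fun ω => expNeg_le_one _) (by simp)
      (Eventually.of_forall fun ω => ?_)
    · exact measurable_expNeg.comp
        (Measurable.tsum fun n => (p k).measurable.comp (hX.measurable n))
    · exact (continuous_expNeg.tendsto _).comp
        (tendsto_tsum_of_monotone (fun n => hp3 _) fun n => hp4 _)
  refine tendsto_nhds_unique h2 ?_
  simp_rw [h1]
  exact (continuous_expNeg.tendsto _).comp (ENNReal.Tendsto.const_mul
    (lintegral_one_sub_expNeg_tendsto (fun k => (p k).measurable) hp3 hp4) (by simp))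

lemma IsHomogeneousPPP.measurable_tsum_ite (hX : IsHomogeneousPPP μ X lam) {v : Plane → ℝ≥0∞}
    (hv : Measurable v) (n : ℕ) :
    Measurable fun ω => ∑' m, if m = n then 0 else v (X m ω) :=
  Measurable.tsum fun m => by
    by_cases h : m = n
    · simp [h]
    · simpa [h] using hv.fun_comp (hX.measurable m)

/-- Removing the `n`-th point from the exponent multiplies the exponential by `(expNeg (p (X
n)))⁻¹`, so the reduced formula is the unreduced one for the test function `f * (expNeg p)⁻¹`. The
division requires `p` to be finite; infinite weights are only reached in the limit. -/
lemma IsHomogeneousPPP.lintegral_tsum_mul_expNeg_simpleFunc (hX : IsHomogeneousPPP μ X lam)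
    (p : SimpleFunc Plane ℝ≥0∞) (hp : ∀ x, p x < ∞) (hp' : volume {x | p x ≠ 0} ≠ ∞)
    {f : Plane → ℝ≥0∞} (hf : Measurable f) :
    ∫⁻ ω, ∑' n, f (X n ω) * expNeg (∑' m, if m = n then 0 else p (X m ω)) ∂μ =
      ENNReal.ofReal lam * (∫⁻ x, f x) *
        expNeg (ENNReal.ofReal lam * ∫⁻ x, (1 - expNeg (p x))) := by
  classical
  set Λ := expNeg (ENNReal.ofReal lam * ∫⁻ x, (1 - expNeg (p x))) with hΛ
  have hpm := p.measurable
  have hem : Measurable fun x => expNeg (p x) := measurable_expNeg.comp hpm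
  have hW : Measurable fun ω => expNeg (∑' m, p (X m ω)) :=
    measurable_expNeg.comp (Measurable.tsum fun n => hpm.comp (hX.measurable n))
  have key := lintegral_tsum_mul_eq_of_indicator (μ := μ) (volume : Measure Plane) hX.measurable
    (W := fun _ ω => expNeg (∑' m, p (X m ω))) (fun _ => hW)
    ((ENNReal.ofReal lam * Λ) • volume.withDensity fun x => expNeg (p x)) (fun B hB hB' => ?_)
    (f := fun x => f x * (expNeg (p x))⁻¹) (hf.mul hem.inv)
  · have hne : ∀ x, expNeg (p x) ≠ 0 := fun x => expNeg_ne_zero (hp x).ne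
    rw [lintegral_smul_measure, lintegral_withDensity_eq_lintegral_mul _ hem
      (hf.fun_mul hem.fun_inv), smul_eq_mul] at key
    have e1 : ∀ x, ((fun x => expNeg (p x)) * fun x => f x * (expNeg (p x))⁻¹) x = f x :=
        fun x => by
      simp only [Pi.mul_apply]
      rw [mul_comm (f x), ← mul_assoc, ENNReal.mul_inv_cancel (hne x) (expNeg_ne_top _), one_mul]
    simp_rw [e1] at key
    rw [show ENNReal.ofReal lam * (∫⁻ x, f x) * Λ = ENNReal.ofReal lam * Λ * ∫⁻ x, f x by ring,
      ← key]
    congr 1; ext ω; congr 1; ext n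
    rw [ENNReal.tsum_eq_add_tsum_ite (f := fun m => p (X m ω)) n, expNeg_add, mul_assoc,
      ← mul_assoc _ (expNeg (p (X n ω))),
      ENNReal.inv_mul_cancel (hne _) (expNeg_ne_top _), one_mul]
    congr!
  -- The pair of `p` and the membership in `B` is one simple function, whose value outside a set of
  -- finite area is `(0, False)`.
  · let b : SimpleFunc Plane Prop := ⟨fun x => x ∈ B, fun P => by
      have : Measurable fun x => x ∈ B := hB.mem
      exact this (measurableSet_singleton P), Set.toFinite _⟩
    let c : ℝ≥0∞ × Prop → ℝ≥0∞ := fun q => if q.2 then 1 else 0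
    have e2 : ∀ x, c (p.pair b x) = B.indicator 1 x := fun x => by
      by_cases hx : x ∈ B <;> simp [hx, c, b]
    have e3 : ∀ x, (p.pair b x).1 = p x := fun x => rfl
    have h := (hX.lintegral_simpleFunc (p.pair b) (q₀ := (0, False)) ?_
      (c := c) (t := fun q => q.1) (by simp [c]) rfl).2
    · simp_rw [e2, e3] at h
      simp_rw [ENNReal.tsum_mul_right]
      rw [h, Measure.smul_apply, withDensity_apply _ hB, ← lintegral_indicator hB, smul_eq_mul,
        mul_right_comm]
      congr 1
      refine lintegral_congr fun x => ?_
      by_cases hx : x ∈ B <;> simp [hx]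
    · refine ne_top_of_le_ne_top (ENNReal.add_ne_top.2 ⟨hp', hB'⟩)
        ((measure_mono fun x hx => ?_).trans (measure_union_le _ _))
      by_contra hx'
      apply hx
      simp only [mem_union, mem_ofPred_eq, not_or, not_not] at hx'
      rw [SimpleFunc.pair_apply, hx'.1]
      congr 1
      exact eq_false hx'.2

/-- The reduced Campbell formula of a homogeneous Poisson point process, for exponentials of
additive functionals. -/
theorem IsHomogeneousPPP.lintegral_tsum_mul_expNeg (hX : IsHomogeneousPPP μ X lam)
    {f v : Plane → ℝ≥0∞} (hf : Measurable f) (hv : Measurable v) :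
    ∫⁻ ω, ∑' n, f (X n ω) * expNeg (∑' m, if m = n then 0 else v (X m ω)) ∂μ =
      ENNReal.ofReal lam * (∫⁻ x, f x) *
        expNeg (ENNReal.ofReal lam * ∫⁻ x, (1 - expNeg (v x))) := by
  obtain ⟨p, hp1, hp2, hp3, hp4⟩ := exists_simpleFunc_tendsto hv
  set Λ := expNeg (ENNReal.ofReal lam * ∫⁻ x, (1 - expNeg (v x))) with hΛ
  have key := lintegral_tsum_mul_eq_of_indicator (μ := μ) (volume : Measure Plane) hX.measurable
    (W := fun n ω => expNeg (∑' m, if m = n then 0 else v (X m ω)))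
    (fun n => measurable_expNeg.comp (hX.measurable_tsum_ite hv n))
    ((ENNReal.ofReal lam * Λ) • volume) (fun B hB hB' => ?_) hf
  · rw [key, lintegral_smul_measure, smul_eq_mul]; ring
  rw [Measure.smul_apply, smul_eq_mul]
  have hBm : Measurable (B.indicator (1 : Plane → ℝ≥0∞)) := measurable_one.indicator hB
  have hlim : Tendsto (fun k => ENNReal.ofReal lam * volume B *
      expNeg (ENNReal.ofReal lam * ∫⁻ x, (1 - expNeg (p k x)))) atTop
      (𝓝 (ENNReal.ofReal lam * volume B * Λ)) := by
    refine ENNReal.Tendsto.const_mul ?_ (Or.inr (ENNReal.mul_ne_top (by simp) hB'))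
    exact (continuous_expNeg.tendsto _).comp (ENNReal.Tendsto.const_mul
      (lintegral_one_sub_expNeg_tendsto (fun k => (p k).measurable) hp3 hp4) (by simp))
  have hk : ∀ k, ∫⁻ ω, ∑' n, B.indicator 1 (X n ω) *
      expNeg (∑' m, if m = n then 0 else p k (X m ω)) ∂μ = ENNReal.ofReal lam * volume B *
      expNeg (ENNReal.ofReal lam * ∫⁻ x, (1 - expNeg (p k x))) := fun k => by
    rw [hX.lintegral_tsum_mul_expNeg_simpleFunc (p k) (hp1 k) (hp2 k) hBm,
      lintegral_indicator_one hB]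
  simp_rw [← hk] at hlim
  rw [mul_right_comm]
  refine tendsto_nhds_unique ?_ hlim
  have hswap : ∀ q : Plane → ℝ≥0∞, Measurable q → ∫⁻ ω, ∑' n, B.indicator 1 (X n ω) *
      expNeg (∑' m, if m = n then 0 else q (X m ω)) ∂μ = ∑' n, ∫⁻ ω, B.indicator 1 (X n ω) *
      expNeg (∑' m, if m = n then 0 else q (X m ω)) ∂μ := fun q hq =>
    lintegral_tsum fun n => ((hBm.comp (hX.measurable n)).mul
      (measurable_expNeg.comp (hX.measurable_tsum_ite hq n))).aemeasurable
  -- The formula with exponent zero says that the mean number of points in `B` is finite; this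
  -- supplies the dominating function for the sum over points and for each integral.
  have hfin : ∑' n, ∫⁻ ω, B.indicator 1 (X n ω) ∂μ ≠ ∞ := by
    have h0 := hX.lintegral_tsum_mul_expNeg_simpleFunc 0 (by simp) (by simp) hBm
    simp only [SimpleFunc.coe_zero, Pi.zero_apply, ite_self, tsum_zero, expNeg_zero, mul_one,
      tsub_self, lintegral_zero, mul_zero, lintegral_indicator_one hB] at h0
    rw [← lintegral_tsum fun n => (hBm.fun_comp (hX.measurable n)).aemeasurable, h0]
    exact ENNReal.mul_ne_top (by simp) hB'
  rw [hswap v hv]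
  simp_rw [hswap _ (p _).measurable]
  have hle : ∀ (q : Plane → ℝ≥0∞) (n : ℕ) (ω : Ω), B.indicator 1 (X n ω) *
      expNeg (∑' m, if m = n then 0 else q (X m ω)) ≤ B.indicator 1 (X n ω) := fun q n ω =>
    (mul_le_mul_right (expNeg_le_one _) _).trans (mul_one _).le
  refine tendsto_tsum_of_dominated hfin (fun k n => lintegral_mono (hle _ n)) fun n => ?_
  refine tendsto_lintegral_of_dominated_convergence (fun ω => B.indicator 1 (X n ω)) (fun k => ?_)
    (fun k => Eventually.of_forall (hle _ n)) (ENNReal.ne_top_of_tsum_ne_top hfin n)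
    (Eventually.of_forall fun ω => ?_)
  · exact (hBm.comp (hX.measurable n)).mul
      (measurable_expNeg.comp (hX.measurable_tsum_ite (p k).measurable n))
  · refine ENNReal.Tendsto.const_mul ((continuous_expNeg.tendsto _).comp
      (tendsto_tsum_of_monotone (fun m => ?_) fun m => ?_)) ?_
    · by_cases h : m = n
      · simp [h, monotone_const]
      · simpa [h] using hp3 (X m ω)
    · by_cases h : m = n
      · simp [h]
      · simpa [h] using hp4 (X m ω)
    · right
      by_cases h : X n ω ∈ B <;> simp [h]

end PPP

/-! ### Independently marked Poisson point processes and clusters -/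

section Marked

variable {Ω : Type*} [mΩ : MeasurableSpace Ω] {μ : Measure Ω} [IsProbabilityMeasure μ]

lemma measurable_expNeg_tsum {α ι : Type*} [Countable ι] {m : MeasurableSpace α}
    {f : ι → α → ℝ≥0∞} (hf : ∀ i, Measurable (f i)) : Measurable fun x => expNeg (∑' i, f i x) :=
  measurable_expNeg.comp (Measurable.tsum hf)

lemma negLog_one : negLog 1 = 0 := by simp [negLog]

lemma lintegral_expNeg_le_one (a : Ω → ℝ≥0∞) : ∫⁻ ω, expNeg (a ω) ∂μ ≤ 1 :=
  (lintegral_mono fun _ => expNeg_le_one _).trans (by simp)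

section Sequence

variable {E : Type*} [mE : MeasurableSpace E] {M : ℕ → Ω → E}

lemma lintegral_expNeg_tsum_comp (hM : ∀ n, Measurable (M n)) (hMi : iIndepFun M μ)
    {t : ℕ → E → ℝ≥0∞} (ht : ∀ m, Measurable (t m)) :
    ∫⁻ ω, expNeg (∑' m, t m (M m ω)) ∂μ =
      expNeg (∑' m, negLog (∫⁻ ω, expNeg (t m (M m ω)) ∂μ)) :=
  lintegral_expNeg_tsum_of_iIndepFun (fun m => (ht m).comp (hM m)) (hMi.comp t ht)

/-- The exponent omits index `n`, hence it is measurable with respect to the other marks and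
independent of `M n`. -/
lemma lintegral_mul_expNeg_tsum_ite (hM : ∀ n, Measurable (M n)) (hMi : iIndepFun M μ)
    {g : E → ℝ≥0∞} (hg : Measurable g) {t : ℕ → E → ℝ≥0∞} (ht : ∀ m, Measurable (t m)) (n : ℕ) :
    ∫⁻ ω, g (M n ω) * expNeg (∑' m, if m = n then 0 else t m (M m ω)) ∂μ =
      (∫⁻ ω, g (M n ω) ∂μ) *
        expNeg (∑' m, if m = n then 0 else negLog (∫⁻ ω, expNeg (t m (M m ω)) ∂μ)) := by
  have hle : ∀ i, mE.comap (M i) ≤ mΩ := fun i => (hM i).comap_le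
  have hind := indep_iSup_of_disjoint hle ((iIndepFun_iff_iIndep _ _ _).1 hMi)
    (disjoint_compl_right (a := ({n} : Set ℕ)))
  have h1 : Measurable[⨆ i ∈ ({n} : Set ℕ), mE.comap (M i)] fun ω => g (M n ω) := by
    refine hg.comp ?_
    exact (comap_measurable (M n)).mono (le_biSup (fun i => mE.comap (M i)) (mem_singleton n))
      le_rfl
  have h2 : ∀ m, Measurable[⨆ i ∈ ({n}ᶜ : Set ℕ), mE.comap (M i)]
      fun ω => if m = n then 0 else t m (M m ω) := fun m => by
    by_cases h : m = n
    · simp only [h, if_true]; exact measurable_const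
    · simp only [h, if_false]
      refine (ht m).comp ?_
      exact (comap_measurable (M m)).mono (le_biSup (fun i => mE.comap (M i))
        (show m ∈ ({n}ᶜ : Set ℕ) from h)) le_rfl
  rw [lintegral_mul_eq_lintegral_mul_lintegral_of_independent_measurableSpace
    (iSup₂_le fun i _ => hle i) (iSup₂_le fun i _ => hle i) hind h1
    (measurable_expNeg_tsum h2)]
  congr 1
  have h3 := lintegral_expNeg_tsum_comp hM hMi (t := fun m x => if m = n then 0 else t m x)
    (fun m => by by_cases h : m = n <;> simp [h, ht m])
  rw [h3]
  congr 2; ext m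
  by_cases h : m = n <;> simp [h, negLog_one]

end Sequence

/-- The Laplace functional of an independently marked Poisson point process. -/
theorem IsHomogeneousPPP.lintegral_expNeg_tsum_marked {X : ℕ → Ω → Plane} {lam : ℝ}
    (hX : IsHomogeneousPPP μ X lam) {E : Type*} [MeasurableSpace E] {M : ℕ → Ω → E}
    (hM : ∀ n, Measurable (M n)) (hMi : iIndepFun M μ)
    (hXM : IndepFun (fun ω n => X n ω) (fun ω n => M n ω) μ) {T : Plane × E → ℝ≥0∞}
    (hT : Measurable T) {w : Plane → ℝ≥0∞} (hw : ∀ n x, ∫⁻ ω, expNeg (T (x, M n ω)) ∂μ = w x) :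
    ∫⁻ ω, expNeg (∑' n, T (X n ω, M n ω)) ∂μ = expNeg (ENNReal.ofReal lam * ∫⁻ x, (1 - w x)) := by
  have hXm : Measurable fun ω n => X n ω := measurable_pi_lambda _ hX.measurable
  have hMm : Measurable fun ω n => M n ω := measurable_pi_lambda _ hM
  have hw1 : ∀ x, w x ≤ 1 := fun x => by rw [← hw 0 x]; exact lintegral_expNeg_le_one _
  have hwm : Measurable w := by
    have : Measurable fun x => ∫⁻ ω, expNeg (T (x, M 0 ω)) ∂μ :=
      Measurable.lintegral_prod_right' (f := fun p : Plane × Ω => expNeg (T (p.1, M 0 p.2)))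
        (measurable_expNeg.comp (hT.comp (measurable_fst.prodMk ((hM 0).comp measurable_snd))))
    simpa only [hw] using this
  have hF : Measurable fun p : (ℕ → Plane) × (ℕ → E) => expNeg (∑' n, T (p.1 n, p.2 n)) := by
    refine measurable_expNeg.comp (Measurable.tsum fun n => hT.comp ?_)
    fun_prop
  rw [lintegral_comp_prodMk_of_indepFun hXm hMm hXM hF]
  have h1 : ∀ x : ℕ → Plane, ∫⁻ ω, expNeg (∑' n, T (x n, M n ω)) ∂μ =
      expNeg (∑' n, negLog (w (x n))) := fun x => by
    rw [lintegral_expNeg_tsum_comp hM hMi (t := fun n y => T (x n, y))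
      (fun n => hT.comp measurable_prodMk_left)]
    simp_rw [hw]
  simp_rw [h1]
  have hm2 : Measurable fun x : ℕ → Plane => expNeg (∑' n, negLog (w (x n))) :=
    measurable_expNeg.comp (Measurable.tsum fun n =>
      (measurable_negLog.comp hwm).comp (measurable_pi_apply n))
  rw [lintegral_map hm2 hXm]
  -- Given the points, integrating out the marks leaves the product of `w (X n)`; this is the
  -- unmarked functional with exponent `negLog ∘ w`.
  have := hX.lintegral_expNeg_tsum (measurable_negLog.comp hwm)
  simp_rw [Function.comp_apply, expNeg_negLog (hw1 _)] at this
  exact this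

/-- The reduced Campbell formula of an independently marked Poisson point process. -/
theorem IsHomogeneousPPP.lintegral_tsum_mul_expNeg_marked {X : ℕ → Ω → Plane} {lam : ℝ}
    (hX : IsHomogeneousPPP μ X lam) {E : Type*} [MeasurableSpace E] {M : ℕ → Ω → E}
    (hM : ∀ n, Measurable (M n)) (hMi : iIndepFun M μ)
    (hXM : IndepFun (fun ω n => X n ω) (fun ω n => M n ω) μ) {F T : Plane × E → ℝ≥0∞}
    (hF : Measurable F) (hT : Measurable T) {f w : Plane → ℝ≥0∞}
    (hf : ∀ n x, ∫⁻ ω, F (x, M n ω) ∂μ = f x)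
    (hw : ∀ n x, ∫⁻ ω, expNeg (T (x, M n ω)) ∂μ = w x) :
    ∫⁻ ω, ∑' n, F (X n ω, M n ω) * expNeg (∑' m, if m = n then 0 else T (X m ω, M m ω)) ∂μ =
      ENNReal.ofReal lam * (∫⁻ x, f x) * expNeg (ENNReal.ofReal lam * ∫⁻ x, (1 - w x)) := by
  have hXm : Measurable fun ω n => X n ω := measurable_pi_lambda _ hX.measurable
  have hMm : Measurable fun ω n => M n ω := measurable_pi_lambda _ hM
  have hw1 : ∀ x, w x ≤ 1 := fun x => by rw [← hw 0 x]; exact lintegral_expNeg_le_one _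
  have hmk : Measurable fun p : Plane × Ω => (p.1, M 0 p.2) :=
    measurable_fst.prodMk ((hM 0).comp measurable_snd)
  have hwm : Measurable w := by
    have : Measurable fun x => ∫⁻ ω, expNeg (T (x, M 0 ω)) ∂μ :=
      Measurable.lintegral_prod_right' (f := fun p : Plane × Ω => expNeg (T (p.1, M 0 p.2)))
        (measurable_expNeg.comp (hT.comp hmk))
    simpa only [hw] using this
  have hfm : Measurable f := by
    have : Measurable fun x => ∫⁻ ω, F (x, M 0 ω) ∂μ :=
      Measurable.lintegral_prod_right' (f := fun p : Plane × Ω => F (p.1, M 0 p.2)) (hF.comp hmk)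
    simpa only [hf] using this
  have hite : ∀ n m : ℕ, Measurable fun p : (ℕ → Plane) × (ℕ → E) =>
      if m = n then 0 else T (p.1 m, p.2 m) := fun n m => by
    by_cases h : m = n
    · simp [h]
    · simp only [h, if_false]
      exact hT.comp (by fun_prop)
  have hG : Measurable fun p : (ℕ → Plane) × (ℕ → E) => ∑' n, F (p.1 n, p.2 n) *
      expNeg (∑' m, if m = n then 0 else T (p.1 m, p.2 m)) :=
    Measurable.tsum fun n => (hF.comp (by fun_prop)).mul
      (measurable_expNeg.comp (Measurable.tsum (hite n)))
  rw [lintegral_comp_prodMk_of_indepFun hXm hMm hXM hG]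
  have h1 : ∀ x : ℕ → Plane, ∫⁻ ω, ∑' n, F (x n, M n ω) *
      expNeg (∑' m, if m = n then 0 else T (x m, M m ω)) ∂μ =
      ∑' n, f (x n) * expNeg (∑' m, if m = n then 0 else negLog (w (x m))) := fun x => by
    rw [lintegral_tsum]
    · congr 1; ext n
      rw [lintegral_mul_expNeg_tsum_ite hM hMi (g := fun y => F (x n, y))
        (t := fun n y => T (x n, y)) (hF.comp measurable_prodMk_left)
        (fun n => hT.comp measurable_prodMk_left)]
      simp_rw [hw, hf]
    · intro n
      refine (Measurable.mul (hF.comp (measurable_const.prodMk (hM n))) (measurable_expNeg.comp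
        (Measurable.tsum fun m => ?_))).aemeasurable
      exact (hite n m).comp (measurable_const.prodMk hMm)
  simp_rw [h1]
  have hvm := measurable_negLog.comp hwm
  have hm1 : ∀ n m : ℕ, Measurable fun x : ℕ → Plane => if m = n then 0 else negLog (w (x m)) :=
    fun n m => by
      by_cases h : m = n
      · simp [h]
      · simp only [h, if_false]
        exact hvm.comp (measurable_pi_apply m)
  have hm2 : Measurable fun x : ℕ → Plane =>
      ∑' n, f (x n) * expNeg (∑' m, if m = n then 0 else negLog (w (x m))) :=
    Measurable.tsum fun n => (hfm.comp (measurable_pi_apply n)).mul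
      (measurable_expNeg.comp (Measurable.tsum (hm1 n)))
  rw [lintegral_map hm2 hXm]
  have := hX.lintegral_tsum_mul_expNeg hfm hvm
  simp_rw [Function.comp_apply, expNeg_negLog (hw1 _)] at this
  exact this

/-! ### Clusters: a Poisson number of independent points. -/

section Cluster

variable {E : Type*} [MeasurableSpace E] {N : Ω → ℕ} {Y : ℕ → Ω → E} {m : NNReal}

lemma lintegral_poisson_mixture (hN : Measurable N) (hlaw : μ.map N = poissonMeasure m)
    (hY : ∀ l, Measurable (Y l)) (hNY : IndepFun N (fun ω l => Y l ω) μ)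
    {F : ℕ × (ℕ → E) → ℝ≥0∞} (hF : ∀ k, Measurable fun y => F (k, y)) {φ : ℕ → ℝ≥0∞}
    (hφ : ∀ k, ∫⁻ ω, F (k, fun l => Y l ω) ∂μ = φ k) :
    ∫⁻ ω, F (N ω, fun l => Y l ω) ∂μ = ∑' k, poissonMeasure m {k} * φ k := by
  rw [lintegral_comp_prodMk_of_indepFun hN (measurable_pi_lambda _ hY) hNY
    (measurable_from_prod_countable_right hF)]
  simp_rw [hφ]
  rw [hlaw, lintegral_countable']
  simp_rw [mul_comm]

/-- The Laplace functional of a cluster with a Poisson number of independent points. -/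
theorem lintegral_expNeg_tsum_cluster (hN : Measurable N) (hlaw : μ.map N = poissonMeasure m)
    (hY : ∀ l, Measurable (Y l)) (hYi : iIndepFun Y μ) (hNY : IndepFun N (fun ω l => Y l ω) μ)
    {a : E → ℝ≥0∞} (ha : Measurable a) {w : ℝ≥0∞}
    (hw : ∀ l, ∫⁻ ω, expNeg (a (Y l ω)) ∂μ = w) :
    ∫⁻ ω, expNeg (∑' l, if l < N ω then a (Y l ω) else 0) ∂μ = expNeg (m * (1 - w)) := by
  have hw1 : w ≤ 1 := by rw [← hw 0]; exact lintegral_expNeg_le_one _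
  rw [← tsum_poissonMeasure_mul_pow m hw1]
  have hm : ∀ k l : ℕ, Measurable fun y : E => if l < k then a y else 0 := fun k l => by
    by_cases h : l < k <;> simp [h, ha]
  refine lintegral_poisson_mixture (F := fun p => expNeg (∑' l, if l < p.1 then a (p.2 l) else 0))
    hN hlaw hY hNY (fun k => measurable_expNeg.comp (Measurable.tsum fun l =>
      (hm k l).comp (measurable_pi_apply l))) fun k => ?_
  dsimp only
  rw [lintegral_expNeg_tsum_comp hY hYi (t := fun l y => if l < k then a y else 0) (hm k)]
  have : ∀ l, negLog (∫⁻ ω, expNeg (if l < k then a (Y l ω) else 0) ∂μ) =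
      if l ∈ Finset.range k then negLog w else 0 := fun l => by
    by_cases h : l < k <;> simp [h, hw, negLog_one]
  simp_rw [this]
  rw [tsum_eq_sum (s := Finset.range k) (by intro b hb; simp [hb]), expNeg_sum,
    Finset.prod_congr rfl (g := fun _ => w)]
  · simp
  · intro l hl
    rw [if_pos hl, expNeg_negLog hw1]

/-- The reduced Campbell formula of a cluster with a Poisson number of independent points. -/
theorem lintegral_tsum_mul_expNeg_cluster (hN : Measurable N) (hlaw : μ.map N = poissonMeasure m)
    (hY : ∀ l, Measurable (Y l)) (hYi : iIndepFun Y μ) (hNY : IndepFun N (fun ω l => Y l ω) μ)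
    {a f : E → ℝ≥0∞} (ha : Measurable a) (hf : Measurable f) {fbar w : ℝ≥0∞}
    (hfb : ∀ l, ∫⁻ ω, f (Y l ω) ∂μ = fbar) (hw : ∀ l, ∫⁻ ω, expNeg (a (Y l ω)) ∂μ = w) :
    ∫⁻ ω, ∑' l, (if l < N ω then f (Y l ω) else 0) *
      expNeg (∑' l', if l' = l then 0 else if l' < N ω then a (Y l' ω) else 0) ∂μ =
      m * fbar * expNeg (m * (1 - w)) := by
  have hw1 : w ≤ 1 := by rw [← hw 0]; exact lintegral_expNeg_le_one _
  rw [mul_right_comm, ← tsum_poissonMeasure_mul_natCast_mul_pow m hw1, ← ENNReal.tsum_mul_right]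
  simp_rw [mul_assoc (poissonMeasure m _)]
  have hm : ∀ (b : E → ℝ≥0∞), Measurable b → ∀ k l : ℕ,
      Measurable fun y : E => if l < k then b y else 0 := fun b hb k l => by
    by_cases h : l < k <;> simp [h, hb]
  have hmm : ∀ k l : ℕ, Measurable fun y : ℕ → E => (if l < k then f (y l) else 0) *
      expNeg (∑' l', if l' = l then 0 else if l' < k then a (y l') else 0) := fun k l => by
    refine ((hm f hf k l).comp (measurable_pi_apply l)).mul
      (measurable_expNeg.comp (Measurable.tsum fun l' => ?_))
    by_cases h : l' = l
    · simp [h]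
    · simp only [h, if_false]
      exact (hm a ha k l').comp (measurable_pi_apply l')
  refine lintegral_poisson_mixture (F := fun p => ∑' l, (if l < p.1 then f (p.2 l) else 0) *
      expNeg (∑' l', if l' = l then 0 else if l' < p.1 then a (p.2 l') else 0))
    hN hlaw hY hNY (fun k => Measurable.tsum (hmm k)) fun k => ?_
  dsimp only
  rw [lintegral_tsum fun l => ((hmm k l).fun_comp (measurable_pi_lambda _ hY)).aemeasurable]
  -- Given the size `k`, each of the first `k` points contributes `fbar` and the `k - 1` weights of
  -- its siblings. Summation produces `k * w ^ (k - 1)`, the size-biased generating function.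
  have key : ∀ l, ∫⁻ ω, (if l < k then f (Y l ω) else 0) *
      expNeg (∑' l', if l' = l then 0 else if l' < k then a (Y l' ω) else 0) ∂μ =
      if l ∈ Finset.range k then fbar * w ^ (k - 1) else 0 := fun l => by
    by_cases h : l < k
    · simp only [h, if_true, Finset.mem_range]
      rw [lintegral_mul_expNeg_tsum_ite hY hYi hf (t := fun l' y => if l' < k then a y else 0)
        (hm a ha k), hfb]
      congr 1
      have : ∀ l', (if l' = l then 0 else
          negLog (∫⁻ ω, expNeg (if l' < k then a (Y l' ω) else 0) ∂μ)) =
          if l' ∈ (Finset.range k).erase l then negLog w else 0 := fun l' => by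
        by_cases h' : l' = l
        · simp [h']
        · by_cases h'' : l' < k <;> simp [h', h'', hw, negLog_one]
      simp_rw [this]
      rw [tsum_eq_sum (s := (Finset.range k).erase l) (by intro b hb; simp only [hb, if_false]),
        expNeg_sum, Finset.prod_congr rfl (g := fun _ => w)]
      · rw [Finset.prod_const, Finset.card_erase_of_mem (by simpa using h), Finset.card_range]
      · intro l hl
        rw [if_pos hl, expNeg_negLog hw1]
    · simp [h]
  simp_rw [key]
  rw [tsum_eq_sum (s := Finset.range k) (by intro b hb; simp only [hb, if_false]),
    Finset.sum_congr rfl (g := fun _ => fbar * w ^ (k - 1)) fun l hl => if_pos hl]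
  simp only [Finset.sum_const, Finset.card_range, nsmul_eq_mul]
  ring

end Cluster

end Marked

/-! ### Measurability and independence in a realization -/

section Network

variable {Ω κ₁ κ₂ : Type*}

/-- The tier to which a source of randomness belongs, if it is not the user. -/
def Source.tier : Source κ₁ κ₂ → Option (κ₁ ⊕ κ₂)
  | .user => none
  | .parent k => some (.inl k)
  | .size k _ => some (.inl k)
  | .offspring k _ _ => some (.inl k)
  | .point k => some (.inr k)
  | .fading b => some b.tier

lemma measurable_pi_of_apply {α ι β : Type*} {m : MeasurableSpace α} [MeasurableSpace β]
    {f : α → ι → β} (hf : ∀ i, Measurable fun a => f a i) : Measurable f :=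
  measurable_pi_lambda _ hf

namespace Realization

variable (R : Realization Ω κ₁ κ₂)

/-- The σ-algebra generated by a set of sources of randomness. -/
@[reducible]
def sigmaOf (G : Set (Source κ₁ κ₂)) : MeasurableSpace Ω := ⨆ s ∈ G, R.sigma s

variable {R}

lemma sigma_le_sigmaOf {G : Set (Source κ₁ κ₂)} {s : Source κ₁ κ₂} (hs : s ∈ G) :
    R.sigma s ≤ R.sigmaOf G := le_biSup R.sigma hs

section Measurable

variable {m : MeasurableSpace Ω}

lemma measurable_user (h : R.sigma .user ≤ m) : Measurable R.user :=
  (comap_measurable R.user).mono h le_rfl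

lemma measurable_parent {k : κ₁} (h : R.sigma (.parent k) ≤ m) (n : ℕ) :
    Measurable (R.parent k n) :=
  (measurable_pi_apply n).comp ((comap_measurable fun ω n => R.parent k n ω).mono h le_rfl)

lemma measurable_size {k : κ₁} {n : ℕ} (h : R.sigma (.size k n) ≤ m) : Measurable (R.size k n) :=
  (comap_measurable _).mono h le_rfl

lemma measurable_offspring {k : κ₁} {n l : ℕ} (h : R.sigma (.offspring k n l) ≤ m) :
    Measurable (R.offspring k n l) :=
  (comap_measurable _).mono h le_rfl

lemma measurable_point {k : κ₂} (h : R.sigma (.point k) ≤ m) (n : ℕ) :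
    Measurable (R.point k n) :=
  (measurable_pi_apply n).comp ((comap_measurable fun ω n => R.point k n ω).mono h le_rfl)

lemma measurable_fading {b : BSIndex κ₁ κ₂} (h : R.sigma (.fading b) ≤ m) :
    Measurable (R.fading b) :=
  (comap_measurable _).mono h le_rfl

/-- Only sources other than fading variables are required, so this serves both for the σ-algebra of
one tier and for the σ-algebra of everything except the fading of one station. -/
lemma measurable_loc {b : BSIndex κ₁ κ₂}
    (h : ∀ s : Source κ₁ κ₂, s.tier = some b.tier → (∀ b', s ≠ .fading b') → R.sigma s ≤ m) :
    Measurable fun ω => R.loc ω b := by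
  rcases b with ⟨k, n, l⟩ | ⟨k, n⟩
  · exact (measurable_parent (h (.parent k) rfl (by simp)) n).add
      (measurable_offspring (h (.offspring k n l) rfl (by simp)))
  · exact measurable_point (h (.point k) rfl (by simp)) n

lemma measurableSet_present {b : BSIndex κ₁ κ₂}
    (h : ∀ s : Source κ₁ κ₂, s.tier = some b.tier → (∀ b', s ≠ .fading b') → R.sigma s ≤ m) :
    MeasurableSet {ω | R.Present ω b} := by
  rcases b with ⟨k, n, l⟩ | ⟨k, n⟩
  · exact measurable_size (h (.size k n) rfl (by simp)) (measurableSet_Ioi (a := l))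
  · exact MeasurableSet.univ

end Measurable

section Independence

variable [mΩ : MeasurableSpace Ω] {D : HetNet κ₁ κ₂} {μ : Measure Ω}

lemma IsUncoupled.sigma_le (hR : R.IsUncoupled D μ) (s : Source κ₁ κ₂) : R.sigma s ≤ mΩ := by
  cases s with
  | user => exact hR.user_measurable.comap_le
  | parent k => exact (measurable_pi_lambda _ (hR.parent_ppp k).measurable).comap_le
  | size k n => exact (hR.size_measurable k n).comap_le
  | offspring k n l => exact (hR.offspring_measurable k n l).comap_le
  | point k => exact (measurable_pi_lambda _ (hR.point_ppp k).measurable).comap_le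
  | fading b => exact (hR.fading_measurable b).comap_le

lemma IsUncoupled.sigmaOf_le (hR : R.IsUncoupled D μ) (G : Set (Source κ₁ κ₂)) :
    R.sigmaOf G ≤ mΩ := iSup₂_le fun s _ => hR.sigma_le s

lemma IsUncoupled.indep_sigmaOf (hR : R.IsUncoupled D μ) {G H : Set (Source κ₁ κ₂)}
    (hGH : Disjoint G H) : Indep (R.sigmaOf G) (R.sigmaOf H) μ :=
  indep_iSup_of_disjoint hR.sigma_le hR.indep hGH

lemma IsUncoupled.indepFun (hR : R.IsUncoupled D μ) {G H : Set (Source κ₁ κ₂)}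
    (hGH : Disjoint G H) {β γ : Type*} [mβ : MeasurableSpace β] [mγ : MeasurableSpace γ]
    {X : Ω → β} {Y : Ω → γ} (hX : Measurable[R.sigmaOf G] X) (hY : Measurable[R.sigmaOf H] Y) :
    IndepFun X Y μ := by
  rw [IndepFun_iff_Indep]
  exact indep_of_indep_of_le (hR.indep_sigmaOf hGH) hX.comap_le hY.comap_le

lemma IsUncoupled.iIndepFun (hR : R.IsUncoupled D μ) {κ : Type*} {G : κ → Set (Source κ₁ κ₂)}
    (hG : ∀ a b, a ≠ b → Disjoint (G a) (G b)) {β : Type*} [MeasurableSpace β]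
    {X : κ → Ω → β} (hX : ∀ a, Measurable[R.sigmaOf (G a)] (X a)) :
    ProbabilityTheory.iIndepFun X μ := by
  rw [iIndepFun_iff_iIndep]
  exact iIndep_of_iIndep_of_le (iIndep_iSup_of_pairwise_disjoint hR.sigma_le hR.indep G hG)
    fun a => (hX a).comap_le

end Independence

end Realization

/-! ### Laplace functionals of the tiers -/

namespace HetNet

variable (D : HetNet κ₁ κ₂) (W : κ₁ ⊕ κ₂ → Plane → ℝ≥0∞)

/-- The mean of the product of the weights `W` of the points of a cluster with center `z`. -/
noncomputable def clusterLaplace (k : κ₁) (z : Plane) : ℝ≥0∞ :=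
  expNeg (ENNReal.ofReal (D.mbar k) *
    (1 - ∫⁻ s, ENNReal.ofReal (D.g k s) * W (.inl k) (z + s)))

/-- The mean of the product of the weights `W` of the points of a tier. -/
noncomputable def tierLaplace : κ₁ ⊕ κ₂ → ℝ≥0∞
  | .inl k => expNeg (ENNReal.ofReal (D.lamP k) * ∫⁻ z, (1 - D.clusterLaplace W k z))
  | .inr k => expNeg (ENNReal.ofReal (D.lam k) * ∫⁻ y, (1 - W (.inr k) y))

/-- The intensity of a tier at `x`, weighted with the mean of the product of the weights `W` of the
other points of the cluster of `x`. -/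
noncomputable def palmDensity : κ₁ ⊕ κ₂ → Plane → ℝ≥0∞
  | .inl k, x => ENNReal.ofReal (D.lamP k) * ENNReal.ofReal (D.mbar k) *
      ∫⁻ z, ENNReal.ofReal (D.g k (x - z)) * D.clusterLaplace W k z
  | .inr k, _ => ENNReal.ofReal (D.lam k)

variable {D W}

lemma measurable_clusterLaplace {k : κ₁} (hW : Measurable (W (.inl k))) :
    Measurable (D.clusterLaplace W k) := by
  have h : Measurable fun p : Plane × Plane =>
      ENNReal.ofReal (D.g k p.2) * W (.inl k) (p.1 + p.2) :=
    (((D.g_measurable k).comp measurable_snd).ennreal_ofReal).mul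
      (hW.comp (measurable_fst.add measurable_snd))
  exact measurable_expNeg.comp (measurable_const.mul (measurable_const.sub h.lintegral_prod_right'))

lemma clusterLaplace_le_one (k : κ₁) (z : Plane) : D.clusterLaplace W k z ≤ 1 := expNeg_le_one _

lemma tierLaplace_le_one (j : κ₁ ⊕ κ₂) : D.tierLaplace W j ≤ 1 := by
  cases j <;> exact expNeg_le_one _

end HetNet

section TierFunctional

variable [mΩ : MeasurableSpace Ω] {D : HetNet κ₁ κ₂} {μ : Measure Ω} [IsProbabilityMeasure μ]
  {R : Realization Ω κ₁ κ₂}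

namespace Realization

/-- The contribution of the potential base station `b` to an additive functional of the network
seen from `u`. -/
noncomputable def contribution (R : Realization Ω κ₁ κ₂) (v : κ₁ ⊕ κ₂ → Plane × ℝ → ℝ≥0∞)
    (u : Plane) (ω : Ω) (b : BSIndex κ₁ κ₂) : ℝ≥0∞ :=
  open Classical in if R.Present ω b then v b.tier (R.loc ω b - u, R.fading b ω) else 0

lemma contribution_inr (R : Realization Ω κ₁ κ₂) (v : κ₁ ⊕ κ₂ → Plane × ℝ → ℝ≥0∞) (u : Plane)
    (ω : Ω) (k : κ₂) (n : ℕ) : R.contribution v u ω (.inr (k, n)) =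
      v (.inr k) (R.point k n ω - u, R.fading (.inr (k, n)) ω) := if_pos trivial

lemma contribution_inl (R : Realization Ω κ₁ κ₂) (v : κ₁ ⊕ κ₂ → Plane × ℝ → ℝ≥0∞) (u : Plane)
    (ω : Ω) (k : κ₁) (n l : ℕ) : R.contribution v u ω (.inl (k, n, l)) =
      if l < R.size k n ω then v (.inl k) (R.parent k n ω + R.offspring k n l ω - u,
        R.fading (.inl (k, n, l)) ω) else 0 := by
  by_cases h : l < R.size k n ω
  · rw [if_pos h]; exact if_pos h
  · rw [if_neg h]; exact if_neg h

/-- The mean over the fading of the weight `exp (-v)`. -/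
noncomputable def meanWeight (v : κ₁ ⊕ κ₂ → Plane × ℝ → ℝ≥0∞) (j : κ₁ ⊕ κ₂) (y : Plane) : ℝ≥0∞ :=
  ∫⁻ h, expNeg (v j (y, h)) ∂(expMeasure 1)

variable {v : κ₁ ⊕ κ₂ → Plane × ℝ → ℝ≥0∞}

instance : IsProbabilityMeasure (expMeasure 1) := isProbabilityMeasure_expMeasure one_pos

lemma measurable_meanWeight {j : κ₁ ⊕ κ₂} (hv : Measurable (v j)) : Measurable (meanWeight v j) :=
  (measurable_expNeg.comp hv).lintegral_prod_right'

/-- Joint measurability of the contributions in the location of the user and the randomness. -/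
lemma measurable_contribution {m : MeasurableSpace Ω} {b : BSIndex κ₁ κ₂}
    (h : ∀ s : Source κ₁ κ₂, s.tier = some b.tier → R.sigma s ≤ m) (hv : Measurable (v b.tier)) :
    Measurable fun p : Plane × Ω => R.contribution v p.1 p.2 b := by
  classical
  refine Measurable.ite ?_ (hv.comp ?_) measurable_const
  · exact measurable_snd (measurableSet_present fun s hs _ => h s hs)
  · refine Measurable.prodMk ?_ ?_
    · exact ((measurable_loc fun s hs _ => h s hs).comp measurable_snd).sub measurable_fst
    · exact (measurable_fading (h (.fading b) rfl)).comp measurable_snd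

end Realization

open Realization

section Poisson

variable (hR : R.IsUncoupled D μ) (k : κ₂)

include hR in
lemma poissonTier_indep :
    ProbabilityTheory.iIndepFun (fun n => R.fading (.inr (k, n))) μ ∧
    IndepFun (fun ω n => R.point k n ω) (fun ω n => R.fading (.inr (k, n)) ω) μ := by
  constructor
  · refine hR.iIndepFun (G := fun n => {.fading (.inr (k, n))}) (fun a b hab => ?_) fun n => ?_
    · simpa using hab
    · exact measurable_fading (sigma_le_sigmaOf (mem_singleton _))
  · refine hR.indepFun (G := {.point k}) (H := {.point k}ᶜ) disjoint_compl_right ?_ ?_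
    · exact measurable_pi_of_apply (measurable_point (sigma_le_sigmaOf (mem_singleton _)))
    · exact measurable_pi_of_apply fun n => measurable_fading (sigma_le_sigmaOf (by simp))

include hR in
lemma lintegral_fading {b : BSIndex κ₁ κ₂} {f : ℝ → ℝ≥0∞} (hf : Measurable f) :
    ∫⁻ ω, f (R.fading b ω) ∂μ = ∫⁻ h, f h ∂(expMeasure 1) := by
  rw [← hR.fading_law b, lintegral_map hf (hR.fading_measurable b)]

include hR in
-- Fading variables are independent marks. The location `u` disappears by translation invariance of
-- Lebesgue measure, here and in the three analogous formulas; this is why the user's law will not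
-- matter.
lemma lintegral_expNeg_poissonTier (hv : Measurable (v (.inr k))) (u : Plane) :
    ∫⁻ ω, expNeg (∑' n, R.contribution v u ω (.inr (k, n))) ∂μ =
      D.tierLaplace (meanWeight v) (.inr k) := by
  have h := (hR.point_ppp k).lintegral_expNeg_tsum_marked (fun n => hR.fading_measurable _)
    (poissonTier_indep hR k).1 (poissonTier_indep hR k).2
    (T := fun p => v (.inr k) (p.1 - u, p.2)) (w := fun x => meanWeight v (.inr k) (x - u))
    (hv.comp (by fun_prop)) (fun n x => lintegral_fading hR
      (f := fun h => expNeg (v (.inr k) (x - u, h)))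
      (measurable_expNeg.comp (hv.comp measurable_prodMk_left)))
  simp only [contribution_inr]
  refine h.trans ?_
  rw [lintegral_sub_right_eq_self (fun x => 1 - meanWeight v (.inr k) x) u]
  rfl

include hR in
lemma lintegral_palm_poissonTier (hv : Measurable (v (.inr k))) (u : Plane) {F : Plane → ℝ≥0∞}
    (hF : Measurable F) :
    ∫⁻ ω, ∑' n, F (R.point k n ω - u) *
      expNeg (∑' m, if m = n then 0 else R.contribution v u ω (.inr (k, m))) ∂μ =
      (∫⁻ x, F x * D.palmDensity (meanWeight v) (.inr k) x) *
        D.tierLaplace (meanWeight v) (.inr k) := by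
  have h := (hR.point_ppp k).lintegral_tsum_mul_expNeg_marked (fun n => hR.fading_measurable _)
    (poissonTier_indep hR k).1 (poissonTier_indep hR k).2
    (F := fun p => F (p.1 - u)) (T := fun p => v (.inr k) (p.1 - u, p.2))
    (f := fun x => F (x - u)) (w := fun x => meanWeight v (.inr k) (x - u))
    (hF.comp (by fun_prop)) (hv.comp (by fun_prop)) (fun n x => by simp)
    (fun n x => lintegral_fading hR (f := fun h => expNeg (v (.inr k) (x - u, h)))
      (measurable_expNeg.comp (hv.comp measurable_prodMk_left)))
  simp only [contribution_inr]
  refine h.trans ?_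
  rw [lintegral_sub_right_eq_self (fun x => 1 - meanWeight v (.inr k) x) u,
    lintegral_sub_right_eq_self F u]
  simp only [HetNet.palmDensity, HetNet.tierLaplace]
  rw [lintegral_mul_const _ hF, mul_comm (ENNReal.ofReal _) (∫⁻ x, F x)]

end Poisson

section ClusterTier

variable (hR : R.IsUncoupled D μ) (k : κ₁)

/-- The cluster size and the relative positions and fading variables of the points of a cluster. -/
def clusterMark (R : Realization Ω κ₁ κ₂) (k : κ₁) (n : ℕ) (ω : Ω) : ℕ × (ℕ → Plane × ℝ) :=
  (R.size k n ω, fun l => (R.offspring k n l ω, R.fading (.inl (k, n, l)) ω))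

include hR in
lemma clusterTier_indep :
    (∀ n, Measurable (clusterMark R k n)) ∧
    ProbabilityTheory.iIndepFun (clusterMark R k) μ ∧
    IndepFun (fun ω n => R.parent k n ω) (fun ω n => clusterMark R k n ω) μ := by
  have hmeas : ∀ {m : MeasurableSpace Ω} (n : ℕ), R.sigma (.size k n) ≤ m →
      (∀ l, R.sigma (.offspring k n l) ≤ m) → (∀ l, R.sigma (.fading (.inl (k, n, l))) ≤ m) →
      Measurable (clusterMark R k n) := fun n h1 h2 h3 =>
    (measurable_size h1).prodMk (measurable_pi_of_apply fun l =>
      (measurable_offspring (h2 l)).prodMk (measurable_fading (h3 l)))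
  refine ⟨fun n => hmeas n (hR.sigma_le _) (fun _ => hR.sigma_le _) fun _ => hR.sigma_le _, ?_, ?_⟩
  · refine hR.iIndepFun (G := fun n => {.size k n} ∪
      (range (fun l => .offspring k n l) ∪ range fun l => .fading (.inl (k, n, l))))
      (fun a b hab => ?_) fun n => ?_
    · rw [Set.disjoint_left]
      rintro s (rfl | ⟨l, rfl⟩ | ⟨l, rfl⟩) <;> simp [hab, hab.symm]
    · exact hmeas n (sigma_le_sigmaOf (by simp)) (fun l => sigma_le_sigmaOf (by simp))
        fun l => sigma_le_sigmaOf (by simp)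
  · refine hR.indepFun (G := {.parent k}) (H := {.parent k}ᶜ) disjoint_compl_right ?_ ?_
    · exact measurable_pi_of_apply (measurable_parent (sigma_le_sigmaOf (mem_singleton _)))
    · exact measurable_pi_of_apply fun n => hmeas n (sigma_le_sigmaOf (by simp))
        (fun l => sigma_le_sigmaOf (by simp)) fun l => sigma_le_sigmaOf (by simp)

include hR in
lemma cluster_indep (n : ℕ) :
    (∀ l, Measurable fun ω => (R.offspring k n l ω, R.fading (.inl (k, n, l)) ω)) ∧
    ProbabilityTheory.iIndepFun
      (fun l ω => (R.offspring k n l ω, R.fading (.inl (k, n, l)) ω)) μ ∧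
    IndepFun (R.size k n) (fun ω l => (R.offspring k n l ω, R.fading (.inl (k, n, l)) ω)) μ := by
  have hmeas : ∀ {m : MeasurableSpace Ω} (l : ℕ), R.sigma (.offspring k n l) ≤ m →
      R.sigma (.fading (.inl (k, n, l))) ≤ m →
      Measurable fun ω => (R.offspring k n l ω, R.fading (.inl (k, n, l)) ω) := fun l h1 h2 =>
    (measurable_offspring h1).prodMk (measurable_fading h2)
  refine ⟨fun l => hmeas l (hR.sigma_le _) (hR.sigma_le _), ?_, ?_⟩
  · refine hR.iIndepFun (G := fun l => {.offspring k n l, .fading (.inl (k, n, l))})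
      (fun a b hab => ?_) fun l => hmeas l (sigma_le_sigmaOf (by simp)) (sigma_le_sigmaOf (by simp))
    rw [Set.disjoint_left]
    rintro s (rfl | rfl) <;> simp [hab]
  · refine hR.indepFun (G := {.size k n}) (H := {.size k n}ᶜ) disjoint_compl_right ?_ ?_
    · exact measurable_size (sigma_le_sigmaOf (mem_singleton _))
    · exact measurable_pi_of_apply fun l =>
        hmeas l (sigma_le_sigmaOf (by simp)) (sigma_le_sigmaOf (by simp))

include hR in
lemma lintegral_offspring_fading (n l : ℕ) {f : Plane × ℝ → ℝ≥0∞} (hf : Measurable f) :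
    ∫⁻ ω, f (R.offspring k n l ω, R.fading (.inl (k, n, l)) ω) ∂μ =
      ∫⁻ s, ENNReal.ofReal (D.g k s) * ∫⁻ h, f (s, h) ∂(expMeasure 1) := by
  have hI : IndepFun (R.offspring k n l) (R.fading (.inl (k, n, l))) μ :=
    hR.indepFun (G := {.offspring k n l}) (H := {.offspring k n l}ᶜ) disjoint_compl_right
      (measurable_offspring (sigma_le_sigmaOf (mem_singleton _)))
      (measurable_fading (sigma_le_sigmaOf (by simp)))
  rw [lintegral_comp_prodMk_of_indepFun (hR.offspring_measurable k n l) (hR.fading_measurable _) hI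
    hf, hR.offspring_law]
  have : ∀ x, ∫⁻ ω, f (x, R.fading (.inl (k, n, l)) ω) ∂μ = ∫⁻ h, f (x, h) ∂(expMeasure 1) :=
    fun x => lintegral_fading hR (f := fun h => f (x, h)) (hf.comp measurable_prodMk_left)
  simp_rw [this]
  rw [lintegral_withDensity_eq_lintegral_mul _ (D.g_measurable k).ennreal_ofReal
    hf.lintegral_prod_right']
  rfl

include hR in
lemma lintegral_expNeg_cluster (hv : Measurable (v (.inl k))) (z : Plane) (n : ℕ) :
    ∫⁻ ω, expNeg (∑' l, if l < R.size k n ω then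
      v (.inl k) (z + R.offspring k n l ω, R.fading (.inl (k, n, l)) ω) else 0) ∂μ =
      D.clusterLaplace (meanWeight v) k z := by
  obtain ⟨h1, h2, h3⟩ := cluster_indep hR k n
  have ha : Measurable fun y : Plane × ℝ => v (.inl k) (z + y.1, y.2) := hv.comp (by fun_prop)
  exact lintegral_expNeg_tsum_cluster (hR.size_measurable k n) (hR.size_law k n) h1 h2 h3 ha
    fun l => lintegral_offspring_fading hR k n l (measurable_expNeg.comp ha)

include hR in
lemma lintegral_palm_cluster (hv : Measurable (v (.inl k))) {F : Plane → ℝ≥0∞} (hF : Measurable F)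
    (z : Plane) (n : ℕ) :
    ∫⁻ ω, ∑' l, (if l < R.size k n ω then F (z + R.offspring k n l ω) else 0) *
      expNeg (∑' l', if l' = l then 0 else if l' < R.size k n ω then
      v (.inl k) (z + R.offspring k n l' ω, R.fading (.inl (k, n, l')) ω) else 0) ∂μ =
      ENNReal.ofReal (D.mbar k) * (∫⁻ s, ENNReal.ofReal (D.g k s) * F (z + s)) *
        D.clusterLaplace (meanWeight v) k z := by
  obtain ⟨h1, h2, h3⟩ := cluster_indep hR k n
  have ha : Measurable fun y : Plane × ℝ => v (.inl k) (z + y.1, y.2) := hv.comp (by fun_prop)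
  have hf : Measurable fun y : Plane × ℝ => F (z + y.1) := hF.comp (by fun_prop)
  exact lintegral_tsum_mul_expNeg_cluster (hR.size_measurable k n) (hR.size_law k n) h1 h2 h3 ha hf
    (fun l => (lintegral_offspring_fading hR k n l hf).trans (by simp))
    fun l => lintegral_offspring_fading hR k n l (measurable_expNeg.comp ha)

include hR in
lemma lintegral_expNeg_clusterTier (hv : Measurable (v (.inl k))) (u : Plane) :
    ∫⁻ ω, expNeg (∑' n, ∑' l, R.contribution v u ω (.inl (k, n, l))) ∂μ =
      D.tierLaplace (meanWeight v) (.inl k) := by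
  obtain ⟨h1, h2, h3⟩ := clusterTier_indep hR k
  have h := (hR.parent_ppp k).lintegral_expNeg_tsum_marked h1 h2 h3
    (T := fun p => ∑' l, if l < p.2.1 then v (.inl k) (p.1 - u + (p.2.2 l).1, (p.2.2 l).2) else 0)
    (w := fun z => D.clusterLaplace (meanWeight v) k (z - u))
    (Measurable.tsum fun l => Measurable.ite
      (measurableSet_lt measurable_const (by fun_prop)) (hv.comp (by fun_prop)) measurable_const)
    (fun n z => lintegral_expNeg_cluster hR k hv (z - u) n)
  simp only [contribution_inl, add_sub_right_comm]
  refine h.trans ?_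
  rw [lintegral_sub_right_eq_self (fun x => 1 - D.clusterLaplace (meanWeight v) k x) u]
  rfl

include hR in
-- The selected point is the `l`-th of the `n`-th cluster, and the exponent is split into its
-- siblings and the other clusters. The Campbell formula of a cluster is used for the inner sum and
-- that of the marked parent process for the outer one. Exchanging the integrals over the center and
-- over the point produces `palmDensity`.
lemma lintegral_palm_clusterTier (hv : Measurable (v (.inl k))) (u : Plane) {F : Plane → ℝ≥0∞}
    (hF : Measurable F) :
    ∫⁻ ω, ∑' n, (∑' l, (if l < R.size k n ω then
        F (R.parent k n ω + R.offspring k n l ω - u) else 0) *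
        expNeg (∑' l', if l' = l then 0 else R.contribution v u ω (.inl (k, n, l')))) *
      expNeg (∑' m, if m = n then 0 else ∑' l, R.contribution v u ω (.inl (k, m, l))) ∂μ =
      (∫⁻ x, F x * D.palmDensity (meanWeight v) (.inl k) x) *
        D.tierLaplace (meanWeight v) (.inl k) := by
  obtain ⟨h1, h2, h3⟩ := clusterTier_indep hR k
  have hT : ∀ l, Measurable fun p : Plane × (ℕ × (ℕ → Plane × ℝ)) =>
      if l < p.2.1 then v (.inl k) (p.1 - u + (p.2.2 l).1, (p.2.2 l).2) else 0 := fun l =>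
    Measurable.ite (measurableSet_lt measurable_const (by fun_prop)) (hv.comp (by fun_prop))
      measurable_const
  have hT' : ∀ l l' : ℕ, Measurable fun p : Plane × (ℕ × (ℕ → Plane × ℝ)) =>
      if l' = l then 0 else
      if l' < p.2.1 then v (.inl k) (p.1 - u + (p.2.2 l').1, (p.2.2 l').2) else 0 := fun l l' => by
    by_cases h : l' = l
    · simp [h]
    · simpa only [h, if_false] using hT l'
  have h := (hR.parent_ppp k).lintegral_tsum_mul_expNeg_marked h1 h2 h3
    (F := fun p => ∑' l, (if l < p.2.1 then F (p.1 - u + (p.2.2 l).1) else 0) *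
      expNeg (∑' l', if l' = l then 0 else
        if l' < p.2.1 then v (.inl k) (p.1 - u + (p.2.2 l').1, (p.2.2 l').2) else 0))
    (T := fun p => ∑' l, if l < p.2.1 then v (.inl k) (p.1 - u + (p.2.2 l).1, (p.2.2 l).2) else 0)
    (f := fun z => ENNReal.ofReal (D.mbar k) *
      (∫⁻ s, ENNReal.ofReal (D.g k s) * F (z - u + s)) *
      D.clusterLaplace (meanWeight v) k (z - u))
    (w := fun z => D.clusterLaplace (meanWeight v) k (z - u))
    (Measurable.tsum fun l => (Measurable.ite
      (measurableSet_lt measurable_const (by fun_prop)) (hF.comp (by fun_prop))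
      measurable_const).mul (measurable_expNeg_tsum (hT' l))) (Measurable.tsum hT)
    (fun n z => lintegral_palm_cluster hR k hv hF (z - u) n)
    (fun n z => lintegral_expNeg_cluster hR k hv (z - u) n)
  simp only [contribution_inl, add_sub_right_comm]
  refine h.trans ?_
  rw [lintegral_sub_right_eq_self (fun x => 1 - D.clusterLaplace (meanWeight v) k x) u,
    lintegral_sub_right_eq_self (fun z => ENNReal.ofReal (D.mbar k) *
      (∫⁻ s, ENNReal.ofReal (D.g k s) * F (z + s)) * D.clusterLaplace (meanWeight v) k z) u]
  congr 1
  have hC := HetNet.measurable_clusterLaplace (D := D) (measurable_meanWeight hv)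
  have hg : Measurable fun x => ENNReal.ofReal (D.g k x) := (D.g_measurable k).ennreal_ofReal
  have e1 : ∀ z, ENNReal.ofReal (D.mbar k) * (∫⁻ s, ENNReal.ofReal (D.g k s) * F (z + s)) *
      D.clusterLaplace (meanWeight v) k z = ∫⁻ x, ENNReal.ofReal (D.mbar k) *
      (ENNReal.ofReal (D.g k (x - z)) * F x * D.clusterLaplace (meanWeight v) k z) := fun z => by
    rw [lintegral_const_mul, lintegral_mul_const, mul_assoc]
    · congr 2
      rw [← lintegral_add_right_eq_self (fun x => ENNReal.ofReal (D.g k (x - z)) * F x) z]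
      simp [add_comm]
    · exact (hg.comp (by fun_prop)).mul hF
    · exact ((hg.comp (by fun_prop)).mul hF).mul_const _
  simp_rw [e1]
  rw [lintegral_lintegral_swap, ← lintegral_const_mul']
  · refine lintegral_congr fun x => ?_
    simp only [HetNet.palmDensity]
    have hgx : Measurable fun z => ENNReal.ofReal (D.g k (x - z)) := hg.comp (by fun_prop)
    rw [lintegral_const_mul' _ _ ENNReal.ofReal_ne_top, ← mul_assoc, mul_left_comm (F x)]
    congr 1
    rw [← lintegral_const_mul _ (hgx.fun_mul hC)]
    refine lintegral_congr fun z => ?_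
    ring
  · simp
  · refine (Measurable.const_mul (Measurable.mul (Measurable.mul ?_ ?_) ?_) _).aemeasurable
    · exact hg.comp (by fun_prop)
    · exact hF.comp measurable_snd
    · exact hC.comp measurable_fst

end ClusterTier

end TierFunctional

end Network

/-! ### The reduced Campbell formula of the network -/

section NetworkPalm

open Realization

variable {Ω κ₁ κ₂ : Type*}

/-- The sum of `f` over the potential base stations of a tier. -/
noncomputable def tierSum (f : BSIndex κ₁ κ₂ → ℝ≥0∞) : κ₁ ⊕ κ₂ → ℝ≥0∞
  | .inl k => ∑' n, ∑' l, f (.inl (k, n, l))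
  | .inr k => ∑' n, f (.inr (k, n))

lemma tsum_bsIndex [Fintype κ₁] [Fintype κ₂] (f : BSIndex κ₁ κ₂ → ℝ≥0∞) :
    ∑' b, f b = ∑ j, tierSum f j := by
  rw [Summable.tsum_sum (f := f) ENNReal.summable ENNReal.summable, Fintype.sum_sum_type]
  congr 1
  · rw [ENNReal.tsum_prod', tsum_fintype]
    simp_rw [ENNReal.tsum_prod']
    rfl
  · rw [ENNReal.tsum_prod', tsum_fintype]
    rfl

lemma tierSum_congr {f g : BSIndex κ₁ κ₂ → ℝ≥0∞} {j : κ₁ ⊕ κ₂} (h : ∀ b, b.tier = j → f b = g b) :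
    tierSum f j = tierSum g j := by
  cases j with
  | inl k => exact tsum_congr fun n => tsum_congr fun l => h _ rfl
  | inr k => exact tsum_congr fun n => h _ rfl

lemma tierSum_mul_right {f : BSIndex κ₁ κ₂ → ℝ≥0∞} {j : κ₁ ⊕ κ₂} (c : ℝ≥0∞) :
    tierSum (fun b => f b * c) j = tierSum f j * c := by
  cases j with
  | inl k => simp only [tierSum, ENNReal.tsum_mul_right]
  | inr k => simp only [tierSum, ENNReal.tsum_mul_right]

open Classical in
-- Omitting `b` changes the sum over its own tier only; the full sums over the other tiers split off
-- as independent factors.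
lemma expNeg_tsum_ite_ne [Fintype κ₁] [Fintype κ₂] (q : BSIndex κ₁ κ₂ → ℝ≥0∞)
    (b : BSIndex κ₁ κ₂) :
    expNeg (∑' b', if b' = b then 0 else q b') =
      expNeg (tierSum (fun b' => if b' = b then 0 else q b') b.tier) *
        ∏ j ∈ Finset.univ.erase b.tier, expNeg (tierSum q j) := by
  rw [tsum_bsIndex, expNeg_sum, ← Finset.mul_prod_erase _ _ (Finset.mem_univ b.tier)]
  congr 1
  refine Finset.prod_congr rfl fun j hj => ?_
  rw [tierSum_congr fun b' hb' => if_neg ?_]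
  rintro rfl
  exact Finset.ne_of_mem_erase hj hb'.symm

variable [mΩ : MeasurableSpace Ω] {D : HetNet κ₁ κ₂} {μ : Measure Ω} [IsProbabilityMeasure μ]
  {R : Realization Ω κ₁ κ₂} {v : κ₁ ⊕ κ₂ → Plane × ℝ → ℝ≥0∞}

lemma lintegral_expNeg_tierSum (hR : R.IsUncoupled D μ) (hv : ∀ j, Measurable (v j)) (u : Plane)
    (j : κ₁ ⊕ κ₂) :
    ∫⁻ ω, expNeg (tierSum (R.contribution v u ω) j) ∂μ = D.tierLaplace (meanWeight v) j := by
  cases j with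
  | inl k => exact lintegral_expNeg_clusterTier hR k (hv _) u
  | inr k => exact lintegral_expNeg_poissonTier hR k (hv _) u

/-- The test function `F` evaluated at the location of `b` relative to `u`, if `b` is present. -/
noncomputable def testAt (R : Realization Ω κ₁ κ₂) (F : Plane → ℝ≥0∞) (u : Plane) (ω : Ω)
    (b : BSIndex κ₁ κ₂) : ℝ≥0∞ :=
  open Classical in if R.Present ω b then F (R.loc ω b - u) else 0

open Classical in
lemma lintegral_palm_tierSum (hR : R.IsUncoupled D μ) (hv : ∀ j, Measurable (v j)) (u : Plane)
    {F : Plane → ℝ≥0∞} (hF : Measurable F) (i : κ₁ ⊕ κ₂) :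
    ∫⁻ ω, tierSum (fun b => testAt R F u ω b * expNeg (tierSum (fun b' =>
      if b' = b then 0 else R.contribution v u ω b') i)) i ∂μ =
      (∫⁻ x, F x * D.palmDensity (meanWeight v) i x) * D.tierLaplace (meanWeight v) i := by
  cases i with
  | inl k =>
    rw [← lintegral_palm_clusterTier hR k (hv _) u hF]
    refine lintegral_congr fun ω => ?_
    simp only [tierSum]
    refine tsum_congr fun n => ?_
    rw [← ENNReal.tsum_mul_right]
    refine tsum_congr fun l => ?_
    rw [mul_assoc, ← expNeg_add]
    congr 1
    · simp only [testAt, Present, loc]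
      by_cases h : l < R.size k n ω <;> simp [h]
    · congr 1
      -- Cluster `n` is separated from the rest: it alone loses a point, the others are complete.
      rw [ENNReal.tsum_eq_add_tsum_ite n]
      congr 1
      · refine tsum_congr fun l' => ?_
        simp only [Sum.inl.injEq, Prod.mk.injEq, true_and]
      · refine tsum_congr fun m => ?_
        by_cases h : m = n <;> simp [h]
  | inr k =>
    rw [← lintegral_palm_poissonTier hR k (hv _) u hF]
    refine lintegral_congr fun ω => ?_
    simp only [tierSum]
    refine tsum_congr fun n => ?_
    congr 1
    · exact if_pos trivial
    · congr 1
      refine tsum_congr fun m => ?_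
      by_cases h : m = n <;> simp [h]

lemma measurable_testAt {m : MeasurableSpace Ω} {b : BSIndex κ₁ κ₂}
    (h : ∀ s : Source κ₁ κ₂, s.tier = some b.tier → R.sigma s ≤ m) {F : Plane → ℝ≥0∞}
    (hF : Measurable F) : Measurable fun p : Plane × Ω => testAt R F p.1 p.2 b := by
  classical
  refine Measurable.ite ?_ (hF.comp ?_) measurable_const
  · exact measurable_snd (measurableSet_present fun s hs _ => h s hs)
  · exact ((measurable_loc fun s hs _ => h s hs).comp measurable_snd).sub measurable_fst

lemma measurable_tierSum {α : Type*} {m : MeasurableSpace α} {f : α → BSIndex κ₁ κ₂ → ℝ≥0∞}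
    {j : κ₁ ⊕ κ₂} (h : ∀ b, b.tier = j → Measurable fun x => f x b) :
    Measurable fun x => tierSum (f x) j := by
  cases j with
  | inl k => exact Measurable.tsum fun n => Measurable.tsum fun l => h _ rfl
  | inr k => exact Measurable.tsum fun n => h _ rfl

open Classical in
lemma measurable_ite_contribution {m : MeasurableSpace Ω} {b b' : BSIndex κ₁ κ₂}
    (h : ∀ s : Source κ₁ κ₂, s.tier = some b'.tier → R.sigma s ≤ m) (hv : ∀ j, Measurable (v j)) :
    Measurable fun p : Plane × Ω => if b' = b then 0 else R.contribution v p.1 p.2 b' := by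
  by_cases hb : b' = b
  · simp only [hb, if_true]; exact measurable_const
  · simp only [hb, if_false]; exact measurable_contribution h (hv _)

open Classical in
/-- The reduced Campbell formula of the network seen from a fixed location `u`. -/
lemma lintegral_palm_fixed [Fintype κ₁] [Fintype κ₂] (hR : R.IsUncoupled D μ)
    (hv : ∀ j, Measurable (v j)) (u : Plane) {F : Plane → ℝ≥0∞} (hF : Measurable F)
    (i : κ₁ ⊕ κ₂) :
    ∫⁻ ω, ∑' b : BSIndex κ₁ κ₂, (if b.tier = i then testAt R F u ω b else 0) *
      expNeg (∑' b', if b' = b then 0 else R.contribution v u ω b') ∂μ =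
      (∫⁻ x, F x * D.palmDensity (meanWeight v) i x) * ∏ j, D.tierLaplace (meanWeight v) j := by
  have h1 : ∀ ω, ∑' b : BSIndex κ₁ κ₂, (if b.tier = i then testAt R F u ω b else 0) *
      expNeg (∑' b', if b' = b then 0 else R.contribution v u ω b') =
      tierSum (fun b => testAt R F u ω b * expNeg (tierSum (fun b' =>
        if b' = b then 0 else R.contribution v u ω b') i)) i *
        ∏ j ∈ Finset.univ.erase i, expNeg (tierSum (R.contribution v u ω) j) := fun ω => by
    rw [tsum_bsIndex, Finset.sum_eq_single i, ← tierSum_mul_right]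
    · refine tierSum_congr fun b hb => ?_
      rw [if_pos hb, expNeg_tsum_ite_ne, hb, mul_assoc]
    · intro j _ hj
      rw [tierSum_congr (g := fun _ => 0)]
      · cases j <;> simp [tierSum]
      · rintro b rfl
        rw [if_neg hj, zero_mul]
    · simp
  simp_rw [h1]
  -- One factor for each tier, measurable with respect to the sources of that tier: a Palm sum for
  -- tier `i`, an exponential functional for each of the others.
  let f : κ₁ ⊕ κ₂ → Ω → ℝ≥0∞ := fun j ω => if j = i then
    tierSum (fun b => testAt R F u ω b * expNeg (tierSum (fun b' =>
        if b' = b then 0 else R.contribution v u ω b') i)) i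
    else expNeg (tierSum (R.contribution v u ω) j)
  have h2 : ∀ ω, tierSum (fun b => testAt R F u ω b * expNeg (tierSum (fun b' =>
        if b' = b then 0 else R.contribution v u ω b') i)) i *
        ∏ j ∈ Finset.univ.erase i, expNeg (tierSum (R.contribution v u ω) j) =
        ∏ j, f j ω := fun ω => by
    rw [← Finset.mul_prod_erase _ _ (Finset.mem_univ i)]
    congr 1
    · simp [f]
    · refine Finset.prod_congr rfl fun j hj => ?_
      simp [f, Finset.ne_of_mem_erase hj]
  simp_rw [h2]
  have hmeas : ∀ (j : κ₁ ⊕ κ₂) {m : MeasurableSpace Ω},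
      (∀ s : Source κ₁ κ₂, s.tier = some j → R.sigma s ≤ m) → Measurable (f j) := by
    intro j m h
    by_cases hj : j = i
    · simp only [f, hj, if_true]
      refine measurable_tierSum fun b hb => Measurable.mul ?_ (measurable_expNeg.comp
        (measurable_tierSum fun b' hb' => ?_))
      · exact (measurable_testAt (fun s hs => h s (by rw [hs, hb, hj])) hF).comp
          measurable_prodMk_left
      · exact (measurable_ite_contribution (fun s hs => h s (by rw [hs, hb', hj])) hv).comp
          measurable_prodMk_left
    · simp only [f, hj, if_false]
      refine measurable_expNeg.comp (measurable_tierSum fun b' hb' => ?_)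
      exact (measurable_contribution (fun s hs => h s (by rw [hs, hb'])) (hv _)).comp
          measurable_prodMk_left
  have hI : iIndepFun f μ := hR.iIndepFun (G := fun j => {s | s.tier = some j})
    (fun a b hab => by
      rw [Set.disjoint_left]
      intro s (hs : s.tier = some a) (hs' : s.tier = some b)
      exact hab (by simpa [hs] using hs'))
    fun j => hmeas j fun s hs => sigma_le_sigmaOf hs
  rw [lintegral_prod_eq_prod_lintegral_of_indepFun _ f hI fun j => hmeas j fun s _ => hR.sigma_le s,
    ← Finset.mul_prod_erase _ _ (Finset.mem_univ i),
    ← Finset.mul_prod_erase _ (D.tierLaplace (meanWeight v)) (Finset.mem_univ i), ← mul_assoc]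
  congr 1
  · simp only [f, if_true]
    exact lintegral_palm_tierSum hR hv u hF i
  · refine Finset.prod_congr rfl fun j hj => ?_
    simp only [f, Finset.ne_of_mem_erase hj, if_false]
    exact lintegral_expNeg_tierSum hR hv u j

open Classical in
/-- The reduced Campbell formula of the network seen from the user. -/
theorem lintegral_palm [Fintype κ₁] [Fintype κ₂] (hR : R.IsUncoupled D μ)
    (hv : ∀ j, Measurable (v j)) {F : Plane → ℝ≥0∞} (hF : Measurable F) (i : κ₁ ⊕ κ₂) :
    ∫⁻ ω, ∑' b : BSIndex κ₁ κ₂, (if b.tier = i then testAt R F (R.user ω) ω b else 0) *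
      expNeg (∑' b', if b' = b then 0 else R.contribution v (R.user ω) ω b') ∂μ =
      (∫⁻ x, F x * D.palmDensity (meanWeight v) i x) * ∏ j, D.tierLaplace (meanWeight v) j := by
  have hind : Indep (MeasurableSpace.comap R.user inferInstance) (R.sigmaOf {.user}ᶜ) μ := by
    have := hR.indep_sigmaOf (disjoint_compl_right (a := ({.user} : Set (Source κ₁ κ₂))))
    exact indep_of_indep_of_le_left this (sigma_le_sigmaOf (R := R) (mem_singleton Source.user))
  have hle : ∀ (j : κ₁ ⊕ κ₂) (s : Source κ₁ κ₂), s.tier = some j →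
      R.sigma s ≤ R.sigmaOf {.user}ᶜ := by
    intro j s hs
    refine sigma_le_sigmaOf ?_
    rintro rfl
    simp [Source.tier] at hs
  have hmeas : ∀ {m : MeasurableSpace Ω}, (∀ (j : κ₁ ⊕ κ₂) (s : Source κ₁ κ₂),
      s.tier = some j → R.sigma s ≤ m) → Measurable fun p : Plane × Ω =>
      ∑' b : BSIndex κ₁ κ₂, (if b.tier = i then testAt R F p.1 p.2 b else 0) *
      expNeg (∑' b', if b' = b then 0 else R.contribution v p.1 p.2 b') := fun h =>
    Measurable.tsum fun b => Measurable.mul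
      (by
        by_cases hb : b.tier = i
        · simp only [hb, if_true]; exact measurable_testAt (h _) hF
        · simp only [hb, if_false]; exact measurable_const)
      (measurable_expNeg_tsum fun b' => measurable_ite_contribution (h _) hv)
  -- The user is independent of the network, and the formula for fixed `u` has a right-hand side
  -- free of `u`; averaging over the location changes nothing.
  rw [lintegral_eq_lintegral_map_of_indep hR.user_measurable (hR.sigmaOf_le _) hind (hmeas hle)]
  simp_rw [lintegral_palm_fixed hR hv _ hF]
  have := Measure.isProbabilityMeasure_map (μ := μ) hR.user_measurable.aemeasurable
  simp

end NetworkPalm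

/-! ### Averaging the coverage event over the fading of the serving base station -/

section Fading

open Realization

lemma expMeasure_one_Ioi {t : ℝ} (ht : 0 ≤ t) :
    expMeasure 1 (Ioi t) = ENNReal.ofReal (Real.exp (-t)) := by
  have h := cdf_expMeasure_eq one_pos t
  rw [cdf_eq_real, if_pos ht] at h
  have h2 : (expMeasure 1).real (Ioi t) = Real.exp (-t) := by
    rw [← compl_Iic, probReal_compl_eq_one_sub measurableSet_Iic, h]
    simp
  rw [← h2, ofReal_measureReal]

lemma lintegral_expMeasure_lt (K : ℝ≥0∞) :
    ∫⁻ h, {h : ℝ | K < ENNReal.ofReal h}.indicator 1 h ∂(expMeasure 1) = expNeg K := by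
  rw [lintegral_indicator_one (measurableSet_lt measurable_const ENNReal.measurable_ofReal)]
  rcases eq_or_ne K ⊤ with rfl | hK
  · simp
  · rw [← ENNReal.ofReal_toReal hK, expNeg_ofReal ENNReal.toReal_nonneg,
      ← expMeasure_one_Ioi ENNReal.toReal_nonneg]
    congr 1
    ext h
    exact ENNReal.ofReal_lt_ofReal_iff'.trans
      ⟨fun h => h.1, fun h' => ⟨h', ENNReal.toReal_nonneg.trans_lt h'⟩⟩

/-- The exponential tilt of the density of rate `1` is `1 / (1 + c)` times the density of rate `1 +
c`. -/
lemma lintegral_expMeasure_expNeg_mul {c : ℝ} (hc : 0 ≤ c) :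
    ∫⁻ h, expNeg (ENNReal.ofReal (c * h)) ∂(expMeasure 1) = (1 + ENNReal.ofReal c)⁻¹ := by
  have hc' : 0 < 1 + c := by linarith
  have hm : ∀ r : ℝ, Measurable (exponentialPDF r) := fun r =>
    (measurable_exponentialPDFReal r).ennreal_ofReal
  have h1 : ∀ h : ℝ, exponentialPDF 1 h * expNeg (ENNReal.ofReal (c * h)) =
      (1 + ENNReal.ofReal c)⁻¹ * exponentialPDF (1 + c) h := fun h => by
    rcases lt_or_ge h 0 with hh | hh
    · simp [exponentialPDF_of_neg hh]
    · rw [exponentialPDF_of_nonneg hh, exponentialPDF_of_nonneg hh, expNeg_ofReal (by positivity),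
        ← ENNReal.ofReal_mul (by positivity), ← ENNReal.ofReal_one,
        ← ENNReal.ofReal_add one_pos.le hc,
        ← ENNReal.ofReal_inv_of_pos hc', ← ENNReal.ofReal_mul (by positivity)]
      congr 1
      rw [inv_mul_cancel_left₀ hc'.ne', one_mul, ← Real.exp_add]
      congr 1; ring
  have h2 : expMeasure 1 = volume.withDensity (exponentialPDF 1) := rfl
  rw [h2, lintegral_withDensity_eq_lintegral_mul _ (hm 1)
    (measurable_expNeg.fun_comp (by fun_prop))]
  simp only [Pi.mul_apply, h1]
  rw [lintegral_const_mul _ (hm _), lintegral_exponentialPDF_eq_one hc', mul_one]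

variable {Ω κ₁ κ₂ : Type*} [mΩ : MeasurableSpace Ω] {D : HetNet κ₁ κ₂} {μ : Measure Ω}
  [IsProbabilityMeasure μ] {R : Realization Ω κ₁ κ₂}

/-- The factor by which the noise and the interference are multiplied in the exponent of the
coverage probability of a user at distance `ρ` from its serving base station in tier `i`. -/
noncomputable def HetNet.scale (D : HetNet κ₁ κ₂) (i : κ₁ ⊕ κ₂) (ρ : ℝ) : ℝ :=
  D.τ i * ρ ^ D.α / D.P i

/-- The power received from a base station of tier `j` at relative location `p.1` with fading
`p.2`. -/
noncomputable def HetNet.power (D : HetNet κ₁ κ₂) (j : κ₁ ⊕ κ₂) (p : Plane × ℝ) : ℝ≥0∞ :=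
  ENNReal.ofReal (D.P j * p.2 * ‖p.1‖ ^ (-D.α))

lemma HetNet.measurable_power (j : κ₁ ⊕ κ₂) : Measurable (D.power j) := by
  unfold HetNet.power
  fun_prop

open Classical in
/-- The interference suffered by a user that is served by `b`. -/
noncomputable def interference (D : HetNet κ₁ κ₂) (R : Realization Ω κ₁ κ₂) (ω : Ω)
    (b : BSIndex κ₁ κ₂) : ℝ≥0∞ :=
  ∑' b', if b' = b then 0 else R.contribution D.power (R.user ω) ω b'

lemma sinr_eq (ω : Ω) (b : BSIndex κ₁ κ₂) :
    R.sinr D ω b = ENNReal.ofReal (R.rxPower D ω b) /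
      (ENNReal.ofReal D.N₀ + interference D R ω b) := by
  classical
  rw [sinr, interference]
  congr 2
  refine (tsum_subtype {b' | R.Present ω b' ∧ b' ≠ b} fun b' =>
    ENNReal.ofReal (R.rxPower D ω b')).trans ?_
  refine tsum_congr fun b' => ?_
  by_cases h1 : b' = b
  · rw [if_pos h1, indicator_of_notMem]
    exact fun h => h.2 h1
  · rw [if_neg h1, contribution]
    by_cases h2 : R.Present ω b'
    · rw [if_pos h2, indicator_of_mem (show b' ∈ {b' | R.Present ω b' ∧ b' ≠ b} from ⟨h2, h1⟩)]
      rfl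
    · rw [if_neg h2, indicator_of_notMem]
      exact fun h => h2 h.1

/-- Division by the mean power isolates the fading of `b`, which does not occur in its interference.
The case of a user located at `b` must be excluded: there `0 ^ (-α) = 0` makes the SINR zero, while
the scale on the right-hand side vanishes as well. -/
lemma lt_sinr_iff {ω : Ω} {b : BSIndex κ₁ κ₂} (h : R.loc ω b ≠ R.user ω) :
    ENNReal.ofReal (D.τ b.tier) < R.sinr D ω b ↔
      ENNReal.ofReal (D.scale b.tier ‖R.loc ω b - R.user ω‖) *
        (ENNReal.ofReal D.N₀ + interference D R ω b) < ENNReal.ofReal (R.fading b ω) := by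
  have hr : 0 < ‖R.loc ω b - R.user ω‖ := norm_pos_iff.2 (sub_ne_zero.2 h)
  have hτ := D.τ_pos b.tier
  have hP := D.P_pos b.tier
  set r := ‖R.loc ω b - R.user ω‖ with hrdef
  have hc : 0 < D.P b.tier * r ^ (-D.α) := mul_pos hP (Real.rpow_pos_of_pos hr _)
  have h1 : ENNReal.ofReal (R.rxPower D ω b) =
      ENNReal.ofReal (D.P b.tier * r ^ (-D.α)) * ENNReal.ofReal (R.fading b ω) := by
    rw [← ENNReal.ofReal_mul hc.le, rxPower, ← hrdef]
    congr 1; ring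
  have h2 : ENNReal.ofReal (D.τ b.tier) = ENNReal.ofReal (D.P b.tier * r ^ (-D.α)) *
      ENNReal.ofReal (D.scale b.tier r) := by
    rw [← ENNReal.ofReal_mul hc.le, HetNet.scale, Real.rpow_neg hr.le]
    congr 1
    have := (Real.rpow_pos_of_pos hr D.α).ne'
    field_simp
  rw [sinr_eq, ENNReal.lt_div_iff_mul_lt (Or.inr ENNReal.ofReal_ne_top)
    (Or.inr (by simpa using hτ)), h1, h2, mul_assoc]
  exact ENNReal.mul_lt_mul_iff_right (by simpa using hc) ENNReal.ofReal_ne_top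

open Classical in
lemma measurable_interference [Finite κ₁] [Finite κ₂] {m : MeasurableSpace Ω} {b : BSIndex κ₁ κ₂}
    (h : ∀ s : Source κ₁ κ₂, s ≠ .fading b → R.sigma s ≤ m) :
    Measurable fun ω => interference D R ω b := by
  refine Measurable.tsum fun b' => ?_
  by_cases hb : b' = b
  · simp only [hb, if_true]; exact measurable_const
  · simp only [hb, if_false]
    have hu : Measurable R.user := measurable_user (h .user (by simp))
    have hl : Measurable fun ω => R.loc ω b' := measurable_loc fun s _ hs => h s (hs b)
    refine Measurable.ite (measurableSet_present fun s _ hs => h s (hs b))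
      ((HetNet.measurable_power b'.tier).comp ?_) measurable_const
    exact (hl.sub hu).prodMk (measurable_fading (h _ (by simpa using hb)))

/-- The probability that a base station satisfies a condition that does not depend on its own
fading, and that its SINR exceeds the threshold. -/
lemma measure_inter_lt_sinr [Finite κ₁] [Finite κ₂] (hR : R.IsUncoupled D μ) (b : BSIndex κ₁ κ₂)
    {S : Set Ω} (hS : MeasurableSet[R.sigmaOf {.fading b}ᶜ] S)
    (hS0 : ∀ ω ∈ S, R.loc ω b ≠ R.user ω) :
    μ (S ∩ {ω | ENNReal.ofReal (D.τ b.tier) < R.sinr D ω b}) =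
      ∫⁻ ω, S.indicator (fun ω => expNeg (ENNReal.ofReal
        (D.scale b.tier ‖R.loc ω b - R.user ω‖) *
        (ENNReal.ofReal D.N₀ + interference D R ω b))) ω ∂μ := by
  set K : Ω → ℝ≥0∞ := fun ω => ENNReal.ofReal (D.scale b.tier ‖R.loc ω b - R.user ω‖) *
        (ENNReal.ofReal D.N₀ + interference D R ω b) with hK
  have hKm : ∀ {m : MeasurableSpace Ω}, (∀ s : Source κ₁ κ₂, s ≠ .fading b → R.sigma s ≤ m) →
      Measurable K := fun h => by
    have hu : Measurable R.user := measurable_user (h .user (by simp))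
    have hl : Measurable fun ω => R.loc ω b := measurable_loc fun s _ hs => h s (hs b)
    have hsc : Measurable fun y : Plane => ENNReal.ofReal (D.scale b.tier ‖y‖) := by
      unfold HetNet.scale
      fun_prop
    exact (hsc.comp (hl.sub hu)).mul (measurable_const.add (measurable_interference h))
  have hle : ∀ s : Source κ₁ κ₂, s ≠ .fading b → R.sigma s ≤ R.sigmaOf {.fading b}ᶜ :=
    fun s hs => sigma_le_sigmaOf hs
  let F : ℝ × Ω → ℝ≥0∞ := (Prod.snd ⁻¹' S ∩ {p | K p.2 < ENNReal.ofReal p.1}).indicator 1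
  have hF : ∀ {m : MeasurableSpace Ω}, (∀ s : Source κ₁ κ₂, s ≠ .fading b → R.sigma s ≤ m) →
      MeasurableSet S → Measurable F := fun h hS => by
    refine measurable_one.indicator ((measurable_snd hS).inter (measurableSet_lt ?_ ?_))
    · exact (hKm h).comp measurable_snd
    · exact ENNReal.measurable_ofReal.comp measurable_fst
  have hSΩ : MeasurableSet[mΩ] S := hR.sigmaOf_le _ _ hS
  have hind : Indep (MeasurableSpace.comap (R.fading b) inferInstance)
      (R.sigmaOf {.fading b}ᶜ) μ := by
    have := hR.indep_sigmaOf (disjoint_compl_right (a := ({.fading b} : Set (Source κ₁ κ₂))))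
    exact indep_of_indep_of_le_left this (sigma_le_sigmaOf (R := R)
      (mem_singleton (Source.fading b)))
  have key := lintegral_eq_lintegral_map_of_indep (hR.fading_measurable b) (hR.sigmaOf_le _) hind
    (F := F) (hF hle hS)
  have hset : S ∩ {ω | ENNReal.ofReal (D.τ b.tier) < R.sinr D ω b} =
      S ∩ {ω | K ω < ENNReal.ofReal (R.fading b ω)} := by
    ext ω
    refine and_congr_right fun hω => ?_
    exact lt_sinr_iff (hS0 ω hω)
  have hmeas : MeasurableSet (S ∩ {ω | K ω < ENNReal.ofReal (R.fading b ω)}) :=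
    hSΩ.inter (measurableSet_lt (hKm fun s _ => hR.sigma_le s)
      (ENNReal.measurable_ofReal.comp (hR.fading_measurable b)))
  rw [hset, ← lintegral_indicator_one hmeas]
  refine Eq.trans ?_ (key.trans ?_)
  · rfl
  -- With the remaining randomness frozen, the fading only has to exceed `K ω`, which has
  -- probability `expNeg (K ω)`.
  · rw [hR.fading_law, lintegral_lintegral_swap (f := fun x ω => F (x, ω))
      (hF (fun s _ => hR.sigma_le s) hSΩ).aemeasurable]
    refine lintegral_congr fun ω => ?_
    by_cases hω : ω ∈ S
    · rw [indicator_of_mem hω, ← lintegral_expMeasure_lt]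
      refine lintegral_congr fun h => ?_
      simp [F, indicator, hω, hK]
    · rw [indicator_of_notMem hω]
      simp [F, hω]

end Fading

/-! ### Serving base stations and exclusion discs -/

section Sandwich

open Realization

variable {Ω κ₁ κ₂ : Type*} {D : HetNet κ₁ κ₂}

namespace HetNet

lemma Pbar_pos (j i : κ₁ ⊕ κ₂) : 0 < D.Pbar j i :=
  Real.rpow_pos_of_pos (div_pos (D.P_pos j) (D.P_pos i)) _

lemma α_pos : 0 < D.α := by linarith [D.two_lt_α]

lemma Pbar_rpow (j i : κ₁ ⊕ κ₂) : D.Pbar j i ^ D.α = D.P j / D.P i := by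
  rw [Pbar, ← Real.rpow_mul (div_pos (D.P_pos j) (D.P_pos i)).le,
    one_div_mul_cancel D.α_pos.ne', Real.rpow_one]

lemma power_ratio (j i : κ₁ ⊕ κ₂) {y r : ℝ} (hy : 0 < y) (hr : 0 < r) :
    D.P j * y ^ (-D.α) = D.P i * r ^ (-D.α) * (D.Pbar j i * r / y) ^ D.α := by
  have hP := D.P_pos i
  rw [Real.div_rpow (mul_pos (Pbar_pos j i) hr).le hy.le, Real.mul_rpow (Pbar_pos j i).le hr.le,
    Pbar_rpow, Real.rpow_neg hy.le, Real.rpow_neg hr.le]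
  have := (Real.rpow_pos_of_pos hr D.α).ne'
  field_simp

/-- This translates association by mean power into exclusion discs. -/
lemma power_le_iff (j i : κ₁ ⊕ κ₂) {y r : ℝ} (hy : 0 < y) (hr : 0 < r) :
    D.P j * y ^ (-D.α) ≤ D.P i * r ^ (-D.α) ↔ D.Pbar j i * r ≤ y := by
  have hpos : 0 < D.P i * r ^ (-D.α) := mul_pos (D.P_pos i) (Real.rpow_pos_of_pos hr _)
  have ht : 0 ≤ D.Pbar j i * r / y := by have := Pbar_pos (D := D) j i; positivity
  rw [power_ratio j i hy hr, mul_le_iff_le_one_right hpos, ← Real.one_rpow D.α,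
    Real.rpow_le_rpow_iff ht zero_le_one D.α_pos, div_le_one hy]

lemma power_lt_iff (j i : κ₁ ⊕ κ₂) {y r : ℝ} (hy : 0 < y) (hr : 0 < r) :
    D.P j * y ^ (-D.α) < D.P i * r ^ (-D.α) ↔ D.Pbar j i * r < y := by
  have hpos : 0 < D.P i * r ^ (-D.α) := mul_pos (D.P_pos i) (Real.rpow_pos_of_pos hr _)
  have ht : 0 ≤ D.Pbar j i * r / y := by have := Pbar_pos (D := D) j i; positivity
  rw [power_ratio j i hy hr, mul_lt_iff_lt_one_right hpos, ← Real.one_rpow D.α,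
    Real.rpow_lt_rpow_iff ht zero_le_one D.α_pos, div_lt_one hy]

lemma scale_nonneg (i : κ₁ ⊕ κ₂) {ρ : ℝ} (hρ : 0 ≤ ρ) : 0 ≤ D.scale i ρ :=
  div_nonneg (mul_nonneg (D.τ_pos i).le (Real.rpow_nonneg hρ _)) (D.P_pos i).le

lemma scale_mono (i : κ₁ ⊕ κ₂) {ρ r : ℝ} (hρ : 0 ≤ ρ) (h : ρ ≤ r) : D.scale i ρ ≤ D.scale i r :=
  div_le_div_of_nonneg_right (mul_le_mul_of_nonneg_left (Real.rpow_le_rpow hρ h D.α_pos.le)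
    (D.τ_pos i).le) (D.P_pos i).le

variable (D) in
/-- The weight of a base station of tier `j` in the exponent of the coverage probability of a user
that is served by a base station of tier `i` at distance `ρ`; it is infinite if the base station
would be preferred to the serving one. -/
noncomputable def exclusionWeight (i : κ₁ ⊕ κ₂) (ρ : ℝ) (j : κ₁ ⊕ κ₂) (p : Plane × ℝ) : ℝ≥0∞ :=
  -- The disc is punctured because a station located at the user has mean power `0` under the
  -- convention `0 ^ (-α) = 0`, and so is never preferred.
  (if 0 < ‖p.1‖ ∧ ‖p.1‖ < D.Pbar j i * ρ then ⊤ else 0) +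
    ENNReal.ofReal (D.scale i ρ) * D.power j p

lemma measurable_exclusionWeight (i : κ₁ ⊕ κ₂) (ρ : ℝ) (j : κ₁ ⊕ κ₂) :
    Measurable (D.exclusionWeight i ρ j) := by
  refine Measurable.add (Measurable.ite ?_ measurable_const measurable_const)
    ((measurable_power j).const_mul _)
  exact (measurableSet_lt measurable_const measurable_fst.norm).inter
    (measurableSet_lt measurable_fst.norm measurable_const)

variable (D) in
/-- The mean of `exp (-D.exclusionWeight i ρ j (y, h))` over the fading `h`. -/
noncomputable def fadedWeight (i : κ₁ ⊕ κ₂) (ρ : ℝ) (j : κ₁ ⊕ κ₂) (y : Plane) : ℝ≥0∞ :=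
  if 0 < ‖y‖ ∧ ‖y‖ < D.Pbar j i * ρ then 0
  else (1 + ENNReal.ofReal (D.scale i ρ * (D.P j * ‖y‖ ^ (-D.α))))⁻¹

lemma meanWeight_exclusionWeight (i : κ₁ ⊕ κ₂) {ρ : ℝ} (hρ : 0 ≤ ρ) :
    meanWeight (D.exclusionWeight i ρ) = D.fadedWeight i ρ := by
  ext j y
  rw [meanWeight, fadedWeight]
  by_cases h : 0 < ‖y‖ ∧ ‖y‖ < D.Pbar j i * ρ
  · simp [exclusionWeight, h]
  · have hs := scale_nonneg (D := D) i hρ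
    have hP := (D.P_pos j).le
    rw [if_neg h, ← lintegral_expMeasure_expNeg_mul (by positivity)]
    refine lintegral_congr fun x => ?_
    rw [exclusionWeight, if_neg h, zero_add, power, ← ENNReal.ofReal_mul hs]
    congr 2; ring

lemma measurable_fadedWeight (i : κ₁ ⊕ κ₂) (ρ : ℝ) (j : κ₁ ⊕ κ₂) :
    Measurable (D.fadedWeight i ρ j) := by
  refine Measurable.ite ?_ measurable_const (by fun_prop)
  exact (measurableSet_lt measurable_const measurable_norm).inter
    (measurableSet_lt measurable_norm measurable_const)

variable (D) in
/-- The density at relative location `x` of base stations of tier `i` that provide coverage to the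
user, if the exclusion discs and the interference are determined as for a serving base station at
distance `ρ`. -/
noncomputable def coverageDensity [Fintype κ₁] [Fintype κ₂] (i : κ₁ ⊕ κ₂) (ρ : ℝ) (x : Plane) :
    ℝ≥0∞ :=
  expNeg (ENNReal.ofReal (D.scale i ρ) * ENNReal.ofReal D.N₀) *
    (D.palmDensity (D.fadedWeight i ρ) i x * ∏ j, D.tierLaplace (D.fadedWeight i ρ) j)

lemma measurable_palmDensity {W : κ₁ ⊕ κ₂ → Plane → ℝ≥0∞} (hW : ∀ j, Measurable (W j))
    (i : κ₁ ⊕ κ₂) : Measurable (D.palmDensity W i) := by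
  cases i with
  | inl k =>
    have hg : Measurable fun x => ENNReal.ofReal (D.g k x) := (D.g_measurable k).ennreal_ofReal
    have h : Measurable fun p : Plane × Plane =>
        ENNReal.ofReal (D.g k (p.1 - p.2)) * D.clusterLaplace W k p.2 :=
      (hg.comp (measurable_fst.sub measurable_snd)).mul
        ((measurable_clusterLaplace (hW _)).comp measurable_snd)
    exact h.lintegral_prod_right'.const_mul _
  | inr k => exact measurable_const

lemma measurable_coverageDensity [Fintype κ₁] [Fintype κ₂] (i : κ₁ ⊕ κ₂) (ρ : ℝ) :
    Measurable (D.coverageDensity i ρ) :=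
  ((measurable_palmDensity (measurable_fadedWeight i ρ) i).mul_const _).const_mul _

end HetNet

open HetNet

variable {R : Realization Ω κ₁ κ₂}

/-- `b` is the only serving base station. -/
def IsStrictlyServing (D : HetNet κ₁ κ₂) (R : Realization Ω κ₁ κ₂) (ω : Ω) (b : BSIndex κ₁ κ₂) :
    Prop :=
  R.Present ω b ∧ ∀ b', b' ≠ b → R.Present ω b' → R.meanPower D ω b' < R.meanPower D ω b

open Classical in
/-- The exponent in the coverage probability, without the noise, of a user that is served by `b`,
with exclusion discs and interference as for a serving base station at distance `ρ`. -/
noncomputable def exclusionSum (D : HetNet κ₁ κ₂) (R : Realization Ω κ₁ κ₂) (ρ : ℝ) (ω : Ω)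
    (b : BSIndex κ₁ κ₂) : ℝ≥0∞ :=
  ∑' b', if b' = b then 0 else R.contribution (D.exclusionWeight b.tier ρ) (R.user ω) ω b'

/-- Shrinking the radius to `ρ` lowers the scale, and no competitor of a server lies in the smaller
exclusion discs, so no infinite weight occurs. The exponent can only decrease. -/
lemma expNeg_le_of_isServing {ω : Ω} {b : BSIndex κ₁ κ₂} (hb : R.IsServing D ω b)
    (h0 : R.loc ω b ≠ R.user ω) {ρ : ℝ} (hρ0 : 0 ≤ ρ) (hρ : ρ ≤ ‖R.loc ω b - R.user ω‖) :
    expNeg (ENNReal.ofReal (D.scale b.tier ‖R.loc ω b - R.user ω‖) *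
        (ENNReal.ofReal D.N₀ + interference D R ω b)) ≤
      expNeg (ENNReal.ofReal (D.scale b.tier ρ) * ENNReal.ofReal D.N₀) *
        expNeg (exclusionSum D R ρ ω b) := by
  classical
  have hr : 0 < ‖R.loc ω b - R.user ω‖ := norm_pos_iff.2 (sub_ne_zero.2 h0)
  have hsc := ENNReal.ofReal_le_ofReal (scale_mono (D := D) b.tier hρ0 hρ)
  rw [← expNeg_add]
  apply expNeg_antitone
  rw [mul_add]
  refine add_le_add (mul_le_mul_left hsc _) ?_
  rw [exclusionSum, interference, ← ENNReal.tsum_mul_left]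
  refine ENNReal.tsum_le_tsum fun b' => ?_
  by_cases hbb : b' = b
  · simp [hbb]
  · rw [if_neg hbb, if_neg hbb, contribution, contribution]
    by_cases hp : R.Present ω b'
    · rw [if_pos hp, if_pos hp, exclusionWeight, if_neg, zero_add]
      · exact mul_le_mul_left hsc _
      · rintro ⟨h1, h2⟩
        have h3 := (power_le_iff b'.tier b.tier h1 hr).1 (hb.2 b' hp)
        have := mul_le_mul_of_nonneg_left hρ (Pbar_pos (D := D) b'.tier b.tier).le
        linarith
    · simp [hp]

/-- If `b` is not the strict maximizer, some competitor lies in the closed exclusion disc of the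
true radius, hence in the open one of the larger radius `ρ`, and the left-hand side is zero.
Otherwise enlarging the radius only increases the exponent. The strict inequality in `hρ` takes care
of ties. -/
lemma le_expNeg_of_isStrictlyServing {ω : Ω} {b : BSIndex κ₁ κ₂} (hb : R.Present ω b)
    (h0 : R.loc ω b ≠ R.user ω) {ρ : ℝ} (hρ : ‖R.loc ω b - R.user ω‖ < ρ) :
    expNeg (ENNReal.ofReal (D.scale b.tier ρ) * ENNReal.ofReal D.N₀) *
        expNeg (exclusionSum D R ρ ω b) ≤
      {ω | IsStrictlyServing D R ω b}.indicator (fun ω => expNeg (ENNReal.ofReal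
        (D.scale b.tier ‖R.loc ω b - R.user ω‖) *
        (ENNReal.ofReal D.N₀ + interference D R ω b))) ω := by
  classical
  have hr : 0 < ‖R.loc ω b - R.user ω‖ := norm_pos_iff.2 (sub_ne_zero.2 h0)
  have hsc := ENNReal.ofReal_le_ofReal (scale_mono (D := D) b.tier hr.le hρ.le)
  by_cases hs : IsStrictlyServing D R ω b
  · rw [indicator_of_mem (show ω ∈ {ω | IsStrictlyServing D R ω b} from hs), ← expNeg_add]
    apply expNeg_antitone
    rw [mul_add]
    refine add_le_add (mul_le_mul_left hsc _) ?_
    rw [exclusionSum, interference, ← ENNReal.tsum_mul_left]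
    refine ENNReal.tsum_le_tsum fun b' => ?_
    by_cases hbb : b' = b
    · simp [hbb]
    · rw [if_neg hbb, if_neg hbb, contribution, contribution]
      by_cases hp : R.Present ω b'
      · rw [if_pos hp, if_pos hp, exclusionWeight]
        exact (mul_le_mul_left hsc _).trans le_add_self
      · simp [hp]
  · have : ∃ b', b' ≠ b ∧ R.Present ω b' ∧ R.meanPower D ω b ≤ R.meanPower D ω b' := by
      by_contra! hcon
      exact hs ⟨hb, hcon⟩
    obtain ⟨b', hbb, hp, hle⟩ := this
    have hb'0 : 0 < ‖R.loc ω b' - R.user ω‖ := by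
      rcases (norm_nonneg (R.loc ω b' - R.user ω)).eq_or_lt with h | h
      · exfalso
        have h1 : R.meanPower D ω b' = 0 := by
          rw [meanPower, ← h, Real.zero_rpow (neg_ne_zero.2 D.α_pos.ne'), mul_zero]
        have h2 : 0 < R.meanPower D ω b := mul_pos (D.P_pos _) (Real.rpow_pos_of_pos hr _)
        linarith
      · exact h
    have hle2 : ‖R.loc ω b' - R.user ω‖ ≤ D.Pbar b'.tier b.tier * ‖R.loc ω b - R.user ω‖ := by
      by_contra! hlt
      exact absurd ((power_lt_iff b'.tier b.tier hb'0 hr).2 hlt) (not_lt.2 hle)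
    have htop : exclusionSum D R ρ ω b = ⊤ := by
      refine ENNReal.tsum_eq_top_of_eq_top ⟨b', ?_⟩
      rw [if_neg hbb, contribution, if_pos hp, exclusionWeight, if_pos, top_add]
      exact ⟨hb'0, hle2.trans_lt (mul_lt_mul_of_pos_left hρ (Pbar_pos _ _))⟩
    rw [htop]
    simp

variable [mΩ : MeasurableSpace Ω] {μ : Measure Ω} [IsProbabilityMeasure μ]

lemma measurable_meanPower {m : MeasurableSpace Ω} {b b' : BSIndex κ₁ κ₂}
    (h : ∀ s : Source κ₁ κ₂, s ≠ .fading b → R.sigma s ≤ m) :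
    Measurable fun ω => R.meanPower D ω b' := by
  have hu : Measurable R.user := measurable_user (h .user (by simp))
  have hl : Measurable fun ω => R.loc ω b' := measurable_loc fun s _ hs => h s (hs b)
  exact (((hl.sub hu).norm).pow_const _).const_mul _

lemma measurableSet_isServing [Finite κ₁] [Finite κ₂] {m : MeasurableSpace Ω} {b : BSIndex κ₁ κ₂}
    (h : ∀ s : Source κ₁ κ₂, s ≠ .fading b → R.sigma s ≤ m) :
    MeasurableSet {ω | R.IsServing D ω b} := by
  have hp : ∀ b', MeasurableSet {ω | R.Present ω b'} := fun b' =>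
    measurableSet_present fun s _ hs => h s (hs b)
  refine (hp b).inter (?_ : MeasurableSet {ω | ∀ b', _})
  rw [Set.ofPred_forall]
  refine MeasurableSet.iInter fun b' => ?_
  refine MeasurableSet.imp (hp b') ?_
  exact measurableSet_le (measurable_meanPower h) (measurable_meanPower h)

lemma measurableSet_isStrictlyServing [Finite κ₁] [Finite κ₂] {m : MeasurableSpace Ω}
    {b : BSIndex κ₁ κ₂} (h : ∀ s : Source κ₁ κ₂, s ≠ .fading b → R.sigma s ≤ m) :
    MeasurableSet {ω | IsStrictlyServing D R ω b} := by
  have hp : ∀ b', MeasurableSet {ω | R.Present ω b'} := fun b' =>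
    measurableSet_present fun s _ hs => h s (hs b)
  refine (hp b).inter (?_ : MeasurableSet {ω | ∀ b', _})
  rw [Set.ofPred_forall]
  refine MeasurableSet.iInter fun b' => ?_
  refine MeasurableSet.imp (MeasurableSet.const _) (MeasurableSet.imp (hp b') ?_)
  exact measurableSet_lt (measurable_meanPower h) (measurable_meanPower h)

end Sandwich

/-! ### Continuity of the coverage density in the exclusion radius -/

section Continuity

variable {κ₁ κ₂ : Type*} {D : HetNet κ₁ κ₂}

namespace HetNet

lemma lintegral_g_sub_left (k : κ₁) (x : Plane) :
    ∫⁻ z, ENNReal.ofReal (D.g k (x - z)) = 1 := by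
  rw [lintegral_sub_left_eq_self (fun s => ENNReal.ofReal (D.g k s)) x, D.g_lintegral]

lemma measurable_ofReal_g (k : κ₁) : Measurable fun s => ENNReal.ofReal (D.g k s) :=
  (D.g_measurable k).ennreal_ofReal

section General

variable {V W : κ₁ ⊕ κ₂ → Plane → ℝ≥0∞} {Wn : ℕ → κ₁ ⊕ κ₂ → Plane → ℝ≥0∞}

lemma clusterLaplace_mono (h : ∀ j y, V j y ≤ W j y) (k : κ₁) (z : Plane) :
    D.clusterLaplace V k z ≤ D.clusterLaplace W k z := by
  apply expNeg_antitone
  gcongr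
  exact h _ _

/-- By `1 - exp (-t) ≤ t` and Tonelli, the offspring density integrates out. Integrability of `1 -
V` over the infinite plane is thereby inherited by clusters. -/
lemma lintegral_one_sub_clusterLaplace_le {k : κ₁} (hV : Measurable (V (.inl k)))
    (hV1 : ∀ y, V (.inl k) y ≤ 1) :
    ∫⁻ z, (1 - D.clusterLaplace V k z) ≤
      ENNReal.ofReal (D.mbar k) * ∫⁻ y, (1 - V (.inl k) y) := by
  have hg := measurable_ofReal_g (D := D) k
  have h1 : ∀ z, 1 - ∫⁻ s, ENNReal.ofReal (D.g k s) * V (.inl k) (z + s) =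
      ∫⁻ s, ENNReal.ofReal (D.g k s) * (1 - V (.inl k) (z + s)) := fun z => by
    have hm : Measurable fun s => ENNReal.ofReal (D.g k s) * V (.inl k) (z + s) :=
      hg.mul (hV.fun_comp (by fun_prop))
    have hle : ∀ s, ENNReal.ofReal (D.g k s) * V (.inl k) (z + s) ≤ ENNReal.ofReal (D.g k s) :=
      fun s => mul_le_of_le_one_right' (hV1 _)
    refine (congrArg (· - _) (D.g_lintegral k).symm).trans ?_
    rw [← lintegral_sub hm _ (ae_of_all _ hle)]
    · refine lintegral_congr fun s => ?_
      rw [ENNReal.mul_sub fun _ _ => ENNReal.ofReal_ne_top, mul_one]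
    · exact ((lintegral_mono hle).trans_lt (by rw [D.g_lintegral]; exact ENNReal.one_lt_top)).ne
  calc ∫⁻ z, (1 - D.clusterLaplace V k z)
      ≤ ∫⁻ z, ENNReal.ofReal (D.mbar k) *
          ∫⁻ s, ENNReal.ofReal (D.g k s) * (1 - V (.inl k) (z + s)) :=
        lintegral_mono fun z => by
          rw [← h1 z]
          exact one_sub_expNeg_le _
    _ = ENNReal.ofReal (D.mbar k) * ∫⁻ y, (1 - V (.inl k) y) := by
        have hm : Measurable fun p : Plane × Plane =>
            ENNReal.ofReal (D.g k p.2) * (1 - V (.inl k) (p.1 + p.2)) :=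
          (hg.comp measurable_snd).mul
            (measurable_const.sub (hV.comp (measurable_fst.add measurable_snd)))
        rw [lintegral_const_mul _ hm.lintegral_prod_right',
          lintegral_lintegral_swap (f := fun z s =>
            ENNReal.ofReal (D.g k s) * (1 - V (.inl k) (z + s))) hm.aemeasurable]
        congr 1
        have h2 : ∀ s, ∫⁻ z, ENNReal.ofReal (D.g k s) * (1 - V (.inl k) (z + s)) =
            ENNReal.ofReal (D.g k s) * ∫⁻ y, (1 - V (.inl k) y) := fun s => by
          rw [lintegral_const_mul' _ _ ENNReal.ofReal_ne_top,
            lintegral_add_right_eq_self (fun y => 1 - V (.inl k) y) s]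
        simp_rw [h2]
        rw [lintegral_mul_const _ hg, D.g_lintegral, one_mul]

variable (hWn : ∀ n j, Measurable (Wn n j)) (hWn1 : ∀ n j y, Wn n j y ≤ 1)
  (hlim : ∀ j, ∀ᵐ y, Tendsto (fun n => Wn n j y) atTop (𝓝 (W j y)))

include hWn hWn1 hlim in
lemma tendsto_clusterLaplace (k : κ₁) (z : Plane) :
    Tendsto (fun n => D.clusterLaplace (Wn n) k z) atTop (𝓝 (D.clusterLaplace W k z)) := by
  refine (continuous_expNeg.tendsto _).comp (ENNReal.Tendsto.const_mul ?_
    (Or.inr ENNReal.ofReal_ne_top))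
  refine ENNReal.Tendsto.sub tendsto_const_nhds ?_ (Or.inl ENNReal.one_ne_top)
  refine tendsto_lintegral_of_dominated_convergence (fun s => ENNReal.ofReal (D.g k s))
    (fun n => (measurable_ofReal_g k).mul ((hWn n _).fun_comp (by fun_prop)))
    (fun n => ae_of_all _ fun s => mul_le_of_le_one_right' (hWn1 _ _ _))
    (by rw [D.g_lintegral]; exact ENNReal.one_ne_top) ?_
  have := (measurePreserving_add_left (volume : Measure Plane) z).quasiMeasurePreserving.ae
    (hlim (.inl k))
  filter_upwards [this] with s hs
  exact ENNReal.Tendsto.const_mul hs (Or.inr ENNReal.ofReal_ne_top)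

variable (hV : ∀ j, Measurable (V j)) (hVW : ∀ n j y, V j y ≤ Wn n j y)
  (hVfin : ∀ j, ∫⁻ y, (1 - V j y) ≠ ⊤)

include hWn hWn1 hlim hV hVW hVfin in
-- The plane has infinite area, so bounded weights do not suffice for dominated convergence; the
-- common lower bound `V` supplies the integrable majorant `1 - V`, or `1 - D.clusterLaplace V k`
-- for clusters.
lemma tendsto_tierLaplace (j : κ₁ ⊕ κ₂) :
    Tendsto (fun n => D.tierLaplace (Wn n) j) atTop (𝓝 (D.tierLaplace W j)) := by
  cases j with
  | inl k =>
    refine (continuous_expNeg.tendsto _).comp (ENNReal.Tendsto.const_mul ?_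
      (Or.inr ENNReal.ofReal_ne_top))
    refine tendsto_lintegral_of_dominated_convergence (fun z => 1 - D.clusterLaplace V k z)
      (fun n => measurable_const.sub (measurable_clusterLaplace (hWn n _)))
      (fun n => ae_of_all _ fun z => tsub_le_tsub_left (clusterLaplace_mono (hVW n) k z) _)
      ?_ (ae_of_all _ fun z => ?_)
    · exact ((lintegral_one_sub_clusterLaplace_le (hV _)
        fun y => (hVW 0 _ y).trans (hWn1 0 _ y)).trans_lt
        (ENNReal.mul_lt_top ENNReal.ofReal_lt_top (hVfin _).lt_top)).ne
    · exact ENNReal.Tendsto.sub tendsto_const_nhds (tendsto_clusterLaplace hWn hWn1 hlim k z)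
        (Or.inl ENNReal.one_ne_top)
  | inr k =>
    refine (continuous_expNeg.tendsto _).comp (ENNReal.Tendsto.const_mul ?_
      (Or.inr ENNReal.ofReal_ne_top))
    refine tendsto_lintegral_of_dominated_convergence (fun y => 1 - V (.inr k) y)
      (fun n => measurable_const.sub (hWn n _))
      (fun n => ae_of_all _ fun z => tsub_le_tsub_left (hVW n _ z) _) (hVfin _) ?_
    filter_upwards [hlim (.inr k)] with y hy
    exact ENNReal.Tendsto.sub tendsto_const_nhds hy (Or.inl ENNReal.one_ne_top)

include hWn hWn1 hlim in
lemma tendsto_palmDensity (i : κ₁ ⊕ κ₂) (x : Plane) :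
    Tendsto (fun n => D.palmDensity (Wn n) i x) atTop (𝓝 (D.palmDensity W i x)) := by
  cases i with
  | inl k =>
    refine ENNReal.Tendsto.const_mul ?_
      (Or.inr (ENNReal.mul_ne_top ENNReal.ofReal_ne_top ENNReal.ofReal_ne_top))
    refine tendsto_lintegral_of_dominated_convergence (fun z => ENNReal.ofReal (D.g k (x - z)))
      (fun n => ((measurable_ofReal_g k).fun_comp (by fun_prop)).mul
        (measurable_clusterLaplace (hWn n _)))
      (fun n => ae_of_all _ fun z => mul_le_of_le_one_right' (clusterLaplace_le_one k z))
      (by rw [lintegral_g_sub_left]; exact ENNReal.one_ne_top) (ae_of_all _ fun z => ?_)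
    exact ENNReal.Tendsto.const_mul (tendsto_clusterLaplace hWn hWn1 hlim k z)
      (Or.inr ENNReal.ofReal_ne_top)
  | inr k => exact tendsto_const_nhds

end General

variable (D) in
/-- The intensity of a tier. -/
noncomputable def intensity : κ₁ ⊕ κ₂ → ℝ≥0∞
  | .inl k => ENNReal.ofReal (D.lamP k) * ENNReal.ofReal (D.mbar k)
  | .inr k => ENNReal.ofReal (D.lam k)

lemma intensity_ne_top (i : κ₁ ⊕ κ₂) : D.intensity i ≠ ⊤ := by
  cases i with
  | inl k => exact ENNReal.mul_ne_top ENNReal.ofReal_ne_top ENNReal.ofReal_ne_top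
  | inr k => exact ENNReal.ofReal_ne_top

lemma palmDensity_le (W : κ₁ ⊕ κ₂ → Plane → ℝ≥0∞) (i : κ₁ ⊕ κ₂) (x : Plane) :
    D.palmDensity W i x ≤ D.intensity i := by
  cases i with
  | inl k =>
    refine mul_le_of_le_one_right' ?_
    rw [← lintegral_g_sub_left k x]
    exact lintegral_mono fun z => mul_le_of_le_one_right' (clusterLaplace_le_one k z)
  | inr k => exact le_rfl

lemma coverageDensity_le [Fintype κ₁] [Fintype κ₂] (i : κ₁ ⊕ κ₂) (ρ : ℝ) (x : Plane) :
    D.coverageDensity i ρ x ≤ D.intensity i :=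
  (mul_le_of_le_one_left' (expNeg_le_one _)).trans
    ((mul_le_of_le_one_right' (Finset.prod_le_one' fun j _ => tierLaplace_le_one j)).trans
      (palmDensity_le _ i x))

lemma fadedWeight_le_one (i : κ₁ ⊕ κ₂) (ρ : ℝ) (j : κ₁ ⊕ κ₂) (y : Plane) :
    D.fadedWeight i ρ j y ≤ 1 := by
  rw [fadedWeight]
  split_ifs
  · exact zero_le_one
  · exact ENNReal.inv_le_one.2 le_self_add

lemma fadedWeight_antitone (i : κ₁ ⊕ κ₂) {ρ ρ' : ℝ} (hρ : 0 ≤ ρ) (h : ρ ≤ ρ') (j : κ₁ ⊕ κ₂)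
    (y : Plane) : D.fadedWeight i ρ' j y ≤ D.fadedWeight i ρ j y := by
  have hP := (D.P_pos j).le
  rw [fadedWeight, fadedWeight]
  by_cases h1 : 0 < ‖y‖ ∧ ‖y‖ < D.Pbar j i * ρ
  · rw [if_pos h1, if_pos ⟨h1.1, h1.2.trans_le (mul_le_mul_of_nonneg_left h (Pbar_pos j i).le)⟩]
  · rw [if_neg h1]
    split_ifs
    · exact zero_le
    · refine ENNReal.inv_le_inv.2 (add_le_add_right (ENNReal.ofReal_le_ofReal ?_) _)
      exact mul_le_mul_of_nonneg_right (scale_mono i hρ h) (by positivity)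

/-- Outside a disc, `1 - 1 / (1 + t) ≤ t` gives decay of order `‖y‖ ^ (-α)`, integrable in the plane
because `α > 2`. -/
lemma lintegral_one_sub_fadedWeight_ne_top (i : κ₁ ⊕ κ₂) {ρ : ℝ} (hρ : 0 ≤ ρ) (j : κ₁ ⊕ κ₂) :
    ∫⁻ y, (1 - D.fadedWeight i ρ j y) ≠ ⊤ := by
  set c := D.scale i ρ * D.P j with hc
  have hc0 : 0 ≤ c := mul_nonneg (scale_nonneg i hρ) (D.P_pos j).le
  -- The `1` ensures `1 + ‖y‖ ≤ 2 * ‖y‖` outside the disc, whence the constant `2 ^ α`.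
  set T := max 1 (D.Pbar j i * ρ)
  have hle : ∀ y : Plane, 1 - D.fadedWeight i ρ j y ≤ (Metric.ball (0 : Plane) T).indicator 1 y +
      ENNReal.ofReal (c * 2 ^ D.α) * ENNReal.ofReal ((1 + ‖y‖) ^ (-D.α)) := fun y => by
    by_cases hy : y ∈ Metric.ball (0 : Plane) T
    · rw [indicator_of_mem hy]
      exact tsub_le_self.trans le_self_add
    · rw [indicator_of_notMem hy, zero_add]
      rw [mem_ball_zero_iff, not_lt, max_le_iff] at hy
      rw [fadedWeight, if_neg fun h => absurd h.2 (not_lt.2 hy.2)]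
      have h1 : 1 - (1 + ENNReal.ofReal (D.scale i ρ * (D.P j * ‖y‖ ^ (-D.α))))⁻¹ ≤
          ENNReal.ofReal (D.scale i ρ * (D.P j * ‖y‖ ^ (-D.α))) := by
        set t := ENNReal.ofReal (D.scale i ρ * (D.P j * ‖y‖ ^ (-D.α)))
        rw [tsub_le_iff_right]
        have h2 : (1 + t) * (1 + t)⁻¹ = 1 := ENNReal.mul_inv_cancel (by simp)
          (by simp [t])
        calc (1 : ℝ≥0∞) = (1 + t)⁻¹ + t * (1 + t)⁻¹ := h2.symm.trans (by rw [add_mul, one_mul])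
          _ ≤ t + (1 + t)⁻¹ := by
            rw [add_comm]
            exact add_le_add_left (mul_le_of_le_one_right' (ENNReal.inv_le_one.2 le_self_add)) _
      refine h1.trans ?_
      rw [← ENNReal.ofReal_mul (by positivity)]
      apply ENNReal.ofReal_le_ofReal
      rw [← mul_assoc, ← hc, mul_assoc c]
      refine mul_le_mul_of_nonneg_left ?_ hc0
      have h3 : (2 : ℝ) ^ D.α = (2⁻¹ : ℝ) ^ (-D.α) := by
        rw [Real.rpow_neg (by norm_num), Real.inv_rpow (by norm_num), inv_inv]
      rw [h3, ← Real.mul_rpow (by norm_num) (by positivity)]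
      exact Real.rpow_le_rpow_of_nonpos (by positivity) (by linarith [hy.1])
        (neg_nonpos.2 D.α_pos.le)
  refine ((lintegral_mono hle).trans_lt ?_).ne
  rw [lintegral_add_left (measurable_one.indicator Metric.isOpen_ball.measurableSet),
    lintegral_indicator_one Metric.isOpen_ball.measurableSet,
    lintegral_const_mul' _ _ ENNReal.ofReal_ne_top]
  refine ENNReal.add_lt_top.2 ⟨measure_ball_lt_top, ENNReal.mul_lt_top ENNReal.ofReal_lt_top ?_⟩
  exact finite_integral_one_add_norm (by simpa using D.two_lt_α)

/-- In `ρ` the weight jumps only when `y` is on the boundary of the exclusion disc, and a circle is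
a null set. -/
lemma tendsto_fadedWeight (i : κ₁ ⊕ κ₂) {ρ : ℝ} {ρn : ℕ → ℝ} (hρ : 0 < ρ)
    (h : Tendsto ρn atTop (𝓝 ρ)) (j : κ₁ ⊕ κ₂) :
    ∀ᵐ y, Tendsto (fun n => D.fadedWeight i (ρn n) j y) atTop (𝓝 (D.fadedWeight i ρ j y)) := by
  have hsph : ∀ᵐ y : Plane, y ∉ Metric.sphere (0 : Plane) (D.Pbar j i * ρ) :=
    measure_eq_zero_iff_ae_notMem.1 (Measure.addHaar_sphere _ _ _)
  have hscale : Tendsto (fun n => D.scale i (ρn n)) atTop (𝓝 (D.scale i ρ)) := by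
    unfold scale
    exact ((h.rpow_const (Or.inl hρ.ne')).const_mul _).div_const _
  have hmul : Tendsto (fun n => D.Pbar j i * ρn n) atTop (𝓝 (D.Pbar j i * ρ)) := h.const_mul _
  filter_upwards [hsph] with y hy
  rw [mem_sphere_zero_iff_norm] at hy
  have hlim : Tendsto (fun n => (1 + ENNReal.ofReal (D.scale i (ρn n) *
      (D.P j * ‖y‖ ^ (-D.α))))⁻¹) atTop
      (𝓝 (1 + ENNReal.ofReal (D.scale i ρ * (D.P j * ‖y‖ ^ (-D.α))))⁻¹) :=
    tendsto_inv_iff.2 (tendsto_const_nhds.add (ENNReal.tendsto_ofReal (hscale.mul_const _)))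
  rcases lt_or_gt_of_ne hy with hlt | hgt
  · by_cases h0 : 0 < ‖y‖
    · have : ∀ᶠ n in atTop, D.fadedWeight i (ρn n) j y = D.fadedWeight i ρ j y := by
        filter_upwards [hmul.eventually_const_lt hlt] with n hn
        rw [fadedWeight, fadedWeight, if_pos ⟨h0, hn⟩, if_pos ⟨h0, hlt⟩]
      exact tendsto_const_nhds.congr' (this.mono fun n hn => hn.symm)
    · simpa [fadedWeight, h0] using hlim
  · have h2 : D.fadedWeight i ρ j y = (1 + ENNReal.ofReal (D.scale i ρ *
        (D.P j * ‖y‖ ^ (-D.α))))⁻¹ := by rw [fadedWeight, if_neg fun h => lt_asymm hgt h.2]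
    rw [h2]
    refine hlim.congr' ?_
    filter_upwards [hmul.eventually_lt_const hgt] with n hn
    rw [fadedWeight, if_neg fun h => lt_asymm hn h.2]

/-- The radii are bounded by some `T`, and the weight for `T` lies below all the others, so it
provides the domination. -/
lemma tendsto_coverageDensity [Fintype κ₁] [Fintype κ₂] (i : κ₁ ⊕ κ₂) {ρ : ℝ} {ρn : ℕ → ℝ}
    (hρ : 0 < ρ) (hρn : ∀ n, 0 ≤ ρn n) (h : Tendsto ρn atTop (𝓝 ρ)) (x : Plane) :
    Tendsto (fun n => D.coverageDensity i (ρn n) x) atTop (𝓝 (D.coverageDensity i ρ x)) := by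
  obtain ⟨T, hT⟩ := h.bddAbove_range
  have hT' : ∀ n, ρn n ≤ T := fun n => hT (mem_range_self n)
  have hlim := tendsto_fadedWeight (D := D) i hρ h
  have hWn := fun n => measurable_fadedWeight (D := D) i (ρn n)
  have hWn1 := fun n => fadedWeight_le_one (D := D) i (ρn n)
  have hlap := tendsto_tierLaplace (D := D) hWn hWn1 hlim (measurable_fadedWeight i T)
    (fun n j y => fadedWeight_antitone i (hρn n) (hT' n) j y)
    fun j => lintegral_one_sub_fadedWeight_ne_top i ((hρn 0).trans (hT' 0)) j
  have hscale : Tendsto (fun n => D.scale i (ρn n)) atTop (𝓝 (D.scale i ρ)) := by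
    unfold scale
    exact ((h.rpow_const (Or.inl hρ.ne')).const_mul _).div_const _
  have hprod : ∏ j, D.tierLaplace (D.fadedWeight i ρ) j ≠ ⊤ :=
    ((Finset.prod_le_one' fun j _ => tierLaplace_le_one j).trans_lt ENNReal.one_lt_top).ne
  have hpalm : D.palmDensity (D.fadedWeight i ρ) i x ≠ ⊤ :=
    ((palmDensity_le _ i x).trans_lt (intensity_ne_top i).lt_top).ne
  refine ENNReal.Tendsto.mul ((continuous_expNeg.tendsto _).comp (ENNReal.Tendsto.mul_const
    (ENNReal.tendsto_ofReal hscale) (Or.inr ENNReal.ofReal_ne_top)))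
    (Or.inr (ENNReal.mul_ne_top hpalm hprod))
    (ENNReal.Tendsto.mul (tendsto_palmDensity hWn hWn1 hlim i x) (Or.inr hprod)
      (ENNReal.tendsto_finsetProd_of_ne_top _ (fun j _ => hlap j) fun j _ => ?_)
      (Or.inr hpalm)) (Or.inr (expNeg_ne_top _))
  exact ((tierLaplace_le_one j).trans_lt ENNReal.one_lt_top).ne

end HetNet

end Continuity

/-! ### The coverage probability as an integral of the coverage density -/

section CoverageProbability

open Realization HetNet

variable {Ω κ₁ κ₂ : Type*} {D : HetNet κ₁ κ₂} {R : Realization Ω κ₁ κ₂}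

open Classical in
/-- The conditional probability, if the base station `b` is present in the region `B` around the
user, that it provides coverage to the user, with exclusion discs and interference as for a serving
base station at the distance `ρ n`, where `n` is the value of `idx` at the relative location. -/
noncomputable def localTerm (D : HetNet κ₁ κ₂) (R : Realization Ω κ₁ κ₂) (B : Set Plane)
    (idx : Plane → ℕ) (ρ : ℕ → ℝ) (ω : Ω) (b : BSIndex κ₁ κ₂) : ℝ≥0∞ :=
  if R.Present ω b ∧ R.loc ω b - R.user ω ∈ B then
    expNeg (ENNReal.ofReal (D.scale b.tier (ρ (idx (R.loc ω b - R.user ω)))) *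
        ENNReal.ofReal D.N₀) *
      expNeg (exclusionSum D R (ρ (idx (R.loc ω b - R.user ω))) ω b)
  else 0

lemma measurable_apply_of_countable {α ι β : Type*} [MeasurableSpace α] [MeasurableSpace ι]
    [MeasurableSpace β] [Countable ι] [MeasurableSingletonClass ι] {f : ι → α → β}
    (hf : ∀ k, Measurable (f k)) {idx : α → ι} (hidx : Measurable idx) :
    Measurable fun x => f (idx x) x :=
  (measurable_from_prod_countable_right (f := fun p : ι × α => f p.1 p.2) hf).comp
    (hidx.prodMk measurable_id)

lemma measurable_coverageDensity_comp [Fintype κ₁] [Fintype κ₂] (i : κ₁ ⊕ κ₂) {idx : Plane → ℕ}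
    (hidx : Measurable idx) (ρ : ℕ → ℝ) :
    Measurable fun x : Plane => D.coverageDensity i (ρ (idx x)) x :=
  measurable_apply_of_countable (f := fun k x => D.coverageDensity i (ρ k) x)
    (fun k => measurable_coverageDensity i (ρ k)) hidx

variable [mΩ : MeasurableSpace Ω] {μ : Measure Ω} [IsProbabilityMeasure μ]

open Classical in
-- The Campbell formula allows the test function, but not the exponent, to depend on the selected
-- point. Here the exponent depends on it only through the countable index `idx`, so the formula is
-- applied on each cell `idx = n`, where the radius is the constant `ρ n`, and the cells are summed.
lemma tsum_lintegral_localTerm [Fintype κ₁] [Fintype κ₂] (hR : R.IsUncoupled D μ) (i : κ₁ ⊕ κ₂)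
    {B : Set Plane} (hB : MeasurableSet B) {idx : Plane → ℕ} (hidx : Measurable idx) {ρ : ℕ → ℝ}
    (hρ : ∀ n, 0 ≤ ρ n) :
    ∑' b : BSIndex κ₁ κ₂, (if b.tier = i then ∫⁻ ω, localTerm D R B idx ρ ω b ∂μ else 0) =
      ∫⁻ x in B, D.coverageDensity i (ρ (idx x)) x := by
  have hAm : ∀ n, MeasurableSet (B ∩ idx ⁻¹' {n}) := fun n =>
    hB.inter (hidx (measurableSet_singleton n))
  let T : ℕ → BSIndex κ₁ κ₂ → Ω → ℝ≥0∞ := fun n b ω =>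
    (if b.tier = i then testAt R ((B ∩ idx ⁻¹' {n}).indicator 1) (R.user ω) ω b else 0) *
      expNeg (∑' b', if b' = b then 0 else
        R.contribution (D.exclusionWeight i (ρ n)) (R.user ω) ω b')
  let c : ℕ → ℝ≥0∞ := fun n => expNeg (ENNReal.ofReal (D.scale i (ρ n)) * ENNReal.ofReal D.N₀)
  have hTm : ∀ n b, Measurable (T n b) := fun n b => by
    refine Measurable.mul ?_ (measurable_expNeg_tsum fun b' => ?_)
    · by_cases hb : b.tier = i
      · simp only [hb, if_true]
        exact (measurable_testAt (fun s _ => hR.sigma_le s)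
          (measurable_one.indicator (hAm n))).comp (hR.user_measurable.prodMk measurable_id)
      · simp only [hb, if_false]; exact measurable_const
    · exact (measurable_ite_contribution (b := b) (b' := b') (fun s _ => hR.sigma_le s)
        (measurable_exclusionWeight i (ρ n))).comp (hR.user_measurable.prodMk measurable_id)
  have hterm : ∀ b, (if b.tier = i then ∫⁻ ω, localTerm D R B idx ρ ω b ∂μ else 0) =
      ∑' n, c n * ∫⁻ ω, T n b ω ∂μ := fun b => by
    by_cases hb : b.tier = i
    · have h1 : ∀ ω, localTerm D R B idx ρ ω b = ∑' n, c n * T n b ω := fun ω => by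
        rw [localTerm]
        by_cases h : R.Present ω b ∧ R.loc ω b - R.user ω ∈ B
        · rw [if_pos h, tsum_eq_single (idx (R.loc ω b - R.user ω))]
          · simp only [c, T, testAt, exclusionSum, hb, if_true, h.1]
            rw [indicator_of_mem (show _ ∈ B ∩ idx ⁻¹' {_} from ⟨h.2, rfl⟩)]
            simp
          · intro n hn
            simp only [T, testAt, hb, if_true, h.1]
            rw [indicator_of_notMem, zero_mul, mul_zero]
            exact fun hmem => hn hmem.2.symm
        · rw [if_neg h]
          symm
          rw [ENNReal.tsum_eq_zero]
          intro n
          simp only [T, testAt, hb, if_true]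
          by_cases hp : R.Present ω b
          · rw [if_pos hp, indicator_of_notMem, zero_mul, mul_zero]
            exact fun hmem => h ⟨hp, hmem.1⟩
          · simp [hp]
      rw [if_pos hb]
      simp_rw [h1]
      rw [lintegral_tsum fun n => ((hTm n b).const_mul _).aemeasurable]
      exact tsum_congr fun n => lintegral_const_mul _ (hTm n b)
    · simp [T, hb]
  simp_rw [hterm]
  rw [ENNReal.tsum_comm]
  have hn : ∀ n, ∑' b, c n * ∫⁻ ω, T n b ω ∂μ =
      ∫⁻ x in B ∩ idx ⁻¹' {n}, D.coverageDensity i (ρ (idx x)) x := fun n => by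
    rw [ENNReal.tsum_mul_left, ← lintegral_tsum fun b => (hTm n b).aemeasurable]
    have h := lintegral_palm hR (measurable_exclusionWeight (D := D) i (ρ n))
      (measurable_one.indicator (hAm n) : Measurable ((B ∩ idx ⁻¹' {n}).indicator 1)) i
    refine (congrArg (c n * ·) h).trans ?_
    rw [meanWeight_exclusionWeight i (hρ n)]
    have hp := measurable_palmDensity (D := D) (measurable_fadedWeight (D := D) i (ρ n)) i
    have h2 : ∫⁻ x, (B ∩ idx ⁻¹' {n}).indicator 1 x * D.palmDensity (D.fadedWeight i (ρ n)) i x =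
        ∫⁻ x in B ∩ idx ⁻¹' {n}, D.palmDensity (D.fadedWeight i (ρ n)) i x := by
      rw [← lintegral_indicator (hAm n)]
      refine lintegral_congr fun x => ?_
      by_cases hx : x ∈ B ∩ idx ⁻¹' {n} <;> simp [hx]
    rw [h2, ← lintegral_mul_const _ hp, ← lintegral_const_mul _ (hp.mul_const _)]
    refine setLIntegral_congr_fun (hAm n) fun x hx => ?_
    rw [show idx x = n from hx.2]
    rfl
  simp_rw [hn]
  rw [← lintegral_iUnion hAm]
  · congr 2
    rw [← inter_iUnion]
    refine inter_eq_left.2 fun x _ => mem_iUnion.2 ⟨idx x, rfl⟩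
  · intro n m hnm
    refine Set.disjoint_left.2 fun x hx hx' => hnm ?_
    exact hx.2.symm.trans hx'.2

/-- The index of the cell of width `1 / (n + 1)` that contains the distance of `x` to the origin. -/
noncomputable def radialCell (n : ℕ) (x : Plane) : ℕ := ⌊‖x‖ * (n + 1)⌋₊

lemma measurable_radialCell (n : ℕ) : Measurable (radialCell n) :=
  Nat.measurable_floor.comp (measurable_norm.mul_const _)

lemma radialCell_div_le (n : ℕ) (x : Plane) : (radialCell n x : ℝ) / (n + 1) ≤ ‖x‖ := by
  rw [div_le_iff₀ (by positivity)]
  exact Nat.floor_le (by positivity)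

lemma lt_radialCell_div (n : ℕ) (x : Plane) : ‖x‖ < ((radialCell n x : ℝ) + 1) / (n + 1) := by
  rw [lt_div_iff₀ (by positivity)]
  exact Nat.lt_floor_add_one _

lemma tendsto_radialCell_add_div (x : Plane) :
    Tendsto (fun n : ℕ => ((radialCell n x : ℝ) + 1) / (n + 1)) atTop (𝓝 ‖x‖) := by
  have h : Tendsto (fun n : ℕ => ‖x‖ + 1 / ((n : ℝ) + 1)) atTop (𝓝 (‖x‖ + 0)) :=
    tendsto_const_nhds.add tendsto_one_div_add_atTop_nhds_zero_nat
  rw [add_zero] at h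
  refine tendsto_of_tendsto_of_tendsto_of_le_of_le tendsto_const_nhds h
    (fun n => (lt_radialCell_div n x).le) fun n => ?_
  simp only [add_div]
  gcongr
  exact radialCell_div_le n x

lemma tendsto_radialCell_div (x : Plane) :
    Tendsto (fun n : ℕ => (radialCell n x : ℝ) / (n + 1)) atTop (𝓝 ‖x‖) := by
  have h := (tendsto_radialCell_add_div x).sub (tendsto_one_div_add_atTop_nhds_zero_nat (𝕜 := ℝ))
  rw [sub_zero] at h
  refine h.congr fun n => ?_
  rw [add_div, add_sub_cancel_right]

/-- The event that the user is served by `b` only, that its SINR exceeds the threshold, and that the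
user is not located at `b`. -/
def strictCoverageBy (D : HetNet κ₁ κ₂) (R : Realization Ω κ₁ κ₂) (b : BSIndex κ₁ κ₂) : Set Ω :=
  {ω | IsStrictlyServing D R ω b ∧ R.loc ω b ≠ R.user ω} ∩
    {ω | ENNReal.ofReal (D.τ b.tier) < R.sinr D ω b}

variable (D R) in
/-- The event that the user is in coverage of a unique serving base station of tier `i`. -/
def strictTierCoverage (i : κ₁ ⊕ κ₂) : Set Ω :=
  ⋃ b : {b : BSIndex κ₁ κ₂ // b.tier = i}, strictCoverageBy D R b

lemma strictTierCoverage_subset (i : κ₁ ⊕ κ₂) :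
    strictTierCoverage D R i ⊆ R.tierCoverage D i := by
  intro ω hω
  obtain ⟨⟨b, rfl⟩, h⟩ := mem_iUnion.1 hω
  refine ⟨b, rfl, ⟨h.1.1.1, fun b' hb' => ?_⟩, h.2⟩
  by_cases hbb : b' = b
  · rw [hbb]
  · exact (h.1.1.2 b' hbb hb').le

lemma disjoint_strictCoverageBy {b b' : BSIndex κ₁ κ₂} (h : b ≠ b') :
    Disjoint (strictCoverageBy D R b) (strictCoverageBy D R b') := by
  refine Set.disjoint_left.2 fun ω hω hω' => ?_
  exact lt_asymm (hω.1.1.2 b' h.symm hω'.1.1.1) (hω'.1.1.2 b h hω.1.1.1)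

lemma disjoint_strictTierCoverage {i j : κ₁ ⊕ κ₂} (h : i ≠ j) :
    Disjoint (strictTierCoverage D R i) (strictTierCoverage D R j) := by
  refine Set.disjoint_iUnion_left.2 fun b => Set.disjoint_iUnion_right.2 fun b' => ?_
  refine disjoint_strictCoverageBy fun hbb => h ?_
  rw [← b.2, ← b'.2, hbb]

section Measurability

variable [Finite κ₁] [Finite κ₂] (hR : R.IsUncoupled D μ) (b : BSIndex κ₁ κ₂)

lemma measurableSet_loc_ne {m : MeasurableSpace Ω} {b : BSIndex κ₁ κ₂}
    (h : ∀ s : Source κ₁ κ₂, s ≠ .fading b → R.sigma s ≤ m) :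
    MeasurableSet {ω | R.loc ω b ≠ R.user ω} := by
  have hu : Measurable R.user := measurable_user (h .user (by simp))
  have hl : Measurable fun ω => R.loc ω b := measurable_loc fun s _ hs => h s (hs b)
  exact (measurableSet_eq_fun hl hu).compl

lemma measurableSet_dist_le {m : MeasurableSpace Ω} {b : BSIndex κ₁ κ₂}
    (h : ∀ s : Source κ₁ κ₂, s ≠ .fading b → R.sigma s ≤ m) (T : ℝ) :
    MeasurableSet {ω | ‖R.loc ω b - R.user ω‖ ≤ T} := by
  have hu : Measurable R.user := measurable_user (h .user (by simp))
  have hl : Measurable fun ω => R.loc ω b := measurable_loc fun s _ hs => h s (hs b)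
  exact measurableSet_le (hl.sub hu).norm measurable_const

include hR in
lemma measurableSet_lt_sinr :
    MeasurableSet {ω | ENNReal.ofReal (D.τ b.tier) < R.sinr D ω b} := by
  have hu := hR.user_measurable
  have hl : Measurable fun ω => R.loc ω b := measurable_loc fun s _ _ => hR.sigma_le s
  have hrx : Measurable fun ω => R.rxPower D ω b :=
    ((hR.fading_measurable b).const_mul _).mul ((hl.sub hu).norm.pow_const _)
  simp_rw [sinr_eq]
  exact measurableSet_lt measurable_const (hrx.ennreal_ofReal.div
    (measurable_const.add (measurable_interference fun s _ => hR.sigma_le s)))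

include hR in
lemma measurableSet_strictCoverageBy : MeasurableSet (strictCoverageBy D R b) :=
  ((measurableSet_isStrictlyServing fun s _ => hR.sigma_le s).inter
    (measurableSet_loc_ne fun s _ => hR.sigma_le s)).inter (measurableSet_lt_sinr hR b)

include hR in
lemma measurableSet_strictTierCoverage (i : κ₁ ⊕ κ₂) :
    MeasurableSet (strictTierCoverage D R i) :=
  MeasurableSet.iUnion fun b => measurableSet_strictCoverageBy hR b

end Measurability

variable [Fintype κ₁] [Fintype κ₂] (hR : R.IsUncoupled D μ) (i : κ₁ ⊕ κ₂)

/-- A station at the user's location has received power `0` by convention, so it cannot exceed a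
positive threshold. -/
lemma ofReal_lt_sinr_loc_ne {ω : Ω} {b : BSIndex κ₁ κ₂}
    (h : ENNReal.ofReal (D.τ b.tier) < R.sinr D ω b) : R.loc ω b ≠ R.user ω := by
  intro h0
  have hrx : R.rxPower D ω b = 0 := by
    rw [rxPower, h0, sub_self, norm_zero, Real.zero_rpow (neg_ne_zero.2 D.α_pos.ne'), mul_zero]
  rw [sinr_eq, hrx] at h
  simp at h

include hR in
-- Union bound over the stations, which disregards ties, with each distance rounded down to its
-- cell. The restriction to distance at most `T` makes the constant bound of the density integrable
-- later on.
lemma measure_tierCoverage_inter_le (T : ℝ) (n : ℕ) :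
    μ {ω | ∃ b : BSIndex κ₁ κ₂, b.tier = i ∧ (R.IsServing D ω b ∧ R.loc ω b ≠ R.user ω ∧
      ‖R.loc ω b - R.user ω‖ ≤ T) ∧ ENNReal.ofReal (D.τ b.tier) < R.sinr D ω b} ≤
      ∫⁻ x in Metric.closedBall 0 T,
        D.coverageDensity i ((radialCell n x : ℝ) / (n + 1)) x := by
  classical
  rw [← tsum_lintegral_localTerm hR i Metric.isClosed_closedBall.measurableSet
    (measurable_radialCell n) (ρ := fun k => (k : ℝ) / (n + 1)) (fun k => by positivity)]
  let S : BSIndex κ₁ κ₂ → Set Ω := fun b => {ω | R.IsServing D ω b ∧ R.loc ω b ≠ R.user ω ∧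
    ‖R.loc ω b - R.user ω‖ ≤ T}
  have hsub : {ω | ∃ b : BSIndex κ₁ κ₂, b.tier = i ∧ (R.IsServing D ω b ∧ R.loc ω b ≠ R.user ω ∧
      ‖R.loc ω b - R.user ω‖ ≤ T) ∧ ENNReal.ofReal (D.τ b.tier) < R.sinr D ω b} ⊆
      ⋃ b : BSIndex κ₁ κ₂, if b.tier = i then
        S b ∩ {ω | ENNReal.ofReal (D.τ b.tier) < R.sinr D ω b} else ∅ := by
    rintro ω ⟨b, hb, h1, h2⟩
    refine mem_iUnion.2 ⟨b, ?_⟩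
    rw [if_pos hb]
    exact ⟨h1, h2⟩
  refine (measure_mono hsub).trans ((measure_iUnion_le _).trans (ENNReal.tsum_le_tsum fun b => ?_))
  split_ifs with hb
  · have hle : ∀ s : Source κ₁ κ₂, s ≠ .fading b → R.sigma s ≤ R.sigmaOf {.fading b}ᶜ :=
      fun s hs => sigma_le_sigmaOf hs
    have hS : MeasurableSet[R.sigmaOf {.fading b}ᶜ] (S b) := by
      exact (measurableSet_isServing hle).inter ((measurableSet_loc_ne hle).inter
        (measurableSet_dist_le hle T))
    rw [measure_inter_lt_sinr hR b hS fun ω hω => hω.2.1]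
    refine lintegral_mono fun ω => ?_
    refine indicator_apply_le' (fun hω => ?_) fun _ => zero_le
    rw [localTerm, if_pos ⟨hω.1.1, by simpa using hω.2.2⟩]
    exact expNeg_le_of_isServing hω.1 hω.2.1 (by positivity) (radialCell_div_le n _)
  · simp

include hR in
-- For fixed `T` the cells shrink, with the tier's intensity as majorant on the disc; then `T` tends
-- to infinity by continuity of measure.
lemma measure_tierCoverage_le :
    μ (R.tierCoverage D i) ≤ ∫⁻ x, D.coverageDensity i ‖x‖ x := by
  let A : ℕ → Set Ω := fun T => {ω | ∃ b : BSIndex κ₁ κ₂, b.tier = i ∧ (R.IsServing D ω b ∧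
    R.loc ω b ≠ R.user ω ∧ ‖R.loc ω b - R.user ω‖ ≤ T) ∧
    ENNReal.ofReal (D.τ b.tier) < R.sinr D ω b}
  have hA : Monotone A := by
    rintro T T' h ω ⟨b, hb, ⟨h1, h2, h3⟩, h4⟩
    exact ⟨b, hb, ⟨h1, h2, h3.trans (by exact_mod_cast h)⟩, h4⟩
  have hU : R.tierCoverage D i ⊆ ⋃ T, A T := by
    rintro ω ⟨b, rfl, h1, h2⟩
    obtain ⟨T, hT⟩ := exists_nat_ge ‖R.loc ω b - R.user ω‖
    exact mem_iUnion.2 ⟨T, b, rfl, ⟨h1, ofReal_lt_sinr_loc_ne h2, hT⟩, h2⟩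
  refine (measure_mono hU).trans ?_
  rw [hA.measure_iUnion]
  refine iSup_le fun T => ?_
  refine le_trans ?_ (setLIntegral_le_lintegral (Metric.closedBall 0 (T : ℝ)) _)
  refine ge_of_tendsto' (tendsto_lintegral_of_dominated_convergence (fun _ => D.intensity i)
    (fun n => ?_) (fun n => ae_of_all _ fun x => coverageDensity_le i _ x) ?_ ?_)
    fun n => measure_tierCoverage_inter_le hR i T n
  · exact measurable_coverageDensity_comp i (measurable_radialCell n) fun k => (k : ℝ) / (n + 1)
  · rw [setLIntegral_const]
    exact ENNReal.mul_ne_top (intensity_ne_top i) measure_closedBall_lt_top.ne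
  · refine ae_restrict_of_ae ?_
    filter_upwards [(measure_eq_zero_iff_ae_notMem.1 (measure_singleton (0 : Plane)))] with x hx
    exact tendsto_coverageDensity i (norm_pos_iff.2 hx) (fun n => by positivity)
      (tendsto_radialCell_div x) x

include hR in
-- A strict server is unique, so the measure of the union is exactly a sum, and rounding each
-- distance up bounds every summand from below.
lemma lintegral_coverageDensity_cell_le (n : ℕ) :
    ∫⁻ x, D.coverageDensity i (((radialCell n x : ℝ) + 1) / (n + 1)) x ≤
      μ (strictTierCoverage D R i) := by
  classical
  have h0 : ∀ᵐ x : Plane, x ∈ ({0}ᶜ : Set Plane) :=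
    measure_eq_zero_iff_ae_notMem.1 (measure_singleton (0 : Plane))
  rw [← Measure.restrict_eq_self_of_ae_mem h0]
  rw [← tsum_lintegral_localTerm hR i (measurableSet_singleton _).compl
    (measurable_radialCell n) (ρ := fun k => ((k : ℝ) + 1) / (n + 1)) (fun k => by positivity)]
  have hsum : μ (strictTierCoverage D R i) = ∑' b,
      {b : BSIndex κ₁ κ₂ | b.tier = i}.indicator (fun b => μ (strictCoverageBy D R b)) b := by
    rw [strictTierCoverage, measure_iUnion
      (fun b b' h => disjoint_strictCoverageBy fun hb => h (Subtype.ext hb))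
      fun b => measurableSet_strictCoverageBy hR b]
    exact tsum_subtype {b : BSIndex κ₁ κ₂ | b.tier = i} fun b => μ (strictCoverageBy D R b)
  rw [hsum]
  refine ENNReal.tsum_le_tsum fun b => ?_
  by_cases hb : b.tier = i
  · have hle : ∀ s : Source κ₁ κ₂, s ≠ .fading b → R.sigma s ≤ R.sigmaOf {.fading b}ᶜ :=
      fun s hs => sigma_le_sigmaOf hs
    rw [if_pos hb, indicator_of_mem (show b ∈ {b : BSIndex κ₁ κ₂ | b.tier = i} from hb),
      strictCoverageBy, measure_inter_lt_sinr hR b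
        (S := {ω | IsStrictlyServing D R ω b ∧ R.loc ω b ≠ R.user ω})
        ((measurableSet_isStrictlyServing hle).inter (measurableSet_loc_ne hle)) fun ω hω => hω.2]
    refine lintegral_mono fun ω => ?_
    rw [localTerm]
    split_ifs with h
    · have hne : R.loc ω b ≠ R.user ω := fun h' => h.2 (by simp [h'])
      refine (le_expNeg_of_isStrictlyServing h.1 hne (lt_radialCell_div n _)).trans (le_of_eq ?_)
      by_cases hs : IsStrictlyServing D R ω b
      · rw [indicator_of_mem (show ω ∈ {ω | IsStrictlyServing D R ω b} from hs),
          indicator_of_mem (show ω ∈ {ω | IsStrictlyServing D R ω b ∧ R.loc ω b ≠ R.user ω}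
            from ⟨hs, hne⟩)]
      · rw [indicator_of_notMem (show ω ∉ {ω | IsStrictlyServing D R ω b} from hs),
          indicator_of_notMem]
        exact fun h => hs h.1
    · exact zero_le
  · simp [hb]

include hR in
-- Fatou's lemma passes to the limit over the whole plane without any majorant.
lemma lintegral_coverageDensity_le :
    ∫⁻ x, D.coverageDensity i ‖x‖ x ≤ μ (strictTierCoverage D R i) := by
  have h0 : ∀ᵐ x : Plane, x ∉ ({0} : Set Plane) :=
    measure_eq_zero_iff_ae_notMem.1 (measure_singleton (0 : Plane))
  calc ∫⁻ x, D.coverageDensity i ‖x‖ x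
      ≤ ∫⁻ x, liminf (fun n : ℕ =>
          D.coverageDensity i (((radialCell n x : ℝ) + 1) / (n + 1)) x) atTop := by
        refine lintegral_mono_ae ?_
        filter_upwards [h0] with x hx
        exact (tendsto_coverageDensity i (norm_pos_iff.2 hx) (fun n => by positivity)
          (tendsto_radialCell_add_div x) x).liminf_eq.ge
    _ ≤ liminf (fun n : ℕ => ∫⁻ x,
          D.coverageDensity i (((radialCell n x : ℝ) + 1) / (n + 1)) x) atTop :=
        lintegral_liminf_le fun n =>
          measurable_coverageDensity_comp i (measurable_radialCell n)
            fun k => ((k : ℝ) + 1) / (n + 1)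
    _ ≤ μ (strictTierCoverage D R i) :=
        liminf_le_of_le ⟨0, by simp⟩ fun a ha => by
          obtain ⟨n, hn⟩ := ha.exists
          exact hn.trans (lintegral_coverageDensity_cell_le hR i n)

include hR in
/-- The probability that the user is served and covered by tier `i`. -/
theorem measure_tierCoverage :
    μ (R.tierCoverage D i) = ∫⁻ x, D.coverageDensity i ‖x‖ x :=
  (measure_tierCoverage_le hR i).antisymm ((lintegral_coverageDensity_le hR i).trans
    (measure_mono (strictTierCoverage_subset i)))

include hR in
-- The upper bound for the larger event equals the lower bound for the smaller one. So coverage with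
-- ties is negligible without a separate argument.
lemma measure_strictTierCoverage :
    μ (strictTierCoverage D R i) = μ (R.tierCoverage D i) :=
  (measure_mono (strictTierCoverage_subset i)).antisymm
    ((measure_tierCoverage_le hR i).trans (lintegral_coverageDensity_le hR i))

include hR in
/-- The coverage probability is the sum of the coverage probabilities of the tiers. -/
theorem measure_coverage :
    μ.real (R.coverage D) = ∑ i, μ.real (R.tierCoverage D i) := by
  have h : μ (R.coverage D) = ∑ i, μ (R.tierCoverage D i) := by
    refine le_antisymm ?_ ?_
    · rw [Realization.coverage]
      refine (measure_iUnion_le _).trans (tsum_fintype _).le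
    -- Coverage events of different tiers may overlap in ties; their strict versions are disjoint
    -- and have the same measure.
    · simp_rw [← measure_strictTierCoverage hR]
      rw [← tsum_fintype (L := .unconditional _),
        ← measure_iUnion (fun i j hij => disjoint_strictTierCoverage hij)
        fun i => measurableSet_strictTierCoverage hR i]
      exact measure_mono (iUnion_mono fun i => strictTierCoverage_subset i)
  rw [measureReal_def, h, ENNReal.toReal_sum fun i _ => measure_ne_top _ _]
  rfl

end CoverageProbability

/-! ### Polar coordinates in the plane -/

section Polar

lemma measurePreserving_plane :
    MeasurePreserving (fun p : ℝ × ℝ => (!₂[p.1, p.2] : Plane)) :=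
  (PiLp.volume_preserving_toLp (Fin 2)).comp (volume_preserving_finTwoArrow ℝ).symm

lemma lintegral_plane_polar {F : Plane → ℝ≥0∞} (hF : Measurable F) :
    ∫⁻ x, F x = ∫⁻ y in Ioi (0 : ℝ), ENNReal.ofReal y *
      ∫⁻ θ in Ioc (-Real.pi) Real.pi, F !₂[y * Real.cos θ, y * Real.sin θ] := by
  rw [← measurePreserving_plane.lintegral_comp hF, ← lintegral_comp_polarCoord_symm,
    show polarCoord.target = Ioi (0 : ℝ) ×ˢ Ioo (-Real.pi) Real.pi from rfl,
    Measure.volume_eq_prod, ← Measure.prod_restrict]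
  have hpl : Measurable fun p : ℝ × ℝ => F !₂[p.1 * Real.cos p.2, p.1 * Real.sin p.2] :=
    hF.comp (measurePreserving_plane.measurable.comp
      (f := fun p : ℝ × ℝ => (p.1 * Real.cos p.2, p.1 * Real.sin p.2)) (by fun_prop))
  rw [lintegral_prod _ (by
    refine Measurable.aemeasurable ?_
    exact (ENNReal.measurable_ofReal.comp measurable_fst).mul hpl)]
  refine lintegral_congr fun y => ?_
  rw [restrict_Ioo_eq_restrict_Ioc, ← lintegral_const_mul' _ _ ENNReal.ofReal_ne_top]
  rfl

lemma norm_polar (y θ : ℝ) : ‖(!₂[y * Real.cos θ, y * Real.sin θ] : Plane)‖ = |y| := by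
  rw [EuclideanSpace.norm_eq, ← Real.sqrt_sq_eq_abs]
  congr 1
  simp only [Real.norm_eq_abs, sq_abs, Fin.sum_univ_two]
  simp only [Matrix.cons_val_zero, Matrix.cons_val_one]
  nlinarith [Real.sin_sq_add_cos_sq θ]

lemma lintegral_plane_norm {Φ : ℝ → ℝ≥0∞} (hΦ : Measurable Φ) :
    ∫⁻ x : Plane, Φ ‖x‖ =
      ENNReal.ofReal (2 * Real.pi) * ∫⁻ y in Ioi (0 : ℝ), ENNReal.ofReal y * Φ y := by
  rw [lintegral_plane_polar (hΦ.fun_comp measurable_norm),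
    ← lintegral_const_mul' _ _ ENNReal.ofReal_ne_top]
  refine setLIntegral_congr_fun measurableSet_Ioi fun y hy => ?_
  simp only [norm_polar, abs_of_pos (show 0 < y from hy), setLIntegral_const, Real.volume_Ioc]
  rw [show Real.pi - -Real.pi = 2 * Real.pi by ring]
  ring

lemma exists_polar (x : Plane) : ∃ φ : ℝ, x = !₂[‖x‖ * Real.cos φ, ‖x‖ * Real.sin φ] := by
  let z : ℂ := ⟨x 0, x 1⟩
  have hz : ‖z‖ = ‖x‖ := by
    rw [EuclideanSpace.norm_eq, Complex.norm_eq_sqrt_sq_add_sq]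
    simp [z, Fin.sum_univ_two]
  refine ⟨z.arg, ?_⟩
  ext k
  fin_cases k
  · simpa [hz] using (Complex.norm_mul_cos_arg z).symm
  · simpa [hz] using (Complex.norm_mul_sin_arg z).symm

lemma setLIntegral_Ioc_periodic {f : ℝ → ℝ≥0∞} {T : ℝ} (hT : 0 < T) (hf : Function.Periodic f T)
    (a b : ℝ) : ∫⁻ θ in Ioc a (a + T), f θ = ∫⁻ θ in Ioc b (b + T), f θ :=
  (isAddFundamentalDomain_Ioc hT a).setLIntegral_eq (isAddFundamentalDomain_Ioc hT b) f
    hf.map_vadd_zmultiples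

lemma setLIntegral_Ioc_sub {f : ℝ → ℝ≥0∞} (a b φ : ℝ) :
    ∫⁻ θ in Ioc a b, f (θ - φ) = ∫⁻ θ in Ioc (a - φ) (b - φ), f θ := by
  have h := (measurePreserving_sub_right (volume : Measure ℝ) φ).setLIntegral_comp_preimage_emb
    (MeasurableEquiv.subRight φ).measurableEmbedding f (Ioc (a - φ) (b - φ))
  rw [← h]
  simp

end Polar

/-! ### The distance density of a cluster point, from isotropy of the offspring law. -/

section AngularDensity

variable {κ₁ κ₂ : Type*} {D : HetNet κ₁ κ₂}

namespace HetNet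

variable (D) in
/-- The integral over the circle of radius `y` of the offspring density around a cluster center at
distance `z` from the origin. -/
noncomputable def angular (k : κ₁) (y z : ℝ) : ℝ≥0∞ :=
  ∫⁻ θ in Ioc 0 (2 * Real.pi),
    ENNReal.ofReal (D.g k !₂[y * Real.cos θ - z, y * Real.sin θ])

lemma measurable_angular (k : κ₁) : Measurable fun p : ℝ × ℝ => D.angular k p.1 p.2 := by
  have h : Measurable fun q : (ℝ × ℝ) × ℝ => ENNReal.ofReal
      (D.g k !₂[q.1.1 * Real.cos q.2 - q.1.2, q.1.1 * Real.sin q.2]) :=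
    (measurable_ofReal_g k).comp (measurePreserving_plane.measurable.comp
      (f := fun q : (ℝ × ℝ) × ℝ => (q.1.1 * Real.cos q.2 - q.1.2, q.1.1 * Real.sin q.2))
      (by fun_prop))
  exact h.lintegral_prod_right'

/-- This also holds when the angular integral diverges: the Bochner integral and `toReal ⊤` are both
`0`. -/
lemma fd_eq (k : κ₁) (y z : ℝ) : D.fd k y z = y * (D.angular k y z).toReal := by
  have hm : Measurable fun θ : ℝ => D.g k !₂[y * Real.cos θ - z, y * Real.sin θ] :=
    (D.g_measurable k).comp (measurePreserving_plane.measurable.comp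
      (f := fun θ : ℝ => (y * Real.cos θ - z, y * Real.sin θ)) (by fun_prop))
  rw [fd, angular, intervalIntegral.integral_of_le (by positivity),
    integral_eq_lintegral_of_nonneg_ae (ae_of_all _ fun θ => D.g_nonneg k _)
      hm.aestronglyMeasurable]

lemma measurable_fd (k : κ₁) : Measurable fun p : ℝ × ℝ => D.fd k p.1 p.2 := by
  simp_rw [fd_eq]
  exact measurable_fst.mul (measurable_angular k).ennreal_toReal

lemma fd_nonneg (k : κ₁) {y : ℝ} (hy : 0 ≤ y) (z : ℝ) : 0 ≤ D.fd k y z := by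
  rw [fd_eq]
  positivity

/-- By the law of cosines the norm of the argument of `g` is symmetric in `y` and `z`, and `g` only
sees the norm. This allows a point and its cluster center to change roles. -/
lemma angular_comm (k : κ₁) (y z : ℝ) : D.angular k y z = D.angular k z y := by
  refine lintegral_congr fun θ => ?_
  congr 1
  refine D.g_isotropic k _ _ ?_
  rw [EuclideanSpace.norm_eq, EuclideanSpace.norm_eq]
  congr 1
  simp only [Real.norm_eq_abs, sq_abs, Fin.sum_univ_two, Matrix.cons_val_zero,
    Matrix.cons_val_one]
  linear_combination (y ^ 2 - z ^ 2) * Real.sin_sq_add_cos_sq θ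

/-- Isotropy rotates the center onto the first axis, at the price of shifting the angle; periodicity
absorbs the shift and the change of the interval. -/
lemma lintegral_polar_g_sub (k : κ₁) (x₀ : Plane) (y : ℝ) :
    ∫⁻ θ in Ioc (-Real.pi) Real.pi,
      ENNReal.ofReal (D.g k (!₂[y * Real.cos θ, y * Real.sin θ] - x₀)) = D.angular k y ‖x₀‖ := by
  obtain ⟨φ, hφ⟩ := exists_polar x₀
  set z := ‖x₀‖
  let f : ℝ → ℝ≥0∞ := fun θ => ENNReal.ofReal (D.g k !₂[y * Real.cos θ - z, y * Real.sin θ])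
  have hf : Function.Periodic f (2 * Real.pi) := fun θ => by simp [f]
  have h : ∀ θ, ENNReal.ofReal (D.g k (!₂[y * Real.cos θ, y * Real.sin θ] - x₀)) = f (θ - φ) := by
    intro θ
    simp only [f]
    congr 1
    refine D.g_isotropic k _ _ ?_
    rw [hφ, EuclideanSpace.norm_eq, EuclideanSpace.norm_eq]
    congr 1
    simp only [Real.norm_eq_abs, sq_abs, Fin.sum_univ_two, Matrix.cons_val_zero,
      Matrix.cons_val_one, PiLp.sub_apply, Real.cos_sub, Real.sin_sub]
    have h1 := Real.sin_sq_add_cos_sq θ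
    have h2 := Real.sin_sq_add_cos_sq φ
    linear_combination (-y ^ 2 * (Real.sin θ ^ 2 + Real.cos θ ^ 2)) * h2 + z ^ 2 * h2
  simp_rw [h]
  rw [setLIntegral_Ioc_sub, show Real.pi - φ = (-Real.pi - φ) + 2 * Real.pi by ring,
    setLIntegral_Ioc_periodic Real.two_pi_pos hf _ 0, zero_add]
  rfl

/-- Integration against the density of the points of a cluster in polar coordinates. -/
lemma lintegral_g_sub_mul (k : κ₁) (x₀ : Plane) {Φ : ℝ → ℝ≥0∞} (hΦ : Measurable Φ) :
    ∫⁻ x, ENNReal.ofReal (D.g k (x - x₀)) * Φ ‖x‖ =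
      ∫⁻ y in Ioi (0 : ℝ), ENNReal.ofReal y * D.angular k y ‖x₀‖ * Φ y := by
  have hg : Measurable fun x => ENNReal.ofReal (D.g k (x - x₀)) :=
    (measurable_ofReal_g k).fun_comp (by fun_prop)
  rw [lintegral_plane_polar (hg.fun_mul (hΦ.fun_comp measurable_norm))]
  refine setLIntegral_congr_fun measurableSet_Ioi fun y hy => ?_
  simp only [norm_polar, abs_of_pos (show 0 < y from hy)]
  rw [lintegral_mul_const, lintegral_polar_g_sub, mul_assoc]
  exact hg.comp (measurePreserving_plane.measurable.comp
      (f := fun θ : ℝ => (y * Real.cos θ, y * Real.sin θ)) (by fun_prop))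

/-- The total mass of `g` is one, so the radii at which `fd` takes its default value form a null
set. -/
lemma ae_angular_lt_top (k : κ₁) (x₀ : Plane) :
    ∀ᵐ y ∂(volume.restrict (Ioi (0 : ℝ))), D.angular k y ‖x₀‖ < ⊤ := by
  have h := lintegral_g_sub_mul (D := D) k x₀ (Φ := fun _ => 1) measurable_const
  simp only [mul_one] at h
  rw [lintegral_sub_right_eq_self (fun s => ENNReal.ofReal (D.g k s)) x₀, D.g_lintegral] at h
  have hm : Measurable fun y : ℝ => ENNReal.ofReal y * D.angular k y ‖x₀‖ :=
    ENNReal.measurable_ofReal.mul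
      ((measurable_angular k).comp (measurable_id.prodMk measurable_const))
  have h2 := ae_lt_top hm (h ▸ ENNReal.one_ne_top)
  filter_upwards [h2, ae_restrict_mem measurableSet_Ioi] with y hy hy0
  by_contra hcon
  rw [not_lt_top_iff.1 hcon, ENNReal.mul_top (by simpa using hy0)] at hy
  exact lt_irrefl _ hy

/-- The function `fd` is the density of the distances of the points of a cluster. -/
lemma lintegral_fd_mul (k : κ₁) (x₀ : Plane) {Φ : ℝ → ℝ≥0∞} (hΦ : Measurable Φ) :
    ∫⁻ y in Ioi (0 : ℝ), ENNReal.ofReal (D.fd k y ‖x₀‖) * Φ y =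
      ∫⁻ x, ENNReal.ofReal (D.g k (x - x₀)) * Φ ‖x‖ := by
  rw [lintegral_g_sub_mul k x₀ hΦ]
  refine lintegral_congr_ae ?_
  filter_upwards [ae_angular_lt_top k x₀, ae_restrict_mem measurableSet_Ioi] with y hy hy0
  rw [fd_eq, ENNReal.ofReal_mul (le_of_lt hy0), ENNReal.ofReal_toReal hy.ne]

/-- The function `fd` as a function of the distance of the cluster center. -/
lemma lintegral_fd_mul_center (k : κ₁) {x : Plane} {Ψ : ℝ → ℝ≥0∞} (hΨ : Measurable Ψ) :
    ∫⁻ z in Ioi (0 : ℝ), ENNReal.ofReal (D.fd k ‖x‖ z) * ENNReal.ofReal z * Ψ z =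
      ENNReal.ofReal ‖x‖ * ∫⁻ z, ENNReal.ofReal (D.g k (x - z)) * Ψ ‖z‖ := by
  have h : ∀ z, D.g k (x - z) = D.g k (z - x) := fun z => D.g_isotropic k _ _ (norm_sub_rev _ _)
  simp_rw [h]
  rw [lintegral_g_sub_mul k x hΨ, ← lintegral_const_mul' _ _ ENNReal.ofReal_ne_top]
  refine lintegral_congr_ae ?_
  filter_upwards [ae_angular_lt_top k x] with z hz
  rw [fd_eq, ENNReal.ofReal_mul (norm_nonneg x), angular_comm, ENNReal.ofReal_toReal hz.ne]
  ring

end HetNet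

end AngularDensity

/-! ### Closed forms -/

section ClosedForm

variable {κ₁ κ₂ : Type*} {D : HetNet κ₁ κ₂}

lemma integrable_and_ofReal_integral {α : Type*} [MeasurableSpace α] {μ : Measure α} {f : α → ℝ}
    (hm : AEStronglyMeasurable f μ) (h0 : 0 ≤ᵐ[μ] f) (hfin : ∫⁻ x, ENNReal.ofReal (f x) ∂μ ≠ ⊤) :
    Integrable f μ ∧ ENNReal.ofReal (∫ x, f x ∂μ) = ∫⁻ x, ENNReal.ofReal (f x) ∂μ := by
  have hi : Integrable f μ := ⟨hm, (hasFiniteIntegral_iff_ofReal h0).2 hfin.lt_top⟩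
  exact ⟨hi, ofReal_integral_eq_lintegral_ofReal hi h0⟩

namespace HetNet

variable (D) in
/-- The function `D.fadedWeight i ρ j` in terms of the distance to the origin. -/
noncomputable def radialWeight (i : κ₁ ⊕ κ₂) (ρ : ℝ) (j : κ₁ ⊕ κ₂) (y : ℝ) : ℝ≥0∞ :=
  if 0 < y ∧ y < D.Pbar j i * ρ then 0
  else (1 + ENNReal.ofReal (D.scale i ρ * (D.P j * y ^ (-D.α))))⁻¹

lemma measurable_radialWeight (i : κ₁ ⊕ κ₂) (ρ : ℝ) (j : κ₁ ⊕ κ₂) :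
    Measurable (D.radialWeight i ρ j) := by
  refine Measurable.ite ?_ measurable_const (by fun_prop)
  exact (measurableSet_lt measurable_const measurable_id).inter
    (measurableSet_lt measurable_id measurable_const)

lemma radialWeight_of_lt (i : κ₁ ⊕ κ₂) {ρ : ℝ} (j : κ₁ ⊕ κ₂) {y : ℝ} (hy : 0 < y)
    (h : y < D.Pbar j i * ρ) : D.radialWeight i ρ j y = 0 := if_pos ⟨hy, h⟩

lemma radialWeight_of_le (i : κ₁ ⊕ κ₂) {ρ : ℝ} (hρ : 0 < ρ) (j : κ₁ ⊕ κ₂) {y : ℝ}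
    (h : D.Pbar j i * ρ ≤ y) : D.radialWeight i ρ j y =
      ENNReal.ofReal (1 + D.τ i * ((D.Pbar j i * ρ) ^ D.α / y ^ D.α))⁻¹ := by
  have hc : 0 < D.Pbar j i * ρ := mul_pos (Pbar_pos j i) hρ
  have hy : 0 < y := hc.trans_le h
  have hτ := D.τ_pos i
  have hP := D.P_pos i
  rw [radialWeight, if_neg fun h' => not_lt.2 h h'.2, scale, ENNReal.ofReal_inv_of_pos
    (by positivity), ENNReal.ofReal_add one_pos.le (by positivity), ENNReal.ofReal_one,
    Real.mul_rpow (Pbar_pos j i).le hρ.le, Pbar_rpow, Real.rpow_neg hy.le]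
  congr 3
  field_simp

variable (i : κ₁ ⊕ κ₂) {ρ : ℝ} (hρ : 0 < ρ)

include hρ in
-- The weight vanishes inside the exclusion disc and is radial, so the mean weight of an offspring
-- point is an integral against `fd` that starts at the exclusion radius. Weights are at most one,
-- hence it is finite.
lemma integrableOn_fd_div (j : κ₁) (z : Plane) :
    IntegrableOn (fun y => D.fd j y ‖z‖ /
      (1 + D.τ i * ((D.Pbar (.inl j) i * ρ) ^ D.α / y ^ D.α))) (Ioi (D.Pbar (.inl j) i * ρ)) ∧
    ENNReal.ofReal (∫ y in Ioi (D.Pbar (.inl j) i * ρ), D.fd j y ‖z‖ /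
      (1 + D.τ i * ((D.Pbar (.inl j) i * ρ) ^ D.α / y ^ D.α))) =
      ∫⁻ s, ENNReal.ofReal (D.g j s) * D.fadedWeight i ρ (.inl j) (z + s) := by
  set c := D.Pbar (.inl j) i * ρ with hcdef
  have hc : 0 < c := mul_pos (Pbar_pos _ i) hρ
  have hτ := D.τ_pos i
  have h1 : ∫⁻ s, ENNReal.ofReal (D.g j s) * D.fadedWeight i ρ (.inl j) (z + s) =
      ∫⁻ y in Ioi c, ENNReal.ofReal (D.fd j y ‖z‖ / (1 + D.τ i * (c ^ D.α / y ^ D.α))) := by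
    rw [← lintegral_sub_right_eq_self
      (fun s => ENNReal.ofReal (D.g j s) * D.fadedWeight i ρ (.inl j) (z + s)) z]
    simp_rw [add_sub_cancel]
    refine (lintegral_fd_mul j z (measurable_radialWeight i ρ (.inl j))).symm.trans ?_
    rw [← Ioo_union_Ici_eq_Ioi hc, lintegral_union measurableSet_Ici
      (Set.disjoint_left.2 fun y hy hy' => not_lt.2 hy' hy.2),
      setLIntegral_congr_fun (g := fun _ => 0) measurableSet_Ioo fun y hy => by
        rw [radialWeight_of_lt i _ hy.1 hy.2, mul_zero],
      lintegral_zero, zero_add, ← restrict_Ioi_eq_restrict_Ici]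
    refine setLIntegral_congr_fun measurableSet_Ioi fun y hy => ?_
    rw [radialWeight_of_le i hρ _ (le_of_lt hy), ← ENNReal.ofReal_mul
      (fd_nonneg j (hc.trans hy).le _), div_eq_mul_inv (D.fd j y ‖z‖)]
  rw [h1]
  refine integrable_and_ofReal_integral ?_ ?_ ?_
  · refine Measurable.aestronglyMeasurable ?_
    refine ((measurable_fd j).comp (measurable_id.prodMk measurable_const)).div ?_
    fun_prop
  · filter_upwards [ae_restrict_mem measurableSet_Ioi] with y hy
    have hy0 : 0 < y := hc.trans hy
    exact div_nonneg (fd_nonneg j hy0.le _) (by positivity)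
  · rw [← h1]
    refine (lt_of_le_of_lt (lintegral_mono fun s => mul_le_of_le_one_right'
      (fadedWeight_le_one i ρ _ _)) ?_).ne
    rw [D.g_lintegral]
    exact ENNReal.one_lt_top

include hρ in
lemma clusterLaplace_fadedWeight (j : κ₁) (z : Plane) :
    D.clusterLaplace (D.fadedWeight i ρ) j z = ENNReal.ofReal (D.C j i ρ ‖z‖) := by
  have h1 : ∫⁻ s, ENNReal.ofReal (D.g j s) * D.fadedWeight i ρ (.inl j) (z + s) ≤ 1 := by
    rw [← D.g_lintegral j]
    exact lintegral_mono fun s => mul_le_of_le_one_right' (fadedWeight_le_one i ρ _ _)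
  rw [clusterLaplace]
  rw [← (integrableOn_fd_div i hρ j z).2] at h1 ⊢
  rw [← ENNReal.ofReal_one, ENNReal.ofReal_le_ofReal_iff zero_le_one] at h1
  have h0 : 0 ≤ ∫ y in Ioi (D.Pbar (.inl j) i * ρ), D.fd j y ‖z‖ /
      (1 + D.τ i * ((D.Pbar (.inl j) i * ρ) ^ D.α / y ^ D.α)) := by
    refine setIntegral_nonneg measurableSet_Ioi fun y hy => ?_
    have hc : 0 < D.Pbar (.inl j) i * ρ := mul_pos (Pbar_pos _ i) hρ
    have hy0 : 0 < y := hc.trans hy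
    have hτ := D.τ_pos i
    exact div_nonneg (fd_nonneg j hy0.le _) (by positivity)
  rw [← ENNReal.ofReal_one, ← ENNReal.ofReal_sub _ h0, ← ENNReal.ofReal_mul (D.mbar_pos j).le,
    expNeg_ofReal (mul_nonneg (D.mbar_pos j).le (sub_nonneg.2 h1)), C, neg_mul]

lemma C_nonneg (j : κ₁) (r z : ℝ) : 0 ≤ D.C j i r z := (Real.exp_pos _).le

lemma exists_norm_eq_of_nonneg {z : ℝ} (hz : 0 ≤ z) : ∃ x : Plane, ‖x‖ = z :=
  ⟨!₂[z * Real.cos 0, z * Real.sin 0], by rw [norm_polar, abs_of_nonneg hz]⟩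

include hρ in
lemma C_le_one (j : κ₁) {z : ℝ} (hz : 0 ≤ z) : D.C j i ρ z ≤ 1 := by
  obtain ⟨x, rfl⟩ := exists_norm_eq_of_nonneg hz
  have h := clusterLaplace_le_one (D := D) (W := D.fadedWeight i ρ) j x
  rw [clusterLaplace_fadedWeight i hρ, ENNReal.ofReal_le_one] at h
  exact h

lemma measurable_C (j : κ₁) (r : ℝ) : Measurable (D.C j i r) := by
  have h : Measurable fun p : ℝ × ℝ => D.fd j p.2 p.1 /
      (1 + D.τ i * ((D.Pbar (.inl j) i * r) ^ D.α / p.2 ^ D.α)) := by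
    refine ((measurable_fd j).comp (measurable_snd.prodMk measurable_fst)).div ?_
    fun_prop
  have h2 := (h.stronglyMeasurable.integral_prod_right'
    (ν := volume.restrict (Ioi (D.Pbar (.inl j) i * r)))).measurable
  exact Real.measurable_exp.comp ((measurable_const.sub h2).const_mul _)

include hρ in
lemma integrableOn_one_sub_C_mul (j : κ₁) :
    IntegrableOn (fun z => (1 - D.C j i ρ z) * z) (Ioi 0) ∧
    ∫⁻ z : Plane, (1 - D.clusterLaplace (D.fadedWeight i ρ) j z) =
      ENNReal.ofReal (2 * Real.pi * ∫ z in Ioi (0 : ℝ), (1 - D.C j i ρ z) * z) := by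
  have h1 : ∫⁻ z : Plane, (1 - D.clusterLaplace (D.fadedWeight i ρ) j z) =
      ENNReal.ofReal (2 * Real.pi) *
        ∫⁻ z in Ioi (0 : ℝ), ENNReal.ofReal ((1 - D.C j i ρ z) * z) := by
    have h2 : ∀ z : Plane, 1 - D.clusterLaplace (D.fadedWeight i ρ) j z =
        ENNReal.ofReal (1 - D.C j i ρ ‖z‖) := fun z => by
      rw [clusterLaplace_fadedWeight i hρ, ENNReal.ofReal_sub _ (C_nonneg i j _ _),
        ENNReal.ofReal_one]
    simp_rw [h2]
    rw [lintegral_plane_norm (Φ := fun z => ENNReal.ofReal (1 - D.C j i ρ z))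
      (measurable_const.sub (measurable_C i j ρ)).ennreal_ofReal]
    congr 1
    refine setLIntegral_congr_fun measurableSet_Ioi fun z hz => ?_
    rw [mul_comm, ENNReal.ofReal_mul (sub_nonneg.2 (C_le_one i hρ j (le_of_lt hz)))]
  have hfin : ∫⁻ z : Plane, (1 - D.clusterLaplace (D.fadedWeight i ρ) j z) ≠ ⊤ :=
    ((lintegral_one_sub_clusterLaplace_le (measurable_fadedWeight i ρ _)
      fun y => fadedWeight_le_one i ρ _ y).trans_lt (ENNReal.mul_lt_top ENNReal.ofReal_lt_top
        (lintegral_one_sub_fadedWeight_ne_top i hρ.le _).lt_top)).ne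
  have h3 := integrable_and_ofReal_integral (μ := volume.restrict (Ioi (0 : ℝ)))
    (f := fun z => (1 - D.C j i ρ z) * z)
    (((measurable_const.sub (measurable_C i j ρ)).mul measurable_id).aestronglyMeasurable)
    (by
      filter_upwards [ae_restrict_mem measurableSet_Ioi] with z hz
      exact mul_nonneg (sub_nonneg.2 (C_le_one i hρ j (le_of_lt hz))) (le_of_lt hz))
    (fun htop => by
      rw [h1, htop, ENNReal.mul_top (by simpa using Real.pi_pos)] at hfin
      exact hfin rfl)
  refine ⟨h3.1, ?_⟩
  rw [h1, ← h3.2, ENNReal.ofReal_mul Real.two_pi_pos.le]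

lemma integrableOn_inv_one_add_rpow {a t₀ : ℝ} (ha : 1 < a) (ht₀ : 0 < t₀) :
    IntegrableOn (fun t : ℝ => 1 / (1 + t ^ a)) (Ioi t₀) := by
  refine (integrableOn_Ioi_rpow_of_lt (show -a < -1 by linarith) ht₀).mono'
    (Measurable.aestronglyMeasurable (by fun_prop)) ?_
  filter_upwards [ae_restrict_mem measurableSet_Ioi] with t ht
  have ht0 : 0 < t := ht₀.trans ht
  have hp := Real.rpow_pos_of_pos ht0 a
  rw [Real.norm_of_nonneg (by positivity), Real.rpow_neg ht0.le, ← one_div]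
  exact one_div_le_one_div_of_le hp (by linarith)

lemma lintegral_Ioi_comp_mul_sq {K c : ℝ} (hK : 0 < K) (hc : 0 < c) (F : ℝ → ℝ≥0∞) :
    ∫⁻ y in Ioi c, ENNReal.ofReal y * F (K * y ^ 2) =
      ENNReal.ofReal (1 / (2 * K)) * ∫⁻ t in Ioi (K * c ^ 2), F t := by
  have himg : (fun y : ℝ => K * y ^ 2) '' Ioi c = Ioi (K * c ^ 2) := by
    ext t
    constructor
    · rintro ⟨y, hy, rfl⟩
      have : c < y := hy
      exact mul_lt_mul_of_pos_left (by gcongr) hK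
    · intro ht
      have ht' : K * c ^ 2 < t := ht
      have h1 : c ^ 2 < t / K := by rw [lt_div_iff₀ hK]; linarith
      refine ⟨Real.sqrt (t / K), Real.lt_sqrt_of_sq_lt h1, ?_⟩
      simp only
      rw [Real.sq_sqrt ((sq_nonneg c).trans h1.le)]
      field_simp
  rw [← himg, lintegral_image_eq_lintegral_abs_deriv_mul (f' := fun y => K * (2 * y))
    measurableSet_Ioi (fun y _ => by
      simpa using ((hasDerivAt_pow 2 y).const_mul K).hasDerivWithinAt)
    (fun x hx y hy h => by
      have hx' : 0 < x := hc.trans hx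
      have hy' : 0 < y := hc.trans hy
      simp only [mul_eq_mul_left_iff, hK.ne', or_false] at h
      exact (sq_eq_sq₀ hx'.le hy'.le).1 h),
    ← lintegral_const_mul' _ _ ENNReal.ofReal_ne_top]
  refine setLIntegral_congr_fun measurableSet_Ioi fun y hy => ?_
  have hy' : 0 < y := hc.trans hy
  rw [← mul_assoc, ← ENNReal.ofReal_mul (by positivity), abs_of_pos (by positivity)]
  congr 2
  field_simp

include hρ in
-- The exclusion disc contributes its area, the summand `1` of `rho`; the interference outside
-- contributes the integral in `rho`.
lemma lintegral_one_sub_fadedWeight (j : κ₁ ⊕ κ₂) :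
    ∫⁻ y, (1 - D.fadedWeight i ρ j y) =
      ENNReal.ofReal (Real.pi * (D.Pbar j i * ρ) ^ 2 * rho (D.τ i) D.α) := by
  set c := D.Pbar j i * ρ with hcdef
  have hc : 0 < c := mul_pos (Pbar_pos _ i) hρ
  have hτ := D.τ_pos i
  have hα := D.α_pos
  have hα2 := D.two_lt_α
  set t₀ := D.τ i ^ (-2 / D.α) with ht₀
  have ht₀pos : 0 < t₀ := Real.rpow_pos_of_pos hτ _
  -- Under `t = K * y ^ 2` the boundary `y = c` becomes `t₀`, and `t ^ (α / 2)` becomes `(y / c) ^ α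
  -- / τ`, so the integrand is `1 / (1 + t ^ (α / 2))`.
  set K := t₀ / c ^ 2 with hKdef
  have hK : 0 < K := by positivity
  have hint := integrableOn_inv_one_add_rpow (a := D.α / 2) (by linarith) ht₀pos
  have hw : ∀ y ∈ Ioi c, ENNReal.ofReal y * (1 - D.radialWeight i ρ j y) =
      ENNReal.ofReal y * ENNReal.ofReal (1 / (1 + (K * y ^ 2) ^ (D.α / 2))) := fun y hy => by
    have hy0 : 0 < y := hc.trans hy
    rw [radialWeight_of_le i hρ j (le_of_lt hy), ← hcdef, ← ENNReal.ofReal_one,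
      ← ENNReal.ofReal_sub _ (by positivity)]
    congr 2
    have h1 : (y ^ 2) ^ (D.α / 2) = y ^ D.α := by
      rw [← Real.rpow_natCast, ← Real.rpow_mul hy0.le]
      congr 1; push_cast; ring
    have h2 : (c ^ 2) ^ (D.α / 2) = c ^ D.α := by
      rw [← Real.rpow_natCast, ← Real.rpow_mul hc.le]
      congr 1; push_cast; ring
    have h3 : t₀ ^ (D.α / 2) = (D.τ i)⁻¹ := by
      rw [ht₀, ← Real.rpow_mul hτ.le, ← Real.rpow_neg_one]
      congr 1
      field_simp
    rw [Real.mul_rpow hK.le (by positivity), hKdef, Real.div_rpow ht₀pos.le (by positivity), h1, h2,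
      h3]
    have := Real.rpow_pos_of_pos hy0 D.α
    have := Real.rpow_pos_of_pos hc D.α
    field_simp
    ring
  have hI1 : ∫⁻ y in Ioo 0 c, ENNReal.ofReal y * (1 - D.radialWeight i ρ j y) =
      ENNReal.ofReal (c ^ 2 / 2) := by
    rw [setLIntegral_congr_fun (g := fun y => ENNReal.ofReal y) measurableSet_Ioo fun y hy => by
        rw [radialWeight_of_lt i _ hy.1 hy.2, tsub_zero, mul_one],
      restrict_Ioo_eq_restrict_Ioc, ← ofReal_integral_eq_lintegral_ofReal,
      ← intervalIntegral.integral_of_le hc.le, integral_id]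
    · congr 1; ring
    · exact continuous_id.integrableOn_Ioc
    · filter_upwards [ae_restrict_mem measurableSet_Ioc] with y hy
      exact hy.1.le
  have hI2 : ∫⁻ y in Ioi c, ENNReal.ofReal y * (1 - D.radialWeight i ρ j y) =
      ENNReal.ofReal (1 / (2 * K) * ∫ t in Ioi t₀, 1 / (1 + t ^ (D.α / 2))) := by
    rw [setLIntegral_congr_fun measurableSet_Ioi hw, lintegral_Ioi_comp_mul_sq hK hc
      fun t => ENNReal.ofReal (1 / (1 + t ^ (D.α / 2))), ENNReal.ofReal_mul (by positivity),
      ofReal_integral_eq_lintegral_ofReal hint]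
    · rw [hKdef, div_mul_cancel₀ _ (by positivity)]
    · filter_upwards [ae_restrict_mem measurableSet_Ioi] with t ht
      have : 0 < t := ht₀pos.trans ht
      exact (by positivity : 0 ≤ 1 / (1 + t ^ (D.α / 2)))
  have hJ : 0 ≤ ∫ t in Ioi t₀, 1 / (1 + t ^ (D.α / 2)) :=
    setIntegral_nonneg measurableSet_Ioi fun t ht => by
      have : 0 < t := ht₀pos.trans ht
      positivity
  have hpol := lintegral_plane_norm (Φ := fun y => 1 - D.radialWeight i ρ j y)
    (measurable_const.sub (measurable_radialWeight i ρ j))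
  refine hpol.trans ?_
  rw [← Ioo_union_Ici_eq_Ioi hc, lintegral_union measurableSet_Ici
      (Set.disjoint_left.2 fun y hy hy' => not_lt.2 hy' hy.2), ← restrict_Ioi_eq_restrict_Ici,
    hI1, hI2, ← ENNReal.ofReal_add (by positivity) (by positivity), ← ENNReal.ofReal_mul
      (by positivity), rho, ← ht₀]
  congr 1
  have hinv : D.τ i ^ (2 / D.α) = t₀⁻¹ := by
    rw [ht₀, ← Real.rpow_neg hτ.le]
    congr 1; ring
  rw [hinv, hKdef]
  field_simp

end HetNet

end ClosedForm

/-! ### The coverage probabilities of the tiers -/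

section Final

variable {κ₁ κ₂ : Type*} {D : HetNet κ₁ κ₂}

namespace HetNet

/-- Symmetry in point and center rewrites the planar integral over cluster centers as an integral
over their distance `z`. Finiteness holds for every `r > 0`, as the density `g` around `x` has mass
one. -/
lemma integrableOn_fd_mul_C_mul (k : κ₁) (i : κ₁ ⊕ κ₂) {r : ℝ} (hr : 0 < r) {x : Plane}
    (hx : ‖x‖ = r) :
    IntegrableOn (fun z => D.fd k r z * D.C k i r z * z) (Ioi 0) ∧
    ENNReal.ofReal (∫ z in Ioi (0 : ℝ), D.fd k r z * D.C k i r z * z) = ENNReal.ofReal r *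
      ∫⁻ z, ENNReal.ofReal (D.g k (x - z)) * D.clusterLaplace (D.fadedWeight i r) k z := by
  have hC := measurable_C (D := D) i k r
  have h1 : ENNReal.ofReal r *
      ∫⁻ z, ENNReal.ofReal (D.g k (x - z)) * D.clusterLaplace (D.fadedWeight i r) k z =
      ∫⁻ z in Ioi (0 : ℝ), ENNReal.ofReal (D.fd k r z * D.C k i r z * z) := by
    simp_rw [clusterLaplace_fadedWeight i hr]
    rw [← hx, ← lintegral_fd_mul_center k (Ψ := fun z => ENNReal.ofReal (D.C k i ‖x‖ z))
      (hx ▸ hC.ennreal_ofReal)]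
    refine setLIntegral_congr_fun measurableSet_Ioi fun z hz => ?_
    have hf := fd_nonneg (D := D) k (norm_nonneg x) z
    rw [← ENNReal.ofReal_mul hf, ← ENNReal.ofReal_mul (mul_nonneg hf (le_of_lt hz))]
    congr 1; ring
  rw [h1]
  refine integrable_and_ofReal_integral ?_ ?_ ?_
  · exact ((((measurable_fd k).comp (measurable_const.prodMk measurable_id)).mul hC).mul
      measurable_id).aestronglyMeasurable
  · filter_upwards [ae_restrict_mem measurableSet_Ioi] with z hz
    exact mul_nonneg (mul_nonneg (fd_nonneg k hr.le z) (C_nonneg i k r z)) (le_of_lt hz)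
  · rw [← h1]
    refine ENNReal.mul_ne_top ENNReal.ofReal_ne_top (lt_of_le_of_lt (lintegral_mono fun z =>
      mul_le_of_le_one_right' (clusterLaplace_le_one k z)) ?_).ne
    rw [lintegral_g_sub_left]
    exact ENNReal.one_lt_top

variable [Fintype κ₁] [Fintype κ₂]

lemma commonFactor_pos (i : κ₁ ⊕ κ₂) (r : ℝ) : 0 < D.commonFactor i r :=
  mul_pos (mul_pos (Real.exp_pos _) (Finset.prod_pos fun _ _ => Real.exp_pos _)) (Real.exp_pos _)

lemma rho_nonneg {τ α : ℝ} (hτ : 0 < τ) : 0 ≤ rho τ α := by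
  refine add_nonneg zero_le_one (mul_nonneg (Real.rpow_nonneg hτ.le _)
    (setIntegral_nonneg measurableSet_Ioi fun t ht => ?_))
  have : 0 < t := (Real.rpow_pos_of_pos hτ _).trans ht
  positivity

lemma ofReal_commonFactor (i : κ₁ ⊕ κ₂) {r : ℝ} (hr : 0 < r) :
    expNeg (ENNReal.ofReal (D.scale i r) * ENNReal.ofReal D.N₀) *
      ∏ j, D.tierLaplace (D.fadedWeight i r) j = ENNReal.ofReal (D.commonFactor i r) := by
  have hs := scale_nonneg (D := D) i hr.le
  have h1 : expNeg (ENNReal.ofReal (D.scale i r) * ENNReal.ofReal D.N₀) =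
      ENNReal.ofReal (Real.exp (-(D.τ i * D.N₀ * r ^ D.α / D.P i))) := by
    rw [← ENNReal.ofReal_mul hs, expNeg_ofReal (mul_nonneg hs D.N₀_nonneg), scale]
    congr 3; ring
  have h2 : ∀ j, D.tierLaplace (D.fadedWeight i r) (.inl j) = ENNReal.ofReal (Real.exp
      (-(2 * Real.pi * D.lamP j * ∫ z in Ioi (0 : ℝ), (1 - D.C j i r z) * z))) := fun j => by
    have hI : 0 ≤ ∫ z in Ioi (0 : ℝ), (1 - D.C j i r z) * z :=
      setIntegral_nonneg measurableSet_Ioi fun z hz =>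
        mul_nonneg (sub_nonneg.2 (C_le_one i hr j (le_of_lt hz))) (le_of_lt hz)
    have hl := (D.lamP_pos j).le
    rw [tierLaplace, (integrableOn_one_sub_C_mul i hr j).2, ← ENNReal.ofReal_mul hl,
      expNeg_ofReal (by positivity)]
    congr 3; ring
  have h3 : ∀ j, D.tierLaplace (D.fadedWeight i r) (.inr j) = ENNReal.ofReal (Real.exp
      (-(Real.pi * r ^ 2 * (D.lam j * D.Pbar (.inr j) i ^ 2 * rho (D.τ i) D.α)))) := fun j => by
    have hl := (D.lam_pos j).le
    have hρ := rho_nonneg (α := D.α) (D.τ_pos i)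
    rw [tierLaplace, lintegral_one_sub_fadedWeight i hr, ← ENNReal.ofReal_mul hl,
      expNeg_ofReal (by positivity)]
    congr 3; ring
  rw [Fintype.prod_sum_type, h1]
  simp_rw [h2, h3]
  rw [← ENNReal.ofReal_prod_of_nonneg fun _ _ => (Real.exp_pos _).le,
    ← ENNReal.ofReal_prod_of_nonneg fun _ _ => (Real.exp_pos _).le,
    ← ENNReal.ofReal_mul (Finset.prod_nonneg fun _ _ => (Real.exp_pos _).le),
    ← ENNReal.ofReal_mul (Real.exp_pos _).le, commonFactor, Finset.mul_sum,
    ← Finset.sum_neg_distrib (f := fun j => Real.pi * r ^ 2 * _),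
    Real.exp_sum Finset.univ fun j => -(Real.pi * r ^ 2 * _)]
  exact congrArg _ (mul_assoc _ _ _).symm

variable (D) in
/-- The density of the distance to the serving base station, if that base station belongs to tier
`i` and the user is in coverage. -/
noncomputable def tierIntegrand : κ₁ ⊕ κ₂ → ℝ → ℝ
  | .inl k, r => 2 * Real.pi * D.lamP k * D.mbar k * D.clusterIntegrand k r
  | .inr k, r => 2 * Real.pi * D.lam k * D.poissonIntegrand k r

/-- The factor `2 * π * r` is the circumference of the circle on which `x` varies. The left-hand
side does not involve `x`, so the coverage density is radial. -/
lemma ofReal_tierIntegrand (i : κ₁ ⊕ κ₂) {r : ℝ} (hr : 0 < r) {x : Plane} (hx : ‖x‖ = r) :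
    ENNReal.ofReal (D.tierIntegrand i r) =
      ENNReal.ofReal (2 * Real.pi) * (ENNReal.ofReal r * D.coverageDensity i r x) := by
  have hc := (commonFactor_pos (D := D) i r).le
  have h : D.coverageDensity i r x =
      ENNReal.ofReal (D.commonFactor i r) * D.palmDensity (D.fadedWeight i r) i x := by
    rw [coverageDensity, ← ofReal_commonFactor i hr]
    ring
  rw [h]
  cases i with
  | inl k =>
    have h1 := (D.lamP_pos k).le
    have h2 := (D.mbar_pos k).le
    rw [tierIntegrand, clusterIntegrand, palmDensity, ENNReal.ofReal_mul (by positivity),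
      ENNReal.ofReal_mul (by positivity), ENNReal.ofReal_mul (by positivity), ENNReal.ofReal_mul hc,
      (integrableOn_fd_mul_C_mul k (.inl k) hr hx).2]
    ring
  | inr k =>
    have h1 := (D.lam_pos k).le
    rw [tierIntegrand, poissonIntegrand, palmDensity, ENNReal.ofReal_mul (by positivity),
      ENNReal.ofReal_mul (by positivity), ENNReal.ofReal_mul hc]
    ring

lemma tierIntegrand_nonneg (i : κ₁ ⊕ κ₂) {r : ℝ} (hr : 0 < r) : 0 ≤ D.tierIntegrand i r := by
  have hc := (commonFactor_pos (D := D) i r).le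
  cases i with
  | inl k =>
    have h1 := (D.lamP_pos k).le
    have h2 := (D.mbar_pos k).le
    refine mul_nonneg (by positivity) (mul_nonneg hc
      (setIntegral_nonneg measurableSet_Ioi fun z hz => ?_))
    exact mul_nonneg (mul_nonneg (fd_nonneg k hr.le z) (C_nonneg _ k r z)) (le_of_lt hz)
  | inr k =>
    have h1 := (D.lam_pos k).le
    exact mul_nonneg (by positivity) (mul_nonneg hc hr.le)

/-- A measurable version of the coverage density as a function of the distance. -/
lemma exists_measurable_radial (i : κ₁ ⊕ κ₂) : ∃ Φ : ℝ → ℝ≥0∞, Measurable Φ ∧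
    ∀ r, 0 < r → ∀ x : Plane, ‖x‖ = r → D.coverageDensity i r x = Φ r := by
  let p : ℝ → Plane := fun r => !₂[r * Real.cos 0, r * Real.sin 0]
  have hp : Measurable p := measurePreserving_plane.measurable.comp
    (f := fun r : ℝ => (r * Real.cos 0, r * Real.sin 0)) (by fun_prop)
  let Φ : ℝ → ℝ≥0∞ := fun r => (Ioi (0 : ℝ)).indicator (fun r => D.coverageDensity i r (p r)) r
  -- Rounding the radius to a countable set makes the density measurable along a ray; continuity in
  -- the radius then gives measurability of the pointwise limit.
  let Φn : ℕ → ℝ → ℝ≥0∞ := fun n => (Ioi (0 : ℝ)).indicator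
    fun r => D.coverageDensity i ((radialCell n (p r) : ℝ) / (n + 1)) (p r)
  have hpn : ∀ r, 0 < r → ‖p r‖ = r := fun r hr => by simp only [p, norm_polar, abs_of_pos hr]
  refine ⟨Φ, measurable_of_tendsto_metrizable (f := Φn) (fun n => ?_) (tendsto_pi_nhds.2
    fun r => ?_), fun r hr x hx => ?_⟩
  · exact Measurable.indicator ((measurable_coverageDensity_comp i (measurable_radialCell n)
      fun k => (k : ℝ) / (n + 1)).comp hp) measurableSet_Ioi
  · by_cases hr : r ∈ Ioi (0 : ℝ)
    · simp only [Φ, Φn, indicator_of_mem hr]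
      have h := tendsto_radialCell_div (p r)
      rw [hpn r hr] at h
      exact tendsto_coverageDensity i hr (fun n => by positivity) h (p r)
    · simp only [Φ, Φn, indicator_of_notMem hr]
      exact tendsto_const_nhds
  -- The integrand has the same value at `x` and at the reference point `p r`; cancelling the
  -- positive factors shows that the densities agree.
  · have h1 := ofReal_tierIntegrand (D := D) i hr hx
    rw [ofReal_tierIntegrand i hr (hpn r hr),
      ENNReal.mul_right_inj (by simpa using Real.pi_pos) ENNReal.ofReal_ne_top,
      ENNReal.mul_right_inj (by simpa using hr) ENNReal.ofReal_ne_top] at h1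
    simp only [Φ, indicator_of_mem (show r ∈ Ioi (0 : ℝ) from hr), h1]

lemma lintegral_tierIntegrand (i : κ₁ ⊕ κ₂) :
    AEStronglyMeasurable (D.tierIntegrand i) (volume.restrict (Ioi 0)) ∧
    ∫⁻ r in Ioi (0 : ℝ), ENNReal.ofReal (D.tierIntegrand i r) =
      ∫⁻ x, D.coverageDensity i ‖x‖ x := by
  obtain ⟨Φ, hΦ, h⟩ := exists_measurable_radial (D := D) i
  have h1 : ∀ r ∈ Ioi (0 : ℝ), ENNReal.ofReal (D.tierIntegrand i r) =
      ENNReal.ofReal (2 * Real.pi) * (ENNReal.ofReal r * Φ r) := fun r hr => by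
    obtain ⟨x, hx⟩ := exists_norm_eq_of_nonneg (le_of_lt hr)
    rw [ofReal_tierIntegrand i hr hx, h r hr x hx]
  constructor
  · have hm : Measurable fun r =>
        (ENNReal.ofReal (2 * Real.pi) * (ENNReal.ofReal r * Φ r)).toReal := by fun_prop
    refine hm.aestronglyMeasurable.congr ?_
    filter_upwards [ae_restrict_mem measurableSet_Ioi] with r hr
    rw [← h1 r hr, ENNReal.toReal_ofReal (tierIntegrand_nonneg i hr)]
  · rw [setLIntegral_congr_fun measurableSet_Ioi h1, lintegral_const_mul' _ _ ENNReal.ofReal_ne_top,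
      ← lintegral_plane_norm hΦ]
    refine lintegral_congr_ae ?_
    filter_upwards [measure_eq_zero_iff_ae_notMem.1 (measure_singleton (0 : Plane))] with x hx
    exact (h ‖x‖ (norm_pos_iff.2 hx) x rfl).symm

end HetNet

open HetNet

variable [Fintype κ₁] [Fintype κ₂] {Ω : Type*} [mΩ : MeasurableSpace Ω] {μ : Measure Ω}
  [IsProbabilityMeasure μ] {R : Realization Ω κ₁ κ₂}

lemma measureReal_tierCoverage (hR : R.IsUncoupled D μ) (i : κ₁ ⊕ κ₂) :
    IntegrableOn (D.tierIntegrand i) (Ioi 0) ∧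
    μ.real (R.tierCoverage D i) = ∫ r in Ioi (0 : ℝ), D.tierIntegrand i r := by
  have h := lintegral_tierIntegrand (D := D) i
  have h0 : ∀ᵐ r ∂(volume.restrict (Ioi (0 : ℝ))), 0 ≤ D.tierIntegrand i r := by
    filter_upwards [ae_restrict_mem measurableSet_Ioi] with r hr
    exact tierIntegrand_nonneg i hr
  rw [← measure_tierCoverage hR i] at h
  have h2 := integrable_and_ofReal_integral h.1 h0 (h.2 ▸ measure_ne_top _ _)
  refine ⟨h2.1, ?_⟩
  rw [measureReal_def, ← h.2, ← h2.2, ENNReal.toReal_ofReal (integral_nonneg_of_ae h0)]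

end Final

end

theorem theorem1 {κ₁ κ₂ : Type*} [Fintype κ₁] [Fintype κ₂] (D : HetNet κ₁ κ₂)
    {Ω : Type*} [MeasurableSpace Ω] (μ : Measure Ω) [IsProbabilityMeasure μ]
    (R : Realization Ω κ₁ κ₂) (hR : R.IsUncoupled D μ) :
    μ.real (R.coverage D) = ∑ i, μ.real (R.tierCoverage D i) ∧
    (∀ i : κ₁,
      IntegrableOn (D.clusterIntegrand i) (Ioi 0) ∧
      μ.real (R.tierCoverage D (.inl i)) =
        2 * Real.pi * D.lamP i * D.mbar i * ∫ r in Ioi (0 : ℝ), D.clusterIntegrand i r) ∧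
    (∀ i : κ₂,
      IntegrableOn (D.poissonIntegrand i) (Ioi 0) ∧
      μ.real (R.tierCoverage D (.inr i)) =
        2 * Real.pi * D.lam i * ∫ r in Ioi (0 : ℝ), D.poissonIntegrand i r) ∧
    (∀ (j : κ₁) (i : κ₁ ⊕ κ₂) (r : ℝ), 0 < r →
      IntegrableOn (fun z => (1 - D.C j i r z) * z) (Ioi 0)) ∧
    (∀ (i : κ₁) (r : ℝ), 0 < r →
      IntegrableOn (fun z => D.fd i r z * D.C i (.inl i) r z * z) (Ioi 0)) := by
  refine ⟨measure_coverage hR, fun i => ?_, fun i => ?_,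
    fun j i r hr => (HetNet.integrableOn_one_sub_C_mul i hr j).1, fun i r hr => ?_⟩
  · have h := measureReal_tierCoverage hR (.inl i)
    have hc : 2 * Real.pi * D.lamP i * D.mbar i ≠ 0 := by
      have := D.lamP_pos i
      have := D.mbar_pos i
      positivity
    exact ⟨(integrable_const_mul_iff hc.isUnit _).1 h.1,
      h.2.trans (integral_const_mul _ _)⟩
  · have h := measureReal_tierCoverage hR (.inr i)
    have hc : 2 * Real.pi * D.lam i ≠ 0 := by
      have := D.lam_pos i
      positivity
    exact ⟨(integrable_const_mul_iff hc.isUnit _).1 h.1,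
      h.2.trans (integral_const_mul _ _)⟩
  · obtain ⟨x, hx⟩ := HetNet.exists_norm_eq_of_nonneg hr.le
    exact (HetNet.integrableOn_fd_mul_C_mul i (.inl i) hr hx).1
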